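/- **Setting.** Let $n\ge 1$ and let $G=(\mathbb R^n,*_G)$ be a rational stratified Lie group of step at most two in exponential coordinates: $\mathbb R^n$ carries a Lie bracket and a decomposition $\mathbb R^n=V_1\oplus V_2$ with $[V_1,V_1]=V_2$, $[V_1,V_2]=0$ ($V_2=0$ allowed), some basis has rational structure constants, and $x*_Gy=x+y+\tfrac12[x,y]$. Dilations are $D_r(v_1+v_2)=rv_1+r^2v_2$, and $Q=\dim V_1+2\dim V_2$. A homogeneous quasi-norm is a continuous $\|\cdot\|:\mathbb R^n\to[0,\infty)$ with $\|D_rx\|=r\|x\|$ for $r>0$ and $\|-x\|=\|x\|$, vanishing only at $0$; $B(c,R)=\{h:\|c^{-1}*_Gh\|<R\}$. A lattice $N\subset G$ is a discrete subgroup such that $G/N$ has a nonzero finite $G$-invariant Borel measure. **Coverings.** A covering $(Q_i)_{i\in I}$ of $\mathbb R^n$ by non-empty sets is admissible if $\sup_i\#\{j:Q_i\cap Q_j\neq\emptyset\}<\infty$. Let $Q_i^{0*}=Q_i$, and let $Q_i^{k*}$ be the union of the sets $Q_j$ that can be reached from $Q_i$ in $k$ steps, each step going from a member of the covering to one that meets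 it. Put $d_{\mathcal Q}(x,x)=0$, and for $x\ne y$ let $d_{\mathcal Q}(x,y)$ be the least $m\geq 1$ such that there are $Q_{i_1}\ni x,\dots,Q_{i_m}\ni y$ with consecutive sets intersecting. A generalized $0$-covering is an admissible covering by open connected sets $P_i$ with $|P_i|\asymp1$ uniformly in $i$ and $\sup_i R(P_i)/r(P_i)<\infty$, where $r(P_i)$ and $R(P_i)$ are the supremum of the radii of balls $B(c,r)$ contained in $P_i$ and the infimum of the radii of balls $B(c,R)$ containing $P_i$. For a lattice $N$ and $R>0$ such that it is an admissible covering, $\mathcal U(G;N)=(B(m,R))_{m\in N\setminus\{0\}}$ is a lattice covering. A $\mathcal Q$-BAPU is a family of non-negative $\psi_i\in C_c^\infty(\mathbb R^n)$ with $\operatorname{supp}\psi_i\subset Q_i$, $\sum_i\psi_i\equiv1$ and $\sup_i\|\mathcal F^{-1}\psi_i\|_{L^1}<\infty$. **Spaces.** Let $Z(\mathbb R^n)=\mathcal F(C_c^\infty(\mathbb R^n))$ with the topology transported from $C_c^\infty(\mathbb R^n)$, and let $Z'(\mathbb R^n)$ be its dual. For $1\le p,q<\infty$, a generalized $0$-covering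 $(P_i)$ and a BAPU $(\varphi_i)$ subordinate to it, the standard modulation space $M_{p,q}(G)=M^{0,0}_{p,q}(G)$ consists of all $f\in Z'(\mathbb R^n)$ with $$\|f\|_{M_{p,q}(G)}=\Big(\sum_i\|\mathcal F^{-1}(\varphi_i\cdot\mathcal F f)\|_{L^p}^q\Big)^{1/q}<\infty .$$ The Feichtinger algebra is $\mathcal S_0(\mathbb R)=M_{1,1}(\mathbb R)$, the case $G=(\mathbb R,+)$. For a lattice covering $\mathcal U(G;N)=(Q_m)$ with a BAPU $(\psi_m)$, the essential support of $f\in M_{p,q}(G)$ is $\mathcal C[f]=\bigcup\{Q_m:\|\mathcal F^{-1}(\psi_m\cdot\mathcal Ff)\|_{L^p}\ne0\}$. **Geometric embeddings.** Let $\mathcal Q=(Q_i)$ and $\mathcal Q'$ be the lattice coverings of $\mathbb R$ and of $G$. An injective bounded linear map $F:\mathcal S_0(\mathbb R)\to M_{p,q}(G)$ is a geometric embedding if there is $L>0$ and for every $k\in\mathbb N_0$ there is $C_k>0$ such that, whenever $\mathcal C[f]\subset Q_i^{k*}$ and $\mathcal C[g]\subset Q_j^{k*}$, $$\tfrac1L\,d_{\mathcal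 Q}(x,y)-C_k\le d_{\mathcal Q'}(z,w)\le L\,d_{\mathcal Q}(x,y)+C_k$$ for all $x\in Q_i^{k*}$, $y\in Q_j^{k*}$, $z\in\mathcal C[F(f)]$, $w\in\mathcal C[F(g)]$. **Statement.** For every $G$ as above and all $1\le p,q<\infty$, the Feichtinger algebra embeds geometrically into $M_{p,q}(G)$: for every choice, on $\mathbb R$ and on $G$, of the quasi-norm, the generalized $0$-covering, the lattice covering and the two BAPUs, there is a geometric embedding $F:\mathcal S_0(\mathbb R)\to M_{p,q}(G)$. -/

import Mathlib

open MeasureTheory Set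
open scoped ENNReal NNReal FourierTransform SchwartzMap Distributions ContDiff

noncomputable section

/-! ### Stratified Lie groups of step at most two, in exponential coordinates -/

/-- A stratified Lie group of step at most two, realised on its Lie algebra through the exponential
map: a Lie bracket on the vector space `E` with a stratification `E = V₁ ⊕ V₂`, `[V₁, V₁] = V₂`,
`[V₁, V₂] = 0`. Step one is the case `V₂ = 0`. -/
structure StratifiedGroup (E : Type*) [AddCommGroup E] [Module ℝ E] where
  /-- The Lie bracket. -/
  bracket : E →ₗ[ℝ] E →ₗ[ℝ] E
  bracket_self : ∀ x, bracket x x = 0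
  jacobi : ∀ x y z,
    bracket x (bracket y z) + bracket y (bracket z x) + bracket z (bracket x y) = 0
  /-- The first layer. -/
  V₁ : Submodule ℝ E
  /-- The second layer. -/
  V₂ : Submodule ℝ E
  isCompl : IsCompl V₁ V₂
  span_bracket : Submodule.span ℝ {z | ∃ x ∈ V₁, ∃ y ∈ V₁, bracket x y = z} = V₂
  bracket_V₁_V₂ : ∀ x ∈ V₁, ∀ y ∈ V₂, bracket x y = 0

namespace StratifiedGroup

section Algebra

variable {E : Type*} [AddCommGroup E] [Module ℝ E] (G : StratifiedGroup E)

/-- The additive group of a vector space: the stratified group with zero bracket. -/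
def abelian (E : Type*) [AddCommGroup E] [Module ℝ E] : StratifiedGroup E where
  bracket := 0
  bracket_self _ := rfl
  jacobi _ _ _ := by simp
  V₁ := ⊤
  V₂ := ⊥
  isCompl := isCompl_top_bot
  span_bracket := by
    refine le_antisymm (Submodule.span_le.2 ?_) bot_le
    rintro z ⟨x, -, y, -, rfl⟩
    simp
  bracket_V₁_V₂ _ _ _ _ := rfl

theorem bracket_skew (x y : E) : G.bracket x y = -G.bracket y x := by
  have h := G.bracket_self (x + y)
  simp only [map_add, LinearMap.add_apply, G.bracket_self, zero_add, add_zero] at h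
  exact eq_neg_of_add_eq_zero_right h

theorem bracket_central (x : E) {z : E} (hz : z ∈ G.V₂) : G.bracket x z = 0 := by
  have key : ∀ u ∈ G.V₂, ∀ z ∈ G.V₂, G.bracket u z = 0 := by
    intro u hu z hz
    rw [← G.span_bracket] at hu
    induction hu using Submodule.span_induction with
    | mem u hu =>
      obtain ⟨a, ha, b, hb, rfl⟩ := hu
      have h := G.jacobi a b z
      rw [G.bracket_V₁_V₂ b hb z hz, G.bracket_skew z a, G.bracket_V₁_V₂ a ha z hz] at h
      rw [G.bracket_skew]
      simpa using h
    | zero => simp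
    | add u v _ _ hu hv => simp [hu, hv]
    | smul c u _ hu => simp [hu]
  have hx : x ∈ G.V₁ ⊔ G.V₂ := by rw [G.isCompl.sup_eq_top]; trivial
  obtain ⟨a, ha, b, hb, rfl⟩ := Submodule.mem_sup.1 hx
  simp [G.bracket_V₁_V₂ a ha z hz, key b hb z hz]

theorem bracket_mem (x y : E) : G.bracket x y ∈ G.V₂ := by
  have hx : x ∈ G.V₁ ⊔ G.V₂ := by rw [G.isCompl.sup_eq_top]; trivial
  have hy : y ∈ G.V₁ ⊔ G.V₂ := by rw [G.isCompl.sup_eq_top]; trivial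
  obtain ⟨a, ha, b, hb, rfl⟩ := Submodule.mem_sup.1 hx
  obtain ⟨c, hc, d, hd, rfl⟩ := Submodule.mem_sup.1 hy
  have h1 : G.bracket b c = 0 := by rw [G.bracket_skew, G.bracket_central c hb, neg_zero]
  simp only [map_add, LinearMap.add_apply, G.bracket_central _ hd, h1, add_zero]
  rw [← G.span_bracket]
  exact Submodule.subset_span ⟨a, ha, c, hc, rfl⟩

/-- The group law; in step at most two the Baker-Campbell-Hausdorff series stops after the first
bracket. -/
def mul (x y : E) : E := x + y + (1 / 2 : ℝ) • G.bracket x y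

theorem mul_assoc' (x y z : E) : G.mul (G.mul x y) z = G.mul x (G.mul y z) := by
  have h1 : G.bracket (G.bracket x y) z = 0 := by
    rw [G.bracket_skew, G.bracket_central _ (G.bracket_mem x y), neg_zero]
  have h2 : G.bracket x (G.bracket y z) = 0 := G.bracket_central _ (G.bracket_mem y z)
  simp only [mul, map_add, map_smul, LinearMap.add_apply, LinearMap.smul_apply, h1, h2,
    smul_zero, add_zero, smul_add]
  abel

/-- The group `(E, *_G)`. -/
@[ext]
structure Carrier (G : StratifiedGroup E) where
  /-- The underlying vector (exponential coordinates). -/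
  toVec : E

instance : Group G.Carrier where
  mul x y := ⟨G.mul x.toVec y.toVec⟩
  one := ⟨0⟩
  inv x := ⟨-x.toVec⟩
  mul_assoc x y z := Carrier.ext (G.mul_assoc' _ _ _)
  one_mul x := Carrier.ext (by change G.mul 0 x.toVec = x.toVec; simp [mul])
  mul_one x := Carrier.ext (by change G.mul x.toVec 0 = x.toVec; simp [mul])
  inv_mul_cancel x :=
    Carrier.ext (by change G.mul (-x.toVec) x.toVec = 0; simp [mul, G.bracket_self])

/-- The dilations `D_r`, equal to `r ^ j` on the layer of degree `j`. -/
def dilation (r : ℝ) : E →ₗ[ℝ] E :=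
  r • (G.V₁.subtype ∘ₗ G.V₁.projectionOnto G.V₂ G.isCompl) +
    (r ^ 2) • (G.V₂.subtype ∘ₗ G.V₂.projectionOnto G.V₁ G.isCompl.symm)

/-- The homogeneous dimension `dim V₁ + 2 dim V₂`. -/
def homDim : ℕ := Module.finrank ℝ G.V₁ + 2 * Module.finrank ℝ G.V₂

/-- The group is rational: some basis of the Lie algebra has rational structure constants. -/
def IsRational : Prop :=
  ∃ b : Module.Basis (Fin (Module.finrank ℝ E)) ℝ E,
    ∀ i j k, ∃ c : ℚ, b.repr (G.bracket (b i) (b j)) k = (c : ℝ)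

/-- The ball `B(c, R) = {h | ‖c⁻¹ * h‖ < R}` of a quasi-norm `ν`. -/
def ball (ν : E → ℝ) (c : E) (R : ℝ) : Set E := {h | ν (G.mul (-c) h) < R}

end Algebra

section Topology

variable {E : Type*} [NormedAddCommGroup E] [NormedSpace ℝ E] (G : StratifiedGroup E)

instance : TopologicalSpace G.Carrier := TopologicalSpace.induced Carrier.toVec inferInstance

/-- `ν` is a homogeneous quasi-norm on `G`. -/
structure IsQuasiNorm (ν : E → ℝ) : Prop where
  continuous : Continuous ν
  nonneg : ∀ x, 0 ≤ ν x
  homogeneous : ∀ r : ℝ, 0 < r → ∀ x, ν (G.dilation r x) = r * ν x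
  symmetric : ∀ x, ν (-x) = ν x
  eq_zero : ∀ x, ν x = 0 → x = 0

/-- `N` is a lattice in `G`: a discrete subgroup such that `G / N` carries a nonzero finite
`G`-invariant Borel measure. -/
def IsLattice (N : Subgroup G.Carrier) : Prop :=
  DiscreteTopology N ∧
    ∃ μ : @Measure (G.Carrier ⧸ N) (borel (G.Carrier ⧸ N)),
      μ univ ≠ 0 ∧ μ univ ≠ ⊤ ∧
        ∀ (g : G.Carrier) (A : Set (G.Carrier ⧸ N)),
          @MeasurableSet _ (borel (G.Carrier ⧸ N)) A → μ ((fun x => g • x) ⁻¹' A) = μ A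

/-- The index set `N \ {0}` of the lattice covering; the neutral element of `G` is `0`. -/
def LatticeIndex {G : StratifiedGroup E} (N : Subgroup G.Carrier) : Type _ :=
  {m : G.Carrier // m ∈ N ∧ m ≠ 1}

/-- The lattice covering `U(G; N) = (B(m, R))_{m ∈ N \ {0}}`. -/
def latticeCovering (ν : E → ℝ) (N : Subgroup G.Carrier) (R : ℝ) (m : LatticeIndex N) : Set E :=
  G.ball ν m.1.toVec R

end Topology

end StratifiedGroup

/-! ### Coverings -/

section Coverings

variable {E ι : Type*}

/-- An admissible covering of the whole space. -/
structure IsAdmissibleCovering (Q : ι → Set E) : Prop where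
  covers : ⋃ i, Q i = univ
  nonempty : ∀ i, (Q i).Nonempty
  bounded : ∃ M : ℕ, ∀ i, {j | (Q i ∩ Q j).Nonempty}.encard ≤ M

/-- Indices of the `k`-fold neighbours of `Q i`. -/
def neighbourIndices (Q : ι → Set E) (i : ι) : ℕ → Set ι
  | 0 => {i}
  | k + 1 => {j | ∃ l ∈ neighbourIndices Q i k, (Q l ∩ Q j).Nonempty}

/-- The set `Q_i^{k*}`, the union of the `k`-fold neighbours of `Q i`; `Q_i^{0*} = Q_i`. -/
def starSet (Q : ι → Set E) (i : ι) (k : ℕ) : Set E := ⋃ j ∈ neighbourIndices Q i k, Q j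

open Classical in
/-- The distance `d_Q` associated with a covering: the least number of members of a chain
`Q (c 0), …, Q (c m)` from `x` to `y`, and `0` if `x = y`. Every admissible covering of `ℝⁿ` by
open sets admits such chains. -/
def coveringDist (Q : ι → Set E) (x y : E) : ℕ :=
  if x = y then 0 else
    sInf {k | ∃ (m : ℕ) (c : ℕ → ι), k = m + 1 ∧ x ∈ Q (c 0) ∧ y ∈ Q (c m) ∧
      ∀ j < m, (Q (c j) ∩ Q (c (j + 1))).Nonempty}

end Coverings

section Analysis

variable {E : Type*} [NormedAddCommGroup E] [InnerProductSpace ℝ E] [FiniteDimensional ℝ E]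
  [MeasurableSpace E] [BorelSpace E]

/-- A generalized `α`-covering of the stratified group `G` with quasi-norm `ν`. The inner radius
`r(P i)` and the outer radius `R(P i)` are taken in `[0, ∞]`. -/
structure StratifiedGroup.IsAlphaCovering (G : StratifiedGroup E) (ν : E → ℝ) (α : ℝ) {ι : Type*}
    (P : ι → Set E) : Prop where
  admissible : IsAdmissibleCovering P
  isOpen : ∀ i, IsOpen (P i)
  isConnected : ∀ i, IsConnected (P i)
  size : ∃ a b : ℝ, 0 < a ∧ 0 < b ∧ ∀ i, ∀ ξ ∈ P i,
    ENNReal.ofReal (a * (1 + ν ξ ^ 2) ^ (α * G.homDim / 2)) ≤ volume (P i) ∧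
    volume (P i) ≤ ENNReal.ofReal (b * (1 + ν ξ ^ 2) ^ (α * G.homDim / 2))
  ratio : ∃ K : ℝ≥0, ∀ i,
    (⨅ (R : ℝ≥0) (_ : ∃ c, P i ⊆ G.ball ν c R), (R : ℝ≥0∞)) ≤
      K * ⨆ (r : ℝ≥0) (_ : ∃ c, G.ball ν c r ⊆ P i), (r : ℝ≥0∞)

/-- A bounded admissible partition of unity subordinate to `Q`, with compactly supported members
(the compact support is automatic when the members of `Q` are bounded sets). -/
structure IsBAPU {ι : Type*} (Q : ι → Set E) (ψ : ι → 𝓓((⊤ : TopologicalSpace.Opens E), ℝ)) :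
    Prop where
  nonneg : ∀ i x, 0 ≤ ψ i x
  tsupport_subset : ∀ i, tsupport (ψ i) ⊆ Q i
  hasSum_one : ∀ x, HasSum (fun i => ψ i x) 1
  bounded : ∃ C : ℝ≥0, ∀ i, eLpNorm (𝓕⁻ (fun x : E => (ψ i x : ℂ))) 1 volume ≤ C

/-! ### The Fourier type reservoir -/

/-- The Fourier transform `C_c^∞(E) → 𝓢(E)` as a linear map. -/
def fourierTest (E : Type*) [NormedAddCommGroup E] [InnerProductSpace ℝ E] [FiniteDimensional ℝ E]
    [MeasurableSpace E] [BorelSpace E] :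
    𝓓((⊤ : TopologicalSpace.Opens E), ℂ) →ₗ[ℂ] 𝓢(E, ℂ) where
  toFun φ := 𝓕 (φ.hasCompactSupport.toSchwartzMap φ.contDiff)
  map_add' φ χ := by
    rw [← FourierTransform.fourier_add]
    congr 1
  map_smul' c φ := by
    rw [RingHom.id_apply, ← FourierTransform.fourier_smul]
    congr 1

/-- The space `Z(E) = 𝓕(C_c^∞(E))`. -/
def FourierTestSpace (E : Type*) [NormedAddCommGroup E] [InnerProductSpace ℝ E]
    [FiniteDimensional ℝ E] [MeasurableSpace E] [BorelSpace E] : Type _ :=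
  LinearMap.range (fourierTest E)

instance : AddCommGroup (FourierTestSpace E) :=
  inferInstanceAs (AddCommGroup (LinearMap.range (fourierTest E)))

instance : Module ℂ (FourierTestSpace E) :=
  inferInstanceAs (Module ℂ (LinearMap.range (fourierTest E)))

/-- The Fourier transform as a (bijective) linear map `C_c^∞(E) → Z(E)`. -/
def fourierOntoZ (E : Type*) [NormedAddCommGroup E] [InnerProductSpace ℝ E]
    [FiniteDimensional ℝ E] [MeasurableSpace E] [BorelSpace E] :
    𝓓((⊤ : TopologicalSpace.Opens E), ℂ) →ₗ[ℂ] FourierTestSpace E :=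
  (fourierTest E).rangeRestrict

/-- `Z(E)` carries the topology transported from `C_c^∞(E)` by the Fourier transform. -/
instance : TopologicalSpace (FourierTestSpace E) :=
  TopologicalSpace.coinduced (fourierOntoZ E) inferInstance

/-- The Fourier type reservoir `Z'(E)`, the dual space of `Z(E)`. -/
abbrev FourierReservoir (E : Type*) [NormedAddCommGroup E] [InnerProductSpace ℝ E]
    [FiniteDimensional ℝ E] [MeasurableSpace E] [BorelSpace E] : Type _ :=
  FourierTestSpace E →L[ℂ] ℂ

/-- The Fourier transform `Z'(E) → 𝓓'(E)`, `⟨𝓕 f, φ⟩ = ⟨f, 𝓕 φ⟩`. -/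
def reservoirFourier (f : FourierReservoir E) : 𝓓((⊤ : TopologicalSpace.Opens E), ℂ) →L[ℂ] ℂ where
  toLinearMap := f.toLinearMap ∘ₗ fourierOntoZ E
  cont := f.continuous.comp continuous_coinduced_rng

/-- The test function `η ↦ ψ(η) exp(2πi⟨η, x⟩)`. -/
def modulate (ψ : 𝓓((⊤ : TopologicalSpace.Opens E), ℝ)) (x : E) :
    𝓓((⊤ : TopologicalSpace.Opens E), ℂ) where
  toFun η := (ψ η : ℂ) * Complex.exp ((2 * Real.pi * inner ℝ η x : ℝ) * Complex.I)
  contDiff' := by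
    refine (Complex.ofRealCLM.contDiff.comp ψ.contDiff).mul ?_
    refine Complex.contDiff_exp.comp (ContDiff.mul ?_ contDiff_const)
    refine Complex.ofRealCLM.contDiff.comp (contDiff_const.mul ?_)
    exact contDiff_id.inner ℝ contDiff_const
  hasCompactSupport' := by
    refine HasCompactSupport.mul_right ?_
    exact ψ.hasCompactSupport.comp_left Complex.ofReal_zero
  tsupport_subset' := fun _ _ => trivial

/-- The function `𝓕⁻¹(ψ · 𝓕 f)`, namely `x ↦ ⟨𝓕 f, ψ exp(2πi⟨·, x⟩)⟩`; since `ψ · 𝓕 f` is a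
compactly supported distribution, this smooth function represents its inverse Fourier transform. -/
def frequencyPiece (ψ : 𝓓((⊤ : TopologicalSpace.Opens E), ℝ)) (f : FourierReservoir E) : E → ℂ :=
  fun x => reservoirFourier f (modulate ψ x)

theorem frequencyPiece_add (ψ : 𝓓((⊤ : TopologicalSpace.Opens E), ℝ)) (f g : FourierReservoir E) :
    frequencyPiece ψ (f + g) = frequencyPiece ψ f + frequencyPiece ψ g := rfl

theorem frequencyPiece_smul (ψ : 𝓓((⊤ : TopologicalSpace.Opens E), ℝ)) (c : ℂ)
    (f : FourierReservoir E) : frequencyPiece ψ (c • f) = c • frequencyPiece ψ f := rfl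

/-! ### Standard modulation spaces -/

/-- The norm of the modulation space with smoothness `s = 0` (all weights `(1 + ‖ξ_i‖²)^{s/2}` are
equal to `1`), with values in `[0, ∞]`:
`(∑_i ‖𝓕⁻¹(ψ_i · 𝓕 f)‖_{L^p}^q)^{1/q}`. -/
def modulationNorm {ι : Type*} (ψ : ι → 𝓓((⊤ : TopologicalSpace.Opens E), ℝ)) (p q : ℝ)
    (f : FourierReservoir E) : ℝ≥0∞ :=
  (∑' i, eLpNorm (frequencyPiece (ψ i) f) (ENNReal.ofReal p) volume ^ q) ^ (1 / q)

/-- The modulation space: all `f ∈ Z'` with pieces in `L^p` and finite norm. For `q < ∞` the first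
condition follows from the second, the pieces being smooth. -/
def modulationSpace {ι : Type*} (ψ : ι → 𝓓((⊤ : TopologicalSpace.Opens E), ℝ)) (p q : ℝ)
    (hq : 1 ≤ q) : Submodule ℂ (FourierReservoir E) where
  carrier := {f | (∀ i, MemLp (frequencyPiece (ψ i) f) (ENNReal.ofReal p) volume) ∧
    modulationNorm ψ p q f < ⊤}
  zero_mem' := by
    have h0 : ∀ i, frequencyPiece (ψ i) (0 : FourierReservoir E) = 0 := fun _ => rfl
    have hq0 : 0 < q := by linarith
    refine ⟨fun i => by rw [h0]; exact MemLp.zero, ?_⟩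
    simp [modulationNorm, h0, hq0]
  add_mem' := by
    rintro f g ⟨hf, hf'⟩ ⟨hg, hg'⟩
    have hq0 : 0 < q := by linarith
    have hi : 0 < 1 / q := by positivity
    refine ⟨fun i => by rw [frequencyPiece_add]; exact (hf i).add (hg i), ?_⟩
    simp only [modulationNorm, ENNReal.rpow_lt_top_iff_of_pos hi] at hf' hg' ⊢
    obtain ⟨C, hC, hle⟩ : ∃ C : ℝ≥0∞, C < ⊤ ∧ ∀ u v : E → ℂ,
        AEStronglyMeasurable u volume → AEStronglyMeasurable v volume →
        eLpNorm (u + v) (ENNReal.ofReal p) volume ≤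
          C * (eLpNorm u (ENNReal.ofReal p) volume + eLpNorm v (ENNReal.ofReal p) volume) :=
      ⟨_, ENNReal.LpAddConst_lt_top (ENNReal.ofReal p), fun u v hu hv => eLpNorm_add_le' hu hv _⟩
    calc
      _ ≤ ∑' i, C ^ q * ((2 : ℝ≥0∞) ^ (q - 1) *
          (eLpNorm (frequencyPiece (ψ i) f) (ENNReal.ofReal p) volume ^ q +
            eLpNorm (frequencyPiece (ψ i) g) (ENNReal.ofReal p) volume ^ q)) := by
        refine ENNReal.tsum_le_tsum fun i => ?_
        rw [frequencyPiece_add]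
        refine (ENNReal.rpow_le_rpow (hle _ _ (hf i).1 (hg i).1) hq0.le).trans ?_
        rw [ENNReal.mul_rpow_of_nonneg _ _ hq0.le]
        gcongr
        exact ENNReal.rpow_add_le_mul_rpow_add_rpow _ _ hq
      _ < ⊤ := by
        rw [ENNReal.tsum_mul_left, ENNReal.tsum_mul_left, ENNReal.tsum_add]
        refine ENNReal.mul_lt_top (ENNReal.rpow_lt_top_of_nonneg hq0.le hC.ne)
          (ENNReal.mul_lt_top ?_ (ENNReal.add_lt_top.2 ⟨hf', hg'⟩))
        exact ENNReal.rpow_lt_top_of_nonneg (by linarith) (by simp)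
  smul_mem' := by
    rintro c f ⟨hf, hf'⟩
    have hq0 : 0 < q := by linarith
    have hi : 0 < 1 / q := by positivity
    refine ⟨fun i => by rw [frequencyPiece_smul]; exact (hf i).const_smul c, ?_⟩
    simp only [modulationNorm, ENNReal.rpow_lt_top_iff_of_pos hi] at hf' ⊢
    simp only [frequencyPiece_smul, eLpNorm_const_smul, ENNReal.mul_rpow_of_nonneg _ _ hq0.le]
    rw [ENNReal.tsum_mul_left]
    exact ENNReal.mul_lt_top (ENNReal.rpow_lt_top_of_nonneg hq0.le (by simp)) hf'

/-- The essential support of `f` with respect to the covering `Q` and the partition of unity `ψ`: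
the union of the `Q i` with `‖𝓕⁻¹(ψ_i · 𝓕 f)‖_{L^p} ≠ 0`. -/
def essentialSupport {ι : Type*} (Q : ι → Set E) (ψ : ι → 𝓓((⊤ : TopologicalSpace.Opens E), ℝ))
    (p : ℝ) (f : FourierReservoir E) : Set E :=
  ⋃ (i) (_ : eLpNorm (frequencyPiece (ψ i) f) (ENNReal.ofReal p) volume ≠ 0), Q i

/-- The auxiliary choices behind `M_{p,q}(G)` and its geometry: a homogeneous quasi-norm, a
generalized `0`-covering `P` with a partition of unity `φ` (which define the space and its norm),
and a lattice covering with a partition of unity `ψ` (which define essential supports and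
distances). -/
structure ModulationData (G : StratifiedGroup E) where
  /-- The homogeneous quasi-norm. -/
  ν : E → ℝ
  isQuasiNorm : G.IsQuasiNorm ν
  /-- Index set of the generalized `0`-covering; admissible open coverings are countable. -/
  ι : Type
  /-- The generalized `0`-covering. -/
  P : ι → Set E
  isAlphaCovering : G.IsAlphaCovering ν 0 P
  /-- The partition of unity that defines the norm. -/
  φ : ι → 𝓓((⊤ : TopologicalSpace.Opens E), ℝ)
  isBAPU_φ : IsBAPU P φ
  /-- The lattice. -/
  N : Subgroup G.Carrier
  isLattice : G.IsLattice N
  /-- The radius of the balls of the lattice covering. -/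
  R : ℝ
  R_pos : 0 < R
  isAdmissible : IsAdmissibleCovering (G.latticeCovering ν N R)
  /-- The partition of unity that defines essential supports. -/
  ψ : StratifiedGroup.LatticeIndex N → 𝓓((⊤ : TopologicalSpace.Opens E), ℝ)
  isBAPU_ψ : IsBAPU (G.latticeCovering ν N R) ψ

namespace ModulationData

variable {G : StratifiedGroup E} (D : ModulationData G)

/-- The standard modulation space `M_{p,q}(G)`. -/
def space (p q : ℝ) (hq : 1 ≤ q) : Submodule ℂ (FourierReservoir E) := modulationSpace D.φ p q hq

/-- The norm of `M_{p,q}(G)`. -/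
def norm (p q : ℝ) (f : FourierReservoir E) : ℝ≥0∞ := modulationNorm D.φ p q f

/-- The lattice covering `U(G; N)`. -/
def covering (m : StratifiedGroup.LatticeIndex D.N) : Set E := G.latticeCovering D.ν D.N D.R m

/-- The essential support of an element of `M_{p,q}(G)`. -/
def essSupp (p : ℝ) (f : FourierReservoir E) : Set E := essentialSupport D.covering D.ψ p f

end ModulationData

end Analysis

/-- A linear map `F : M_{p₁,q₁}(G) → M_{p₂,q₂}(H)` is a geometric embedding if it is injective,
bounded, and moves frequencies in a coarsely controlled way. The additive constant may depend on the
size `k` of the frequency windows `Q_i^{k*}`, the multiplicative one may not. -/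
structure IsGeometricEmbedding
    {E₁ : Type*} [NormedAddCommGroup E₁] [InnerProductSpace ℝ E₁] [FiniteDimensional ℝ E₁]
    [MeasurableSpace E₁] [BorelSpace E₁]
    {E₂ : Type*} [NormedAddCommGroup E₂] [InnerProductSpace ℝ E₂] [FiniteDimensional ℝ E₂]
    [MeasurableSpace E₂] [BorelSpace E₂]
    {G : StratifiedGroup E₁} {H : StratifiedGroup E₂} (D : ModulationData G) (D' : ModulationData H)
    (p₁ q₁ p₂ q₂ : ℝ) (hq₁ : 1 ≤ q₁) (hq₂ : 1 ≤ q₂)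
    (F : D.space p₁ q₁ hq₁ →ₗ[ℂ] D'.space p₂ q₂ hq₂) : Prop where
  injective : Function.Injective F
  bounded : ∃ C : ℝ≥0, ∀ f, D'.norm p₂ q₂ (F f) ≤ C * D.norm p₁ q₁ f
  geometric : ∃ L : ℝ, 0 < L ∧ ∀ k : ℕ, ∃ C : ℝ, 0 < C ∧
    ∀ (i j) (f g : D.space p₁ q₁ hq₁),
      D.essSupp p₁ f ⊆ starSet D.covering i k → D.essSupp p₁ g ⊆ starSet D.covering j k →
      ∀ x ∈ starSet D.covering i k, ∀ y ∈ starSet D.covering j k,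
      ∀ z ∈ D'.essSupp p₂ (F f), ∀ w ∈ D'.essSupp p₂ (F g),
        1 / L * (coveringDist D.covering x y : ℝ) - C ≤ (coveringDist D'.covering z w : ℝ) ∧
        (coveringDist D'.covering z w : ℝ) ≤ L * (coveringDist D.covering x y : ℝ) + C

end

/-!
Fix `X ∉ V₂` and a bump function `θ`. A member `f` of the Feichtinger algebra has a continuous
Fourier transform `h` and is the sum of its frequency pieces `fᵢ = 𝓕⁻¹(φᵢ h)`, where `φᵢ` is
supported near a point `tᵢ` of the line. The embedding is `F f (x) = ∑ᵢ fᵢ(⟨X, x⟩) wᵢ(x)`, where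
the window `wᵢ` is `𝓕⁻¹θ` composed with the transpose of the unipotent linear part of the left
translation by `tᵢ X`. Multiplication by `fᵢ(⟨X, ·⟩)` moves the frequencies of `wᵢ` along `X`, so
those of the `i`-th summand lie in balls of a fixed radius around the points `s X` with `s` near
`tᵢ` and `h s ≠ 0`.

* `F` is bounded because every such ball meets boundedly many members of the covering of the group.
* `F` is injective because all windows coincide with `𝓕⁻¹θ` on the orthogonal complement of `V₂`,
  which contains a line where `⟨X, ·⟩` does not vanish; on it `F f` is the product of `f` and an
  analytic function with isolated zeros.
* `F` is geometric because the covering distance of points near `s X` and `t X` is comparable to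
  `|s - t|`: unit steps along the subgroup give the upper bound, and a linear functional that
  vanishes on `V₂`, hence is a homomorphism, gives the lower one.
-/

/-! ### Translations, balls and volumes on the group -/

namespace StratifiedGroup

section Algebra

variable {E : Type*} [AddCommGroup E] [Module ℝ E] (G : StratifiedGroup E)

theorem mul_neg_cancel_left (c x : E) : G.mul c (G.mul (-c) x) = x := by
  rw [← G.mul_assoc']
  simp [mul, G.bracket_self]

theorem neg_mul_cancel_left (c x : E) : G.mul (-c) (G.mul c x) = x := by
  simpa using G.mul_neg_cancel_left (-c) x

theorem neg_mul_rev (x y : E) : -(G.mul x y) = G.mul (-y) (-x) := by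
  simp only [mul, map_neg, LinearMap.neg_apply, neg_neg, G.bracket_skew y x, smul_neg]
  abel

theorem neg_smul_mul_smul (s t : ℝ) (X : E) : G.mul (-(s • X)) (t • X) = (t - s) • X := by
  simp only [mul, map_neg, map_smul, LinearMap.neg_apply, LinearMap.smul_apply, G.bracket_self,
    smul_zero, neg_zero, add_zero]
  module

theorem bracket_bracket (c x : E) : G.bracket c (G.bracket c x) = 0 :=
  G.bracket_central _ (G.bracket_mem c x)

theorem map_mul_of_vanish_V₂ {l : E →ₗ[ℝ] ℝ} (hl : ∀ z ∈ G.V₂, l z = 0) (x y : E) :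
    l (G.mul x y) = l x + l y := by
  simp [mul, hl _ (G.bracket_mem x y)]

theorem V₂_ne_top [Nontrivial E] : G.V₂ ≠ ⊤ := by
  intro h
  have hspan := G.span_bracket
  rw [h, Submodule.span_eq_bot.2] at hspan
  · exact bot_ne_top hspan
  · rintro z ⟨x, -, y, -, rfl⟩
    exact G.bracket_central x (h ▸ Submodule.mem_top)

theorem exists_add_eq (x : E) : ∃ a ∈ G.V₁, ∃ b ∈ G.V₂, a + b = x :=
  Submodule.mem_sup.1 (G.isCompl.sup_eq_top ▸ Submodule.mem_top)

theorem dilation_add {a b : E} (ha : a ∈ G.V₁) (hb : b ∈ G.V₂) (r : ℝ) :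
    G.dilation r (a + b) = r • a + r ^ 2 • b := by
  simp [dilation, Submodule.projection_apply_of_mem_left, Submodule.projection_apply_of_mem_right,
    ha, hb]

theorem dilation_one (x : E) : G.dilation 1 x = x := by
  obtain ⟨a, ha, b, hb, rfl⟩ := G.exists_add_eq x
  simp [G.dilation_add ha hb]

theorem dilation_zero (x : E) : G.dilation 0 x = 0 := by
  simp [dilation]

theorem dilation_dilation (r s : ℝ) (x : E) :
    G.dilation r (G.dilation s x) = G.dilation (r * s) x := by
  obtain ⟨a, ha, b, hb, rfl⟩ := G.exists_add_eq x
  rw [G.dilation_add ha hb, G.dilation_add (G.V₁.smul_mem s ha) (G.V₂.smul_mem _ hb),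
    G.dilation_add ha hb, smul_smul, smul_smul, mul_pow]

theorem mem_ball {ν : E → ℝ} {c h : E} {R : ℝ} : h ∈ G.ball ν c R ↔ ν (G.mul (-c) h) < R := Iff.rfl

variable {G}

theorem ball_mono {ν : E → ℝ} {c : E} {R R' : ℝ} (h : R ≤ R') : G.ball ν c R ⊆ G.ball ν c R' :=
  fun _ hx => lt_of_lt_of_le hx h

end Algebra

section Topology

variable {E : Type*} [NormedAddCommGroup E] [NormedSpace ℝ E] {G : StratifiedGroup E}
  {ν : E → ℝ}

theorem continuous_dilation_apply (x : E) : Continuous fun r : ℝ => G.dilation r x := by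
  simp only [dilation, LinearMap.add_apply, LinearMap.smul_apply]
  fun_prop

theorem IsQuasiNorm.map_zero (hν : G.IsQuasiNorm ν) : ν 0 = 0 := by
  have h := hν.homogeneous 2 two_pos 0
  rw [_root_.map_zero] at h
  linarith

theorem IsQuasiNorm.mem_ball_comm (hν : G.IsQuasiNorm ν) {x y : E} {R : ℝ} :
    x ∈ G.ball ν y R ↔ y ∈ G.ball ν x R := by
  rw [mem_ball, mem_ball, ← hν.symmetric, G.neg_mul_rev, neg_neg]

theorem IsQuasiNorm.mem_ball_self (hν : G.IsQuasiNorm ν) (x : E) {R : ℝ} (hR : 0 < R) :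
    x ∈ G.ball ν x R := by
  simpa [mem_ball, mul, G.bracket_self, hν.map_zero] using hR

theorem IsQuasiNorm.measure_sublevel_pos [MeasurableSpace E] (μ : Measure E) [μ.IsOpenPosMeasure]
    (hν : G.IsQuasiNorm ν) {R : ℝ} (hR : 0 < R) : 0 < μ {x | ν x < R} :=
  (isOpen_lt hν.continuous continuous_const).measure_pos μ ⟨0, by simpa [hν.map_zero] using hR⟩

variable [FiniteDimensional ℝ E]

variable (G) in
theorem continuous_mul : Continuous fun p : E × E => G.mul p.1 p.2 := by
  have hbracket : Continuous fun p : E × E => G.bracket p.1 p.2 :=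
    G.bracket.toContinuousBilinearMap.continuous₂
  unfold mul
  fun_prop

theorem IsQuasiNorm.isOpen_ball (hν : G.IsQuasiNorm ν) (c : E) (R : ℝ) :
    IsOpen (G.ball ν c R) :=
  isOpen_lt (hν.continuous.comp (G.continuous_mul.comp (.prodMk_right (-c)))) continuous_const

/-- Every orbit of the dilations outside the unit ball crosses the unit sphere, on which `ν` is
bounded below. -/
theorem IsQuasiNorm.exists_lt_imp_norm_le_one (hν : G.IsQuasiNorm ν) :
    ∃ m > 0, ∀ x, ν x < m → ‖x‖ ≤ 1 := by
  obtain ⟨m, hm, hsphere⟩ := (isCompact_sphere (0 : E) 1).exists_forall_le'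
    hν.continuous.continuousOn (a := 0) fun x hx => lt_of_le_of_ne (hν.nonneg x) fun h0 => by
      simp [hν.eq_zero x h0.symm] at hx
  refine ⟨m, hm, fun x hx => ?_⟩
  by_contra! hn
  obtain ⟨r, ⟨hr0, hr1⟩, hr⟩ : (1 : ℝ) ∈ (fun r => ‖G.dilation r x‖) '' Icc 0 1 :=
    intermediate_value_Icc zero_le_one (continuous_dilation_apply x).norm.continuousOn
      (by simp [dilation_zero, dilation_one, hn.le])
  have hr0' : 0 < r := hr0.lt_of_ne fun h => by simp [← h, dilation_zero] at hr
  have hm_le := hsphere (G.dilation r x) (by simpa using hr)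
  rw [hν.homogeneous r hr0'] at hm_le
  linarith [mul_le_of_le_one_left (hν.nonneg x) hr1]

theorem IsQuasiNorm.isBounded_sublevel (hν : G.IsQuasiNorm ν) (R : ℝ) :
    Bornology.IsBounded {x | ν x < R} := by
  obtain ⟨m, hm, hsmall⟩ := hν.exists_lt_imp_norm_le_one
  rcases le_or_gt R 0 with hR | hR
  · exact Bornology.isBounded_empty.subset fun x (hx : ν x < R) =>
      (hx.not_ge (hR.trans (hν.nonneg x))).elim
  refine (((isCompact_closedBall (0 : E) 1).image
    (LinearMap.continuous_of_finiteDimensional (G.dilation (R / m)))).isBounded).subset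
      fun x (hx : ν x < R) => ⟨G.dilation (m / R) x, ?_, ?_⟩
  · rw [mem_closedBall_zero_iff]
    refine hsmall _ ?_
    rw [hν.homogeneous _ (by positivity), div_mul_eq_mul_div, div_lt_iff₀ hR]
    gcongr
  · rw [dilation_dilation, div_mul_div_cancel₀ hm.ne', div_self hR.ne', dilation_one]

theorem IsQuasiNorm.measure_sublevel_lt_top [MeasurableSpace E] (μ : Measure E)
    [IsFiniteMeasureOnCompacts μ] (hν : G.IsQuasiNorm ν) (R : ℝ) : μ {x | ν x < R} < ⊤ :=
  (hν.isBounded_sublevel R).measure_lt_top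

theorem IsQuasiNorm.exists_abs_le (hν : G.IsQuasiNorm ν) {f : E → ℝ} (hf : Continuous f) (R : ℝ) :
    ∃ C > 0, ∀ x, ν x < R → |f x| ≤ C := by
  obtain ⟨C, hC⟩ := ((hν.isBounded_sublevel R).isCompact_closure.image hf).isBounded.exists_norm_le
  exact ⟨max C 1, by positivity, fun x hx =>
    (hC _ ⟨x, subset_closure hx, rfl⟩).trans (le_max_left _ _)⟩

theorem IsQuasiNorm.exists_lt_of_isBounded (hν : G.IsQuasiNorm ν) {S : Set E}
    (hS : Bornology.IsBounded S) : ∃ R > 0, ∀ x ∈ S, ν x < R := by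
  obtain ⟨C, hC⟩ := (hS.isCompact_closure.image hν.continuous).isBounded.bddAbove
  refine ⟨max C 0 + 1, by positivity, fun x hx => ?_⟩
  linarith [hC (mem_image_of_mem ν (subset_closure hx)), le_max_left C 0]

theorem IsQuasiNorm.exists_mul_lt (hν : G.IsQuasiNorm ν) (R : ℝ) :
    ∃ R' > 0, ∀ x y, ν x < R → ν y < R → ν (G.mul x y) < R' := by
  have hc := (hν.isBounded_sublevel R).isCompact_closure
  obtain ⟨R', hR', h⟩ :=
    hν.exists_lt_of_isBounded ((hc.prod hc).image G.continuous_mul).isBounded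
  exact ⟨R', hR', fun x y hx hy => h _ ⟨(x, y), ⟨subset_closure hx, subset_closure hy⟩, rfl⟩⟩

theorem IsQuasiNorm.exists_ball_trans (hν : G.IsQuasiNorm ν) (R₁ R₂ : ℝ) :
    ∃ R > 0, ∀ x y z, y ∈ G.ball ν x R₁ → z ∈ G.ball ν y R₂ → z ∈ G.ball ν x R := by
  obtain ⟨R, hR, h⟩ := hν.exists_mul_lt (max R₁ R₂)
  refine ⟨R, hR, fun x y z hy hz => ?_⟩
  have hmul := h _ _ (ball_mono (le_max_left _ _) hy) (ball_mono (le_max_right _ _) hz)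
  rwa [G.mul_assoc', G.mul_neg_cancel_left] at hmul

end Topology

end StratifiedGroup

theorem det_one_add_of_isNilpotent {R M : Type*} [CommRing R] [IsDomain R] [AddCommGroup M]
    [Module R M] [Module.Finite R M] [Module.Free R M] {T : Module.End R M}
    (hT : IsNilpotent T) : LinearMap.det (1 + T) = 1 := by
  have h := LinearMap.eval_charpoly (-T) 1
  rw [hT.neg.charpoly_eq_X_pow_finrank] at h
  simpa using h.symm

theorem measurePreserving_add_apply_of_isNilpotent {E : Type*} [NormedAddCommGroup E]
    [NormedSpace ℝ E] [FiniteDimensional ℝ E] [MeasurableSpace E] [BorelSpace E] (μ : Measure E)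
    [μ.IsAddHaarMeasure] {T : Module.End ℝ E} (hT : IsNilpotent T) :
    MeasurePreserving (fun x => x + T x) μ μ := by
  have hdet := det_one_add_of_isNilpotent hT
  refine ⟨(LinearMap.continuous_of_finiteDimensional (1 + T)).measurable, ?_⟩
  have h := Measure.map_linearMap_addHaar_eq_smul_addHaar μ (f := 1 + T) (by simp [hdet])
  rwa [hdet, inv_one, abs_one, ENNReal.ofReal_one, one_smul] at h

namespace StratifiedGroup

section Measure

variable {E : Type*} [NormedAddCommGroup E] [NormedSpace ℝ E] [FiniteDimensional ℝ E]
  [MeasurableSpace E] [BorelSpace E] {G : StratifiedGroup E} {ν : E → ℝ}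
  (μ : Measure E) [μ.IsAddHaarMeasure]

theorem measurePreserving_mul (G : StratifiedGroup E) (c : E) :
    MeasurePreserving (G.mul c) μ μ := by
  have hnil : IsNilpotent ((1 / 2 : ℝ) • G.bracket c : Module.End ℝ E) :=
    ⟨2, by ext x; simp [pow_two, bracket_bracket]⟩
  convert (measurePreserving_add_left μ c).comp (measurePreserving_add_apply_of_isNilpotent μ hnil)
    using 1
  ext x
  simp [mul, add_assoc]

theorem IsQuasiNorm.measure_ball (hν : G.IsQuasiNorm ν) (c : E) (R : ℝ) :
    μ (G.ball ν c R) = μ {x | ν x < R} :=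
  (measurePreserving_mul μ G (-c)).measure_preimage
    (isOpen_lt hν.continuous continuous_const).measurableSet.nullMeasurableSet

end Measure

end StratifiedGroup

/-! ### Covering distances and packings -/

section Chains

variable {E ι : Type*} {Q : ι → Set E} {x y z : E} {m : ℕ}

/-- There is a chain `Q (c 0), …, Q (c m)` of consecutively intersecting sets from `x` to `y`, as in
the definition of `coveringDist`. It has `m + 1` members. -/
def IsChainFromTo (Q : ι → Set E) (x y : E) (m : ℕ) : Prop :=
  ∃ c : ℕ → ι, x ∈ Q (c 0) ∧ y ∈ Q (c m) ∧ ∀ j < m, (Q (c j) ∩ Q (c (j + 1))).Nonempty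

theorem IsChainFromTo.coveringDist_le (h : IsChainFromTo Q x y m) :
    coveringDist Q x y ≤ m + 1 := by
  rw [coveringDist]
  split_ifs
  · exact Nat.zero_le _
  · obtain ⟨c, hx, hy, hc⟩ := h
    exact Nat.sInf_le ⟨m, c, rfl, hx, hy, hc⟩

theorem IsChainFromTo.exists_coveringDist_eq (h : IsChainFromTo Q x y m) (hxy : x ≠ y) :
    ∃ n, coveringDist Q x y = n + 1 ∧ IsChainFromTo Q x y n := by
  obtain ⟨c, hx, hy, hc⟩ := h
  obtain ⟨n, c', hn, hchain⟩ := Nat.sInf_mem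
    (s := {k | ∃ (m : ℕ) (c : ℕ → ι), k = m + 1 ∧ x ∈ Q (c 0) ∧ y ∈ Q (c m) ∧
      ∀ j < m, (Q (c j) ∩ Q (c (j + 1))).Nonempty}) ⟨_, m, c, rfl, hx, hy, hc⟩
  exact ⟨n, by rw [coveringDist, if_neg hxy, hn], c', hchain⟩

theorem IsChainFromTo.trans {n : ℕ} (hxy : IsChainFromTo Q x y m) (hyz : IsChainFromTo Q y z n) :
    IsChainFromTo Q x z (m + 1 + n) := by
  obtain ⟨c, hx, hy, hc⟩ := hxy
  obtain ⟨c', hy', hz, hc'⟩ := hyz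
  refine ⟨fun k => if k ≤ m then c k else c' (k - (m + 1)), by simpa using hx,
    by simpa [show ¬m + 1 + n ≤ m by omega] using hz, fun j hj => ?_⟩
  rcases lt_trichotomy j m with hjm | rfl | hjm
  · simpa [hjm.le, Nat.succ_le_of_lt hjm] using hc j hjm
  · simpa using ⟨y, hy, hy'⟩
  · obtain ⟨i, rfl⟩ : ∃ i, j = m + 1 + i := Nat.exists_eq_add_of_le hjm
    have hi := hc' i (by omega)
    simpa only [show ¬m + 1 + i ≤ m by omega, show ¬m + 1 + (i + 1) ≤ m by omega, if_false,
      Nat.add_sub_cancel_left, add_assoc (m + 1) i 1] using hi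

theorem coveringDist_self (Q : ι → Set E) (x : E) : coveringDist Q x x = 0 :=
  if_pos rfl

/-- The graph on the index set of a family whose edges are the pairs of intersecting members. -/
def intersectionGraph (Q : ι → Set E) : SimpleGraph ι :=
  SimpleGraph.fromRel fun i j => (Q i ∩ Q j).Nonempty

theorem intersectionGraph_reachable_of_mem {i j : ι} (hi : x ∈ Q i) (hj : x ∈ Q j) :
    (intersectionGraph Q).Reachable i j := by
  rcases eq_or_ne i j with rfl | hij
  · rfl
  · exact SimpleGraph.Adj.reachable ⟨hij, Or.inl ⟨x, hi, hj⟩⟩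

theorem isChainFromTo_of_walk {i j : ι} (p : (intersectionGraph Q).Walk i j) (hx : x ∈ Q i)
    (hy : y ∈ Q j) : IsChainFromTo Q x y p.length := by
  refine ⟨p.getVert, by simpa using hx, by simpa using hy, fun k hk => ?_⟩
  rcases (p.adj_getVert_succ hk).2 with h | h
  · exact h
  · rwa [inter_comm]

variable [TopologicalSpace E]

theorem intersectionGraph_reachable_of_isPreconnected {S : Set E} (hS : IsPreconnected S)
    (hopen : ∀ i, IsOpen (Q i)) (hcov : S ⊆ ⋃ i, Q i) {i j : ι} (hxS : x ∈ S) (hyS : y ∈ S)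
    (hx : x ∈ Q i) (hy : y ∈ Q j) : (intersectionGraph Q).Reachable i j := by
  refine hS.induction₂ (fun x y => ∀ i j, x ∈ Q i → y ∈ Q j → (intersectionGraph Q).Reachable i j)
    (fun a ha => ?_) (fun a b c _ hb _ hab hbc i j hi hj => ?_)
    (fun a b _ _ hab i j hi hj => (hab j i hj hi).symm) hxS hyS i j hx hy
  · obtain ⟨k, hk⟩ := mem_iUnion.1 (hcov ha)
    filter_upwards [mem_nhdsWithin_of_mem_nhds ((hopen k).mem_nhds hk)] with b hb i j hi hj
    exact (intersectionGraph_reachable_of_mem hi hk).trans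
      (intersectionGraph_reachable_of_mem hb hj)
  · obtain ⟨k, hk⟩ := mem_iUnion.1 (hcov hb)
    exact (hab i k hi hk).trans (hbc k j hk hj)

/-- The members of a family that meet a set. -/
def meeting (Q : ι → Set E) (S : Set E) : Set ι := {i | (Q i ∩ S).Nonempty}

theorem coveringDist_le_of_isPreconnected {S : Set E} (hS : IsPreconnected S)
    (hopen : ∀ i, IsOpen (Q i)) (hcov : S ⊆ ⋃ i, Q i) {K : ℕ} (hK : (meeting Q S).encard ≤ K)
    (hx : x ∈ S) (hy : y ∈ S) : coveringDist Q x y ≤ K := by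
  classical
  have hfin : (meeting Q S).Finite := finite_of_encard_le_coe hK
  let _ : Fintype (meeting Q S) := hfin.fintype
  have hmem : ∀ z ∈ S, ∃ i : meeting Q S, z ∈ Q i := fun z hz =>
    let ⟨i, hi⟩ := mem_iUnion.1 (hcov hz)
    ⟨⟨i, z, hi, hz⟩, hi⟩
  obtain ⟨i, hi⟩ := hmem x hx
  obtain ⟨j, hj⟩ := hmem y hy
  obtain ⟨p, hp⟩ := (intersectionGraph_reachable_of_isPreconnected (Q := fun i : meeting Q S => Q i)
    hS (fun i => hopen i) (fun z hz => mem_iUnion.2 (hmem z hz)) hx hy hi hj).exists_isPath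
  obtain ⟨c, hchain⟩ := isChainFromTo_of_walk p hi hj
  have hcard : Fintype.card (meeting Q S) ≤ K := by
    rw [← Nat.card_eq_fintype_card, Nat.card_coe_set_eq]
    exact_mod_cast hfin.cast_ncard_eq.trans_le hK
  have hdist : coveringDist Q x y ≤ p.length + 1 :=
    IsChainFromTo.coveringDist_le ⟨fun k => c k, hchain⟩
  linarith [hp.length_lt]

variable [PreconnectedSpace E]

theorem exists_isChainFromTo (hopen : ∀ i, IsOpen (Q i)) (hcov : ⋃ i, Q i = univ) (x y : E) :
    ∃ m, IsChainFromTo Q x y m := by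
  obtain ⟨i, hi⟩ := iUnion_eq_univ_iff.1 hcov x
  obtain ⟨j, hj⟩ := iUnion_eq_univ_iff.1 hcov y
  obtain ⟨p⟩ := intersectionGraph_reachable_of_isPreconnected isPreconnected_univ hopen hcov.ge
    (mem_univ x)
    (mem_univ y) hi hj
  exact ⟨_, isChainFromTo_of_walk p hi hj⟩

theorem coveringDist_triangle (hopen : ∀ i, IsOpen (Q i)) (hcov : ⋃ i, Q i = univ) (x y z : E) :
    coveringDist Q x z ≤ coveringDist Q x y + coveringDist Q y z := by
  rcases eq_or_ne x y with rfl | hxy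
  · simp [coveringDist_self]
  rcases eq_or_ne y z with rfl | hyz
  · simp [coveringDist_self]
  obtain ⟨m, hm⟩ := exists_isChainFromTo hopen hcov x y
  obtain ⟨n, hn⟩ := exists_isChainFromTo hopen hcov y z
  obtain ⟨m', hm', hxy'⟩ := hm.exists_coveringDist_eq hxy
  obtain ⟨n', hn', hyz'⟩ := hn.exists_coveringDist_eq hyz
  linarith [(hxy'.trans hyz').coveringDist_le]

theorem dist_le_mul_coveringDist {α : Type*} [PseudoMetricSpace α] (hopen : ∀ i, IsOpen (Q i))
    (hcov : ⋃ i, Q i = univ) {f : E → α} {Λ : ℝ}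
    (hΛ : ∀ i, ∀ x ∈ Q i, ∀ y ∈ Q i, dist (f x) (f y) ≤ Λ) (x y : E) :
    dist (f x) (f y) ≤ Λ * coveringDist Q x y := by
  rcases eq_or_ne x y with rfl | hxy
  · simp [coveringDist_self]
  obtain ⟨_, hm⟩ := exists_isChainFromTo hopen hcov x y
  obtain ⟨n, hn, c, hx, hy, hc⟩ := hm.exists_coveringDist_eq hxy
  have hchain : ∀ k ≤ n, ∀ w ∈ Q (c k), dist (f x) (f w) ≤ Λ * (k + 1) := by
    intro k
    induction k with
    | zero => exact fun _ w hw => by simpa using hΛ _ x hx w hw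
    | succ k ih =>
      intro hk w hw
      obtain ⟨v, hv, hv'⟩ := hc k hk
      calc dist (f x) (f w) ≤ dist (f x) (f v) + dist (f v) (f w) := dist_triangle _ _ _
        _ ≤ Λ * (k + 1) + Λ := add_le_add (ih (by omega) v hv) (hΛ _ v hv' w hw)
        _ = Λ * ((k + 1 : ℕ) + 1) := by push_cast; ring
  rw [hn]
  exact_mod_cast hchain n le_rfl y hy

end Chains

section Packing

variable {E ι : Type*}

theorem encard_le_coe_of_forall_finset {s : Set ι} {K : ℕ}
    (h : ∀ t : Finset ι, ↑t ⊆ s → t.card ≤ K) : s.encard ≤ K := by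
  by_contra! hK
  obtain ⟨t, hts, ht⟩ := exists_subset_encard_eq (Order.add_one_le_of_lt hK)
  obtain ⟨t, rfl⟩ := (finite_of_encard_eq_coe (k := K + 1) (by exact_mod_cast ht)).exists_finset_coe
  rw [encard_coe_eq_coe_finsetCard] at ht
  have hcard := h t hts
  have : t.card = K + 1 := by exact_mod_cast ht
  omega

theorem sum_measure_le_of_encard_le [MeasurableSpace E] (μ : Measure E) {Q : ι → Set E} {B : Set E}
    (s : Finset ι) {M : ℕ} (hQ : ∀ i ∈ s, MeasurableSet (Q i)) (hB : MeasurableSet B)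
    (hQB : ∀ i ∈ s, Q i ⊆ B) (hM : ∀ x, {i | i ∈ s ∧ x ∈ Q i}.encard ≤ M) :
    ∑ i ∈ s, μ (Q i) ≤ M * μ B := by
  classical
  have hpointwise : ∀ x, ∑ i ∈ s, (Q i).indicator (1 : E → ℝ≥0∞) x ≤
      B.indicator (fun _ => (M : ℝ≥0∞)) x := by
    intro x
    by_cases hx : x ∈ B
    · rw [indicator_of_mem hx]
      have hcard : ({i ∈ s | x ∈ Q i} : Finset ι).card ≤ M := by
        have h := hM x
        rw [← Finset.coe_filter, encard_coe_eq_coe_finsetCard] at h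
        exact_mod_cast h
      simpa only [indicator_apply, Pi.one_apply, Finset.sum_boole] using
        (Nat.cast_le (α := ℝ≥0∞)).2 hcard
    · rw [Finset.sum_eq_zero fun i hi => indicator_of_notMem (fun h => hx (hQB i hi h)) _]
      exact zero_le
  calc ∑ i ∈ s, μ (Q i) = ∑ i ∈ s, ∫⁻ x, (Q i).indicator (1 : E → ℝ≥0∞) x ∂μ :=
        Finset.sum_congr rfl fun i hi => (lintegral_indicator_one (hQ i hi)).symm
    _ = ∫⁻ x, ∑ i ∈ s, (Q i).indicator (1 : E → ℝ≥0∞) x ∂μ :=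
        (lintegral_finsetSum' _ fun i hi => (measurable_one.indicator (hQ i hi)).aemeasurable).symm
    _ ≤ ∫⁻ x, B.indicator (fun _ => (M : ℝ≥0∞)) x ∂μ := lintegral_mono hpointwise
    _ = M * μ B := lintegral_indicator_const hB _

theorem IsAdmissibleCovering.exists_encard_mem_le {Q : ι → Set E} (hQ : IsAdmissibleCovering Q) :
    ∃ M : ℕ, ∀ x, {i | x ∈ Q i}.encard ≤ M := by
  obtain ⟨M, hM⟩ := hQ.bounded
  refine ⟨M, fun x => ?_⟩
  obtain ⟨i, hi⟩ := iUnion_eq_univ_iff.1 hQ.covers x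
  exact (encard_le_encard fun j (hj : x ∈ Q j) => (⟨x, hi, hj⟩ : (Q i ∩ Q j).Nonempty)).trans (hM i)

theorem exists_lt_measure_sublevel [MeasurableSpace E] (μ : Measure E) (f : E → ℝ) {b : ℝ≥0∞}
    (hb : b < μ univ) : ∃ k : ℕ, b < μ {x | f x < k} := by
  have hlim : Filter.Tendsto (fun k : ℕ => μ {x | f x < k}) Filter.atTop
      (nhds (μ (⋃ k : ℕ, {x | f x < k}))) :=
    tendsto_measure_iUnion_atTop fun k l hkl x (hx : f x < k) =>
      show f x < l from hx.trans_le (Nat.cast_le.2 hkl)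
  rw [show ⋃ k : ℕ, {x | f x < k} = univ from
    iUnion_eq_univ_iff.2 fun x => exists_nat_gt (f x)] at hlim
  exact (hlim.eventually (lt_mem_nhds hb)).exists

end Packing

namespace StratifiedGroup

section UniformCovering

variable {E ι : Type*} [NormedAddCommGroup E] [InnerProductSpace ℝ E] [FiniteDimensional ℝ E]
  [MeasurableSpace E] [BorelSpace E] {G : StratifiedGroup E} {ν : E → ℝ} {Q : ι → Set E}

/-- An admissible covering by open sets, of volume bounded below and contained in balls of a fixed
radius: the common generalization of lattice coverings and generalized `0`-coverings. -/
structure IsUniformCovering (G : StratifiedGroup E) (ν : E → ℝ) (Q : ι → Set E) : Prop where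
  admissible : IsAdmissibleCovering Q
  isOpen : ∀ i, IsOpen (Q i)
  exists_le_volume : ∃ a : ℝ≥0, 0 < a ∧ ∀ i, a ≤ volume (Q i)
  subset_ball : ∃ R : ℝ, ∀ i, ∃ c, Q i ⊆ G.ball ν c R

theorem IsUniformCovering.exists_mem_ball (hQ : IsUniformCovering G ν Q) (hν : G.IsQuasiNorm ν) :
    ∃ R > 0, ∀ i, ∀ x ∈ Q i, ∀ y ∈ Q i, y ∈ G.ball ν x R := by
  obtain ⟨R, hR⟩ := hQ.subset_ball
  obtain ⟨R', hR', htrans⟩ := hν.exists_ball_trans R R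
  refine ⟨R', hR', fun i x hx y hy => ?_⟩
  obtain ⟨c, hc⟩ := hR i
  exact htrans x c y (hν.mem_ball_comm.1 (hc hx)) (hc hy)

theorem IsUniformCovering.exists_encard_meeting_le (hQ : IsUniformCovering G ν Q)
    (hν : G.IsQuasiNorm ν) (ρ : ℝ) :
    ∃ K : ℕ, ∀ c, (meeting Q (G.ball ν c ρ)).encard ≤ K := by
  obtain ⟨M, hM⟩ := hQ.admissible.exists_encard_mem_le
  obtain ⟨a, ha, ha_le⟩ := hQ.exists_le_volume
  obtain ⟨R, -, hR⟩ := hQ.exists_mem_ball hν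
  obtain ⟨R', -, htrans⟩ := hν.exists_ball_trans ρ R
  have ha0 : (a : ℝ≥0∞) ≠ 0 := by exact_mod_cast ha.ne'
  obtain ⟨K, hK⟩ := ENNReal.exists_nat_gt (r := M * volume {x | ν x < R'} / a)
    (ENNReal.div_ne_top (ENNReal.mul_ne_top (ENNReal.natCast_ne_top M)
      (hν.measure_sublevel_lt_top volume R').ne) ha0)
  refine ⟨K, fun c => encard_le_coe_of_forall_finset fun s hs => ?_⟩
  have hsub : ∀ i ∈ s, Q i ⊆ G.ball ν c R' := fun i hi y hy =>
    let ⟨x, hx, hxc⟩ := hs hi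
    htrans c x y hxc (hR i x hx y hy)
  have hpack : (s.card : ℝ≥0∞) * a ≤ M * volume {x | ν x < R'} :=
    calc (s.card : ℝ≥0∞) * a = ∑ _i ∈ s, (a : ℝ≥0∞) := by simp
      _ ≤ ∑ i ∈ s, volume (Q i) := Finset.sum_le_sum fun i _ => ha_le i
      _ ≤ M * volume (G.ball ν c R') :=
        sum_measure_le_of_encard_le volume s (fun i _ => (hQ.isOpen i).measurableSet)
          (hν.isOpen_ball c R').measurableSet hsub
          fun x => (encard_le_encard fun i hi => hi.2).trans (hM x)
      _ = M * volume {x | ν x < R'} := by rw [hν.measure_ball volume]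
  exact_mod_cast ((ENNReal.le_div_iff_mul_le (Or.inl ha0) (Or.inl ENNReal.coe_ne_top)).2
    hpack).trans hK.le

/-- The segment from `z` to `w`, translated from a ray at the origin, stays in a ball around `z`,
which only boundedly many members of the covering meet. -/
theorem IsUniformCovering.exists_coveringDist_le_of_mem_ball (hQ : IsUniformCovering G ν Q)
    (hν : G.IsQuasiNorm ν) (ρ : ℝ) :
    ∃ K : ℕ, ∀ z w, w ∈ G.ball ν z ρ → coveringDist Q z w ≤ K := by
  obtain ⟨R, -, hR⟩ := hν.exists_lt_of_isBounded
    (((isCompact_Icc (a := (0 : ℝ)) (b := 1)).prod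
      (hν.isBounded_sublevel ρ).isCompact_closure).image
      (continuous_fst.smul continuous_snd : Continuous fun p : ℝ × E => p.1 • p.2)).isBounded
  obtain ⟨K, hK⟩ := hQ.exists_encard_meeting_le hν R
  refine ⟨K, fun z w hw => ?_⟩
  set v := G.mul (-z) w
  have hray : Continuous fun τ : ℝ => G.mul z (τ • v) :=
    G.continuous_mul.comp (by fun_prop : Continuous fun τ : ℝ => (z, τ • v))
  have hball : (fun τ : ℝ => G.mul z (τ • v)) '' Icc 0 1 ⊆ G.ball ν z R := by
    rintro _ ⟨τ, hτ, rfl⟩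
    rw [mem_ball, G.neg_mul_cancel_left]
    exact hR _ ⟨(τ, v), ⟨hτ, subset_closure hw⟩, rfl⟩
  exact coveringDist_le_of_isPreconnected (isPreconnected_Icc.image _ hray.continuousOn) hQ.isOpen
    ((subset_univ _).trans hQ.admissible.covers.ge)
    ((encard_le_encard fun i hi => hi.mono (inter_subset_inter_right _ hball)).trans (hK z))
    ⟨0, by simp, by simp [mul]⟩ ⟨1, by simp, by simp [v, G.mul_neg_cancel_left]⟩

theorem IsUniformCovering.coveringDist_triangle (hQ : IsUniformCovering G ν Q) (x y z : E) :
    coveringDist Q x z ≤ coveringDist Q x y + coveringDist Q y z :=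
  _root_.coveringDist_triangle hQ.isOpen hQ.admissible.covers x y z

theorem IsUniformCovering.exists_coveringDist_smul_le (hQ : IsUniformCovering G ν Q)
    (hν : G.IsQuasiNorm ν) (X : E) :
    ∃ K : ℕ, ∀ s t : ℝ, (coveringDist Q (s • X) (t • X) : ℝ) ≤ K * (|s - t| + 1) := by
  obtain ⟨r, -, hr⟩ := hν.exists_lt_of_isBounded
    ((isCompact_Icc (a := (-1 : ℝ)) (b := 1)).image
      (continuous_id.smul continuous_const : Continuous fun τ : ℝ => τ • X)).isBounded
  obtain ⟨K, hK⟩ := hQ.exists_coveringDist_le_of_mem_ball hν r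
  have hstep : ∀ s t : ℝ, |t - s| ≤ 1 → coveringDist Q (s • X) (t • X) ≤ K := fun s t hst =>
    hK _ _ (by rw [mem_ball, neg_smul_mul_smul]; exact hr _ ⟨t - s, abs_le.1 hst, rfl⟩)
  refine ⟨K, fun s t => ?_⟩
  set n := ⌊|s - t|⌋₊ + 1
  have hn : (0 : ℝ) < n := by positivity
  have hnodes : ∀ k : ℕ, coveringDist Q (s • X) ((s + k * ((t - s) / n)) • X) ≤ K * k := by
    intro k
    induction k with
    | zero => simp [coveringDist_self]
    | succ k ih =>
      refine (hQ.coveringDist_triangle _ _ _).trans (add_le_add ih (hstep _ _ ?_))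
      rw [show s + (k + 1 : ℕ) * ((t - s) / n) - (s + k * ((t - s) / n)) = (t - s) / n by
        push_cast; ring, abs_div, abs_of_pos hn, div_le_one hn, abs_sub_comm]
      exact_mod_cast (Nat.lt_floor_add_one |s - t|).le
  have hend := hnodes n
  rw [mul_div_cancel₀ _ hn.ne', add_sub_cancel] at hend
  calc (coveringDist Q (s • X) (t • X) : ℝ) ≤ K * n := by exact_mod_cast hend
    _ ≤ K * (|s - t| + 1) := by
      gcongr
      push_cast [n]
      gcongr
      exact Nat.floor_le (abs_nonneg _)

theorem IsUniformCovering.exists_dist_le_mul_coveringDist (hQ : IsUniformCovering G ν Q)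
    (hν : G.IsQuasiNorm ν) {l : E →ₗ[ℝ] ℝ} (hl : ∀ z ∈ G.V₂, l z = 0) :
    ∃ A > 0, ∀ z w, |l z - l w| ≤ A * coveringDist Q z w := by
  obtain ⟨R, -, hR⟩ := hQ.exists_mem_ball hν
  obtain ⟨A, hA, hlA⟩ := hν.exists_abs_le (LinearMap.continuous_of_finiteDimensional l) R
  refine ⟨A, hA, dist_le_mul_coveringDist (f := l) hQ.isOpen hQ.admissible.covers
    fun i x hx y hy => ?_⟩
  rw [Real.dist_eq]
  have h := hlA _ (hR i x hx y hy)
  rwa [G.map_mul_of_vanish_V₂ hl, map_neg, neg_add_eq_sub, abs_sub_comm] at h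

/-- The lower bound comes from a linear functional that detects `X` and vanishes on `V₂`. -/
theorem IsUniformCovering.exists_coveringDist_comparison (hQ : IsUniformCovering G ν Q)
    (hν : G.IsQuasiNorm ν) {X : E} (hX : X ∉ G.V₂) :
    ∃ L > 0, ∀ ρ : ℝ, ∃ C > 0, ∀ s t : ℝ, ∀ z ∈ G.ball ν (s • X) ρ, ∀ w ∈ G.ball ν (t • X) ρ,
      1 / L * |s - t| - C ≤ coveringDist Q z w ∧ coveringDist Q z w ≤ L * |s - t| + C := by
  obtain ⟨l, hlX, hl⟩ : ∃ l : E →ₗ[ℝ] ℝ, l X = 1 ∧ ∀ z ∈ G.V₂, l z = 0 := by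
    obtain ⟨l, hlX, hl⟩ := Submodule.exists_le_ker_of_notMem hX
    exact ⟨(l X)⁻¹ • l, by simp [hlX], fun z hz => by simp [LinearMap.mem_ker.1 (hl hz)]⟩
  obtain ⟨A, hA, hlower⟩ := hQ.exists_dist_le_mul_coveringDist hν hl
  obtain ⟨K, hK⟩ := hQ.exists_coveringDist_smul_le hν X
  refine ⟨max A (K + 1), by positivity, fun ρ => ?_⟩
  obtain ⟨K', hK'⟩ := hQ.exists_coveringDist_le_of_mem_ball hν ρ
  obtain ⟨B, hB, hlB⟩ := hν.exists_abs_le (LinearMap.continuous_of_finiteDimensional l) ρ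
  have hclose : ∀ (s : ℝ) (z : E), z ∈ G.ball ν (s • X) ρ → |l z - s| ≤ B := fun s z hz => by
    have h := hlB _ hz
    rwa [G.map_mul_of_vanish_V₂ hl, map_neg, map_smul, hlX, smul_eq_mul, mul_one,
      neg_add_eq_sub] at h
  refine ⟨2 * B / A + (K + 2 * K'), by positivity, fun s t z hz w hw => ⟨?_, ?_⟩⟩
  · have hst : |s - t| ≤ A * coveringDist Q z w + 2 * B := by
      have hs := abs_le.1 (hclose s z hz)
      have ht := abs_le.1 (hclose t w hw)
      have hzw := abs_le.1 (hlower z w)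
      exact abs_le.2 ⟨by linarith, by linarith⟩
    calc 1 / max A (K + 1) * |s - t| - (2 * B / A + (K + 2 * K'))
        ≤ 1 / A * (A * coveringDist Q z w + 2 * B) - 2 * B / A := by
          gcongr
          · exact le_max_left _ _
          · exact le_add_of_nonneg_right (by positivity)
      _ = coveringDist Q z w := by field_simp; ring
  · have htri : coveringDist Q z w ≤ K' + (coveringDist Q (s • X) (t • X) + K') :=
      (hQ.coveringDist_triangle z (s • X) w).trans (add_le_add (hK' _ _ (hν.mem_ball_comm.1 hz))
        ((hQ.coveringDist_triangle _ (t • X) w).trans (add_le_add le_rfl (hK' _ _ hw))))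
    calc (coveringDist Q z w : ℝ) ≤ K' + (K * (|s - t| + 1) + K') := by
          refine (Nat.cast_le.2 htri).trans ?_
          push_cast
          gcongr
          exact hK s t
      _ = K * |s - t| + (K + 2 * K') := by ring
      _ ≤ max A (K + 1) * |s - t| + (2 * B / A + (K + 2 * K')) :=
          add_le_add (mul_le_mul_of_nonneg_right ((lt_add_one _).le.trans (le_max_right _ _))
            (abs_nonneg _)) (le_add_of_nonneg_left (by positivity))

theorem isUniformCovering_latticeCovering (hν : G.IsQuasiNorm ν) {N : Subgroup G.Carrier} {R : ℝ}
    (hR : 0 < R) (h : IsAdmissibleCovering (G.latticeCovering ν N R)) :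
    IsUniformCovering G ν (G.latticeCovering ν N R) where
  admissible := h
  isOpen _ := hν.isOpen_ball _ _
  exists_le_volume :=
    have hfin := (hν.measure_sublevel_lt_top volume R).ne
    ⟨(volume {x | ν x < R}).toNNReal,
      ENNReal.toNNReal_pos (hν.measure_sublevel_pos volume hR).ne' hfin,
      fun _ => (ENNReal.coe_toNNReal hfin).trans_le (hν.measure_ball volume _ _).ge⟩
  subset_ball := ⟨R, fun _ => ⟨_, Subset.rfl⟩⟩

theorem IsAlphaCovering.exists_volume_bounds (h : G.IsAlphaCovering ν 0 Q) :
    ∃ a b : ℝ≥0, 0 < a ∧ ∀ i, a ≤ volume (Q i) ∧ volume (Q i) ≤ b := by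
  obtain ⟨a, b, ha, -, hab⟩ := h.size
  refine ⟨a.toNNReal, b.toNNReal, Real.toNNReal_pos.2 ha, fun i => ?_⟩
  obtain ⟨x, hx⟩ := h.admissible.nonempty i
  simpa [ENNReal.ofReal] using hab i x hx

theorem IsAlphaCovering.isUniformCovering [Nontrivial E] (hν : G.IsQuasiNorm ν)
    (h : G.IsAlphaCovering ν 0 Q) : IsUniformCovering G ν Q := by
  obtain ⟨a, b, ha, hab⟩ := h.exists_volume_bounds
  refine ⟨h.admissible, h.isOpen, ⟨a, ha, fun i => (hab i).1⟩, ?_⟩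
  obtain ⟨k, hk⟩ := exists_lt_measure_sublevel (volume : Measure E) ν (b := b)
    (by simp [measure_univ_of_isAddLeftInvariant])
  obtain ⟨K, hK⟩ := h.ratio
  have hinner : ∀ i, ⨆ (r : ℝ≥0) (_ : ∃ c, G.ball ν c r ⊆ Q i), (r : ℝ≥0∞) ≤ (k : ℝ≥0) := by
    refine fun i => iSup₂_le fun r ⟨c, hc⟩ => ?_
    by_contra! hlt
    have hkr : (k : ℝ) ≤ r := by exact_mod_cast hlt.le
    refine hk.not_ge ?_
    rw [← hν.measure_ball volume c]
    exact (measure_mono ((ball_mono hkr).trans hc)).trans (hab i).2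
  refine ⟨K * k + 1, fun i => ?_⟩
  have houter : ⨅ (R : ℝ≥0) (_ : ∃ c, Q i ⊆ G.ball ν c R), (R : ℝ≥0∞) < (K * k + 1 : ℝ≥0) := by
    refine ((hK i).trans (mul_le_mul_right (hinner i) _)).trans_lt ?_
    exact_mod_cast lt_add_one _
  simp only [iInf_lt_iff] at houter
  obtain ⟨R, ⟨c, hc⟩, hR⟩ := houter
  exact ⟨c, hc.trans (ball_mono (by exact_mod_cast hR.le))⟩

theorem IsUniformCovering.exists_ball_of_mem_starSet (hQ : IsUniformCovering G ν Q)
    (hν : G.IsQuasiNorm ν) (k : ℕ) :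
    ∃ T > 0, ∀ i, ∀ x ∈ starSet Q i k, ∀ y ∈ starSet Q i k, y ∈ G.ball ν x T := by
  obtain ⟨R, -, hmem⟩ := hQ.exists_mem_ball hν
  obtain ⟨T, hT⟩ : ∃ T, ∀ i, ∀ c ∈ Q i, ∀ x ∈ starSet Q i k, x ∈ G.ball ν c T := by
    simp only [starSet, mem_iUnion₂]
    induction k with
    | zero =>
      refine ⟨R, fun i c hc x ⟨j, hj, hx⟩ => hmem i c hc x ?_⟩
      rwa [show j = i from hj] at hx
    | succ k ih =>
      obtain ⟨T, hT⟩ := ih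
      obtain ⟨T', -, htrans⟩ := hν.exists_ball_trans T R
      refine ⟨T', fun i c hc x ⟨j, ⟨l, hl, u, hul, huj⟩, hx⟩ => ?_⟩
      exact htrans c u x (hT i c hc u ⟨l, hl, hul⟩) (hmem j u huj x hx)
  obtain ⟨T', hT', htrans⟩ := hν.exists_ball_trans T T
  refine ⟨T', hT', fun i x hx y hy => ?_⟩
  obtain ⟨c, hc⟩ := hQ.admissible.nonempty i
  exact htrans x c y (hν.mem_ball_comm.1 (hT i c hc x hx)) (hT i c hc y hy)

end UniformCovering

end StratifiedGroup

/-! ### Integrals of test functions and Fourier inversion -/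

section TestFunctionIntegral

set_option maxSynthPendingDepth 3

open scoped BoundedContinuousFunction

variable {𝕜 : Type*} [RCLike 𝕜]

theorem exists_clm_comp_eq {V Y : Type*} [AddCommGroup V] [Module 𝕜 V] [NormedAddCommGroup Y]
    [NormedSpace 𝕜 Y] (T : V →ₗ[𝕜] 𝕜) (J : V →ₗ[𝕜] Y) (C : ℝ) (h : ∀ v, ‖T v‖ ≤ C * ‖J v‖) :
    ∃ l : Y →L[𝕜] 𝕜, ∀ v, l (J v) = T v := by
  obtain ⟨r, hr⟩ := J.rangeRestrict.exists_rightInverse_of_surjective J.range_rangeRestrict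
  have hJr (y : LinearMap.range J) : J (r y) = y :=
    congrArg Subtype.val (LinearMap.congr_fun hr y)
  let f : StrongDual 𝕜 (LinearMap.range J) := (T ∘ₗ r).mkContinuous C fun y =>
    (h (r y)).trans_eq (by rw [hJr, Submodule.coe_norm])
  obtain ⟨g, hg, -⟩ := exists_extension_norm_eq (LinearMap.range J) f
  refine ⟨g, fun v => (hg ⟨J v, v, rfl⟩).trans (sub_eq_zero.1 (norm_le_zero_iff.1 ?_))⟩
  have hle := h (r ⟨J v, v, rfl⟩ - v)
  rwa [map_sub J, hJr, sub_self, norm_zero, mul_zero, map_sub] at hle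

variable {E F : Type*} [NormedAddCommGroup E] [NormedSpace ℝ E]
  [NormedAddCommGroup F] [NormedSpace ℝ F] [NormedSpace 𝕜 F] {K : TopologicalSpace.Compacts E}

/-- By continuity, `T` is dominated by finitely many derivatives, so by Hahn–Banach it factors
through a Banach space of jets, where functionals commute with the Bochner integral. -/
theorem exists_clm_structureMapCLM_eq [SMulCommClass ℝ 𝕜 F] (T : 𝓓_{K}(E, F) →L[𝕜] 𝕜) :
    ∃ (s : Finset ℕ) (l : (∀ i : s, E →ᵇ (E [×i]→L[ℝ] F)) →L[𝕜] 𝕜),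
      ∀ φ, l (fun i => ContDiffMapSupportedIn.structureMapCLM 𝕜 ⊤ i φ) = T φ := by
  obtain ⟨s, C, -, hC⟩ := Seminorm.bound_of_continuous
    (ContDiffMapSupportedIn.withSeminorms 𝕜 E F ⊤ K)
    ((normSeminorm 𝕜 𝕜).comp T.toLinearMap) T.continuous.norm
  let J : 𝓓_{K}(E, F) →ₗ[𝕜] ∀ i : s, E →ᵇ (E [×i]→L[ℝ] F) :=
    LinearMap.pi fun i => (ContDiffMapSupportedIn.structureMapCLM 𝕜 ⊤ i).toLinearMap
  obtain ⟨l, hl⟩ := exists_clm_comp_eq T.toLinearMap J C fun φ => (hC φ).trans <|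
    mul_le_mul_of_nonneg_left (Seminorm.finset_sup_apply_le (norm_nonneg (J φ)) fun i hi =>
      norm_le_pi_norm (J φ) ⟨i, hi⟩) C.2
  exact ⟨s, l, hl⟩

variable {X : Type*} [MeasurableSpace X] {μ : Measure X} {m : X → 𝓓_{K}(E, F)} {w : 𝓓_{K}(E, F)}

theorem integrable_iteratedFDeriv_apply {i : ℕ}
    (hm : Integrable (fun x => ContDiffMapSupportedIn.structureMapCLM ℝ ⊤ i (m x)) μ) (η : E) :
    Integrable (fun x => iteratedFDeriv ℝ i (m x) η) μ := by
  have h := (BoundedContinuousFunction.evalCLM ℝ η).integrable_comp hm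
  simpa only [BoundedContinuousFunction.evalCLM_apply,
    ContDiffMapSupportedIn.structureMapCLM_top_apply] using h

variable (hm : ∀ i, Integrable (fun x => ContDiffMapSupportedIn.structureMapCLM ℝ ⊤ i (m x)) μ)
  (hw : ∀ η, ∫ x, m x η ∂μ = w η)

include hm hw

theorem integral_iteratedFDeriv_apply (i : ℕ) (η : E) :
    ∫ x, iteratedFDeriv ℝ i (m x) η ∂μ = iteratedFDeriv ℝ i w η := by
  induction i generalizing η with
  | zero =>
    have h := (continuousMultilinearCurryFin0 ℝ E F).symm.toContinuousLinearEquiv.integral_comp_comm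
      (μ := μ) fun x => m x η
    rw [hw] at h
    exact h
  | succ i ih =>
    have hderiv (x : X) (η : E) : HasFDerivAt (iteratedFDeriv ℝ i (m x))
        (fderiv ℝ (iteratedFDeriv ℝ i (m x)) η) η :=
      ((m x).contDiff.differentiable_iteratedFDeriv
        (by exact_mod_cast ENat.natCast_lt_top i) η).hasFDerivAt
    have hcurry (f : E → F) : fderiv ℝ (iteratedFDeriv ℝ i f) η =
        (continuousMultilinearCurryLeftEquiv ℝ (fun _ : Fin (i + 1) => E) F).toContinuousLinearEquiv
          (iteratedFDeriv ℝ (i + 1) f η) := by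
      rw [iteratedFDeriv_succ_eq_comp_left]
      simp
    have hbound (x : X) (η : E) : ‖fderiv ℝ (iteratedFDeriv ℝ i (m x)) η‖ ≤
        ‖ContDiffMapSupportedIn.structureMapCLM ℝ ⊤ (i + 1) (m x)‖ := by
      rw [norm_fderiv_iteratedFDeriv, ← ContDiffMapSupportedIn.structureMapCLM_top_apply ℝ]
      exact BoundedContinuousFunction.norm_coe_le_norm _ η
    have h := hasFDerivAt_integral_of_dominated_of_fderiv_le (μ := μ) (𝕜 := ℝ) (x₀ := η)
      (F := fun η x => iteratedFDeriv ℝ i (m x) η)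
      (F' := fun η x => fderiv ℝ (iteratedFDeriv ℝ i (m x)) η)
      Filter.univ_mem
      (.of_forall fun η => (integrable_iteratedFDeriv_apply (hm i) η).1)
      (integrable_iteratedFDeriv_apply (hm i) η)
      (by
        simp only [hcurry]
        exact (ContinuousLinearEquiv.integrable_comp_iff _).2
          (integrable_iteratedFDeriv_apply (hm (i + 1)) η) |>.1)
      (.of_forall fun x η _ => hbound x η) (hm (i + 1)).norm
      (.of_forall fun x η _ => hderiv x η)
    simp only [ih, hcurry] at h
    rw [ContinuousLinearEquiv.integral_comp_comm] at h
    have h' := h.fderiv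
    rw [hcurry] at h'
    exact (ContinuousLinearEquiv.injective _ h').symm

theorem integral_clm_apply_eq [CompleteSpace F] [SMulCommClass ℝ 𝕜 F] (T : 𝓓_{K}(E, F) →L[𝕜] 𝕜) :
    ∫ x, T (m x) ∂μ = T w := by
  obtain ⟨s, l, hl⟩ := exists_clm_structureMapCLM_eq T
  have hinteg : ∫ x, (fun i : s => ContDiffMapSupportedIn.structureMapCLM ℝ ⊤ (i : ℕ) (m x)) ∂μ =
      fun i : s => ContDiffMapSupportedIn.structureMapCLM ℝ ⊤ (i : ℕ) w := by
    ext i η : 2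
    have h := (BoundedContinuousFunction.evalCLM ℝ η).integral_comp_comm (hm i)
    simp only [BoundedContinuousFunction.evalCLM_apply,
      ContDiffMapSupportedIn.structureMapCLM_top_apply,
      integral_iteratedFDeriv_apply hm hw] at h
    rw [eval_integral fun i : s => hm i, ← h, ContDiffMapSupportedIn.structureMapCLM_top_apply]
  simp only [← hl, ContDiffMapSupportedIn.structureMapCLM_eq_of_scalars 𝕜 ℝ, ← hinteg]
  exact l.integral_comp_comm (Integrable.of_eval fun i => hm i)

end TestFunctionIntegral

section FourierInversion

theorem hasTemperateGrowth_cexp_ofReal_mul_I :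
    Function.HasTemperateGrowth fun t : ℝ => Complex.exp (t * Complex.I) := by
  have hderiv (n : ℕ) : iteratedDeriv n (fun t : ℝ => Complex.exp (t * Complex.I)) =
      fun t : ℝ => Complex.I ^ n * Complex.exp (t * Complex.I) := by
    induction n with
    | zero => simp
    | succ n ih =>
      ext t
      rw [iteratedDeriv_succ, ih]
      have h := ((Complex.ofRealCLM.hasDerivAt (x := t)).mul_const Complex.I).cexp.const_mul
        (Complex.I ^ n)
      simp only [Complex.ofRealCLM_apply, Complex.ofReal_one, one_mul] at h
      rw [h.deriv, pow_succ]
      ring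
  refine ⟨Complex.contDiff_exp.comp (Complex.ofRealCLM.contDiff.mul contDiff_const),
    fun n => ⟨0, 1, fun t => ?_⟩⟩
  simp [norm_iteratedFDeriv_eq_norm_iteratedDeriv, hderiv, Complex.norm_exp_ofReal_mul_I]

section ParametricTestFunction

set_option maxSynthPendingDepth 3

open scoped BoundedContinuousFunction

variable {X E F : Type*} [NormedAddCommGroup E] [NormedSpace ℝ E]
  [NormedAddCommGroup F] [NormedSpace ℝ F]

theorem continuous_boundedContinuousFunction_of_eq_zero_off {X Y Z : Type*} [TopologicalSpace X]
    [TopologicalSpace Y] [PseudoMetricSpace Z] [Zero Z] {K : Set Y} (hK : IsCompact K)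
    {g : X → Y →ᵇ Z} (hg : Continuous fun p : X × Y => g p.1 p.2)
    (h0 : ∀ x, ∀ y ∉ K, g x y = 0) : Continuous g := by
  refine continuous_iff_continuousAt.2 fun x₀ => Metric.tendsto_nhds.2 fun ε hε => ?_
  have hnear : ∀ᶠ x in nhds x₀, ∀ y ∈ K, dist (g x y) (g x₀ y) < ε / 2 := by
    refine hK.eventually_forall_of_forall_eventually fun y _ => ?_
    have hcont : Continuous fun p : X × Y => dist (g p.1 p.2) (g x₀ p.2) :=
      hg.dist (hg.comp (continuous_const.prodMk continuous_snd))
    exact hcont.continuousAt.eventually_lt continuousAt_const (by simpa using hε)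
  filter_upwards [hnear] with x hx
  refine lt_of_le_of_lt ((BoundedContinuousFunction.dist_le (half_pos hε).le).2 fun y => ?_)
    (half_lt_self hε)
  by_cases hy : y ∈ K
  · exact (hx y hy).le
  · rw [h0 x y hy, h0 x₀ y hy, dist_self]
    exact (half_pos hε).le

variable [NormedAddCommGroup X] [NormedSpace ℝ X]

theorem iteratedFDeriv_comp_prodMk {n : WithTop ℕ∞} {f : X × E → F} (hf : ContDiff ℝ n f) (x : X)
    (η : E) {i : ℕ} (hi : i ≤ n) :
    iteratedFDeriv ℝ i (fun η => f (x, η)) η =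
      (iteratedFDeriv ℝ i f (x, η)).compContinuousLinearMap
        fun _ => ContinuousLinearMap.inr ℝ X E := by
  have hshift : ContDiff ℝ n fun z => f ((x, 0) + z) := hf.comp (contDiff_const.add contDiff_id)
  have h := (ContinuousLinearMap.inr ℝ X E).iteratedFDeriv_comp_right hshift η hi
  rw [iteratedFDeriv_comp_add_left] at h
  simpa [Function.comp_def] using h

variable {K : TopologicalSpace.Compacts E} {m : X → 𝓓_{K}(E, F)}
  (hm : Function.HasTemperateGrowth fun p : X × E => m p.1 p.2)

include hm

theorem continuous_structureMapCLM_comp (i : ℕ) :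
    Continuous fun x => ContDiffMapSupportedIn.structureMapCLM ℝ ⊤ i (m x) := by
  refine continuous_boundedContinuousFunction_of_eq_zero_off K.isCompact ?_ fun x η hη => ?_
  · simp only [ContDiffMapSupportedIn.structureMapCLM_top_apply]
    refine (continuous_congr fun p : X × E => iteratedFDeriv_comp_prodMk hm.1 p.1 p.2
      (by exact_mod_cast le_top)).2 ?_
    exact (ContinuousMultilinearMap.compContinuousLinearMapL _).continuous.comp
      (hm.1.continuous_iteratedFDeriv (by exact_mod_cast le_top))
  · rw [ContDiffMapSupportedIn.structureMapCLM_top_apply]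
    exact ContDiffMapSupportedIn.iteratedFDeriv_zero_on_compl (m x) hη

theorem exists_norm_structureMapCLM_le (i : ℕ) :
    ∃ (k : ℕ) (C : ℝ), ∀ x,
      ‖ContDiffMapSupportedIn.structureMapCLM ℝ ⊤ i (m x)‖ ≤ C * (1 + ‖x‖) ^ k := by
  obtain ⟨k, C, hC⟩ := hm.2 i
  obtain ⟨r, hr0, hr⟩ := K.isCompact.isBounded.exists_pos_norm_le
  have hC0 : 0 ≤ C := by simpa using (norm_nonneg _).trans (hC 0)
  refine ⟨k, C * (1 + r) ^ k, fun x =>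
    (BoundedContinuousFunction.norm_le (by positivity)).2 fun η => ?_⟩
  rw [ContDiffMapSupportedIn.structureMapCLM_top_apply]
  by_cases hη : η ∈ K
  · calc ‖iteratedFDeriv ℝ i (m x) η‖
        = ‖(iteratedFDeriv ℝ i (fun p : X × E => m p.1 p.2) (x, η)).compContinuousLinearMap
            fun _ => ContinuousLinearMap.inr ℝ X E‖ :=
          congrArg norm (iteratedFDeriv_comp_prodMk hm.1 x η (by exact_mod_cast le_top))
      _ ≤ ‖iteratedFDeriv ℝ i (fun p : X × E => m p.1 p.2) (x, η)‖ :=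
          (ContinuousMultilinearMap.norm_compContinuousLinearMap_le _ _).trans <|
            mul_le_of_le_one_right (norm_nonneg _) <| Finset.prod_le_one
              (fun _ _ => norm_nonneg _) fun _ _ => ContinuousLinearMap.norm_inr_le_one ℝ X E
      _ ≤ C * (1 + ‖(x, η)‖) ^ k := hC (x, η)
      _ ≤ C * ((1 + r) * (1 + ‖x‖)) ^ k := by
          have hη' := hr η hη
          gcongr
          rw [Prod.norm_mk]
          rcases max_cases ‖x‖ ‖η‖ with h | h <;> nlinarith [norm_nonneg x]
      _ = C * (1 + r) ^ k * (1 + ‖x‖) ^ k := by rw [mul_pow, mul_assoc]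
  · rw [ContDiffMapSupportedIn.iteratedFDeriv_zero_on_compl (m x) hη, Pi.zero_apply, norm_zero]
    positivity

theorem integrable_structureMapCLM_smul [MeasurableSpace X] [BorelSpace X]
    [SecondCountableTopology X] {μ : Measure X} [μ.HasTemperateGrowth]
    {𝕜 : Type*} [RCLike 𝕜] [NormedSpace 𝕜 F] [SMulCommClass ℝ 𝕜 F]
    (S : 𝓢(X, 𝕜)) (i : ℕ) :
    Integrable (fun x => ContDiffMapSupportedIn.structureMapCLM ℝ ⊤ i (S x • m x)) μ := by
  obtain ⟨k, C, hC⟩ := exists_norm_structureMapCLM_le hm i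
  have hC0 : 0 ≤ C := by simpa using (norm_nonneg _).trans (hC 0)
  have hS : Integrable (fun x => C * (2 ^ (k - 1) * (‖S x‖ + ‖x‖ ^ k * ‖S x‖))) μ :=
    ((S.integrable.norm.add (S.integrable_pow_mul μ k)).const_mul _).const_mul _
  have hsmul (x : X) : ContDiffMapSupportedIn.structureMapCLM ℝ ⊤ i (S x • m x) =
      S x • ContDiffMapSupportedIn.structureMapCLM ℝ ⊤ i (m x) := by
    simp only [ContDiffMapSupportedIn.structureMapCLM_eq_of_scalars ℝ 𝕜, map_smul]
  simp only [hsmul]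
  refine hS.mono' (S.continuous.smul
    (continuous_structureMapCLM_comp hm i)).aestronglyMeasurable (.of_forall fun x => ?_)
  calc ‖S x • ContDiffMapSupportedIn.structureMapCLM ℝ ⊤ i (m x)‖
      ≤ ‖S x‖ * (C * (1 + ‖x‖) ^ k) := (norm_smul_le _ _).trans (by gcongr; exact hC x)
    _ ≤ ‖S x‖ * (C * (2 ^ (k - 1) * (1 ^ k + ‖x‖ ^ k))) := by
        gcongr
        exact add_pow_le zero_le_one (norm_nonneg x) k
    _ = C * (2 ^ (k - 1) * (‖S x‖ + ‖x‖ ^ k * ‖S x‖)) := by ring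

end ParametricTestFunction

variable {E : Type*} [NormedAddCommGroup E] [InnerProductSpace ℝ E]

theorem hasTemperateGrowth_modulate_char {ψ : E → ℝ} (hψ : ψ.HasTemperateGrowth) :
    Function.HasTemperateGrowth fun p : E × E =>
      (ψ p.2 : ℂ) * Complex.exp ((2 * Real.pi * inner ℝ p.2 p.1 : ℝ) * Complex.I) := by
  have hinner : Function.HasTemperateGrowth fun p : E × E => inner ℝ p.2 p.1 :=
    (innerSL ℝ).bilinear_hasTemperateGrowth (ContinuousLinearMap.snd ℝ E E).hasTemperateGrowth
      (ContinuousLinearMap.fst ℝ E E).hasTemperateGrowth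
  have hψ' : Function.HasTemperateGrowth fun p : E × E => ψ p.2 :=
    hψ.comp (ContinuousLinearMap.snd ℝ E E).hasTemperateGrowth
  exact (Function.HasTemperateGrowth.comp Complex.ofRealCLM.hasTemperateGrowth hψ').mul <|
    Function.HasTemperateGrowth.comp (g := fun t : ℝ => Complex.exp (t * Complex.I))
      hasTemperateGrowth_cexp_ofReal_mul_I
      ((Function.HasTemperateGrowth.const (2 * Real.pi)).mul hinner)

variable [FiniteDimensional ℝ E] [MeasurableSpace E] [BorelSpace E]

/-- The test function `ψ · χ`. -/
noncomputable def realMul (ψ : 𝓓((⊤ : TopologicalSpace.Opens E), ℝ))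
    (χ : 𝓓((⊤ : TopologicalSpace.Opens E), ℂ)) : 𝓓((⊤ : TopologicalSpace.Opens E), ℂ) where
  toFun η := (ψ η : ℂ) * χ η
  contDiff' := (Complex.ofRealCLM.contDiff.comp ψ.contDiff).mul χ.contDiff
  hasCompactSupport' := χ.hasCompactSupport.mul_left
  tsupport_subset' := fun _ _ => trivial

theorem integral_modulate_mul_fourier (T : 𝓓((⊤ : TopologicalSpace.Opens E), ℂ) →L[ℂ] ℂ)
    (ψ : 𝓓((⊤ : TopologicalSpace.Opens E), ℝ)) (χ : 𝓓((⊤ : TopologicalSpace.Opens E), ℂ)) :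
    ∫ x, T (modulate ψ x) * 𝓕 (χ : E → ℂ) x = T (realMul ψ χ) := by
  let K : TopologicalSpace.Compacts E := ⟨tsupport ψ, ψ.hasCompactSupport⟩
  have hsupp (χ : 𝓓((⊤ : TopologicalSpace.Opens E), ℂ)) {f : E → ℂ} (hχ : ∀ η, χ η = ψ η * f η) :
      Function.support χ ⊆ K := fun η hη =>
    subset_tsupport _ fun h => hη (by rw [hχ, h, Complex.ofReal_zero, zero_mul])
  let m (x : E) : 𝓓_{K}(E, ℂ) := ContDiffMapSupportedIn.of_support_subset
    (modulate ψ x).contDiff (hsupp _ fun _ => rfl)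
  let w : 𝓓_{K}(E, ℂ) := ContDiffMapSupportedIn.of_support_subset
    (realMul ψ χ).contDiff (hsupp _ fun _ => rfl)
  let ofK : 𝓓_{K}(E, ℂ) →L[ℂ] 𝓓((⊤ : TopologicalSpace.Opens E), ℂ) :=
    TestFunction.ofSupportedInCLM ℂ fun _ _ => trivial
  have hm : Function.HasTemperateGrowth fun p : E × E => m p.1 p.2 :=
    hasTemperateGrowth_modulate_char (ψ.hasCompactSupport.hasTemperateGrowth ψ.contDiff)
  have hinv (η : E) : ∫ x, (fourierTest E χ x • m x) η = w η := by
    have h := congrFun (χ.continuous.fourierInv_fourier_eq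
      (χ.continuous.integrable_of_hasCompactSupport χ.hasCompactSupport)
      (fourierTest E χ).integrable) η
    rw [Real.fourierInv_eq'] at h
    calc ∫ x, (fourierTest E χ x • m x) η
        = ∫ x, (ψ η : ℂ) * (Complex.exp ((2 * Real.pi * inner ℝ x η : ℝ) * Complex.I) •
            𝓕 (χ : E → ℂ) x) := by
          congr 1 with x
          rw [real_inner_comm, smul_eq_mul, mul_comm (Complex.exp _), mul_left_comm]
          rfl
      _ = w η := by rw [integral_const_mul, h]; rfl
  calc ∫ x, T (modulate ψ x) * 𝓕 (χ : E → ℂ) x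
      = ∫ x, T.comp ofK (fourierTest E χ x • m x) := by
        simp only [map_smul, smul_eq_mul, mul_comm (fourierTest E χ _)]
        rfl
    _ = T (realMul ψ χ) :=
        integral_clm_apply_eq (integrable_structureMapCLM_smul hm (fourierTest E χ)) hinv
          (T.comp ofK)

end FourierInversion

/-! ### Fourier integrals of series -/

section IntegralOfSums

variable {α ι F : Type*} [MeasurableSpace α] {μ : Measure α} [Countable ι]
  [NormedAddCommGroup F] {v : ι → α → F} (hv : ∀ i, Integrable (v i) μ)
  (hsum : Summable fun i => ∫ x, ‖v i x‖ ∂μ)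

include hv hsum

theorem lintegral_tsum_enorm_eq_ofReal :
    ∫⁻ x, ∑' i, ‖v i x‖ₑ ∂μ = ENNReal.ofReal (∑' i, ∫ x, ‖v i x‖ ∂μ) := by
  rw [lintegral_tsum fun i => (hv i).1.enorm,
    ENNReal.ofReal_tsum_of_nonneg (fun _ => integral_nonneg fun _ => norm_nonneg _) hsum]
  exact tsum_congr fun i => (ofReal_integral_norm_eq_lintegral_enorm (hv i)).symm

variable [CompleteSpace F]

theorem integrable_tsum_of_summable_integral_norm :
    Integrable (fun x => ∑' i, v i x) μ := by
  have hfin : ∫⁻ x, ∑' i, ‖v i x‖ₑ ∂μ < ⊤ :=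
    (lintegral_tsum_enorm_eq_ofReal hv hsum).trans_lt ENNReal.ofReal_lt_top
  have hae : ∀ᵐ x ∂μ, ∑' i, ‖v i x‖ₑ < ⊤ :=
    ae_lt_top' (AEMeasurable.tsum fun i => (hv i).1.enorm) hfin.ne
  refine ⟨?_, (lintegral_mono fun x => enorm_tsum_le_tsum_enorm).trans_lt hfin⟩
  refine aestronglyMeasurable_of_tendsto_ae Filter.atTop
    (fun s => Finset.aestronglyMeasurable_fun_sum s fun i _ => (hv i).1) (hae.mono fun x hx => ?_)
  exact (Summable.of_enorm hx.ne).hasSum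

theorem integral_norm_tsum_le : ∫ x, ‖∑' i, v i x‖ ∂μ ≤ ∑' i, ∫ x, ‖v i x‖ ∂μ := by
  rw [integral_norm_eq_lintegral_enorm (integrable_tsum_of_summable_integral_norm hv hsum).1]
  refine ENNReal.toReal_le_of_le_ofReal
    (tsum_nonneg fun _ => integral_nonneg fun _ => norm_nonneg _) ?_
  rw [← lintegral_tsum_enorm_eq_ofReal hv hsum]
  exact lintegral_mono fun x => enorm_tsum_le_tsum_enorm

end IntegralOfSums

section PowerSums

theorem ennreal_rpow_eq_rpow_sub_one_mul (y : ℝ≥0∞) {q : ℝ} (hq : 1 ≤ q) :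
    y ^ q = y ^ (q - 1) * y := by
  conv_lhs => rw [← sub_add_cancel q 1,
    ENNReal.rpow_add_of_nonneg _ _ (by linarith) zero_le_one, ENNReal.rpow_one]

theorem eLpNorm_le_of_lintegral_le_of_forall_le {α F : Type*} [MeasurableSpace α] {μ : Measure α}
    [NormedAddCommGroup F] {w : α → F} {p : ℝ} (hp : 1 ≤ p) {A : ℝ≥0∞} (hA : A ≠ ⊤)
    (h1 : ∫⁻ x, ‖w x‖ₑ ∂μ ≤ A) (h2 : ∀ x, ‖w x‖ₑ ≤ A) : eLpNorm w (ENNReal.ofReal p) μ ≤ A := by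
  have hp0 : 0 < p := by linarith
  have hp1 : 0 ≤ p - 1 := by linarith
  rw [eLpNorm_eq_lintegral_rpow_enorm_toReal (by simpa using hp0) ENNReal.ofReal_ne_top,
    ENNReal.toReal_ofReal hp0.le, one_div, ENNReal.rpow_inv_le_iff hp0]
  calc ∫⁻ x, ‖w x‖ₑ ^ p ∂μ ≤ ∫⁻ x, A ^ (p - 1) * ‖w x‖ₑ ∂μ := by
        refine lintegral_mono fun x => ?_
        rw [ennreal_rpow_eq_rpow_sub_one_mul _ hp]
        gcongr
        exact h2 x
    _ = A ^ (p - 1) * ∫⁻ x, ‖w x‖ₑ ∂μ :=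
        lintegral_const_mul' _ _ (ENNReal.rpow_ne_top_of_nonneg hp1 hA)
    _ ≤ A ^ (p - 1) * A := by gcongr
    _ = A ^ p := (ennreal_rpow_eq_rpow_sub_one_mul A hp).symm

theorem rpow_tsum_rpow_le_tsum {ι : Type*} (b : ι → ℝ≥0∞) {q : ℝ} (hq : 1 ≤ q) :
    (∑' i, b i ^ q) ^ (1 / q) ≤ ∑' i, b i := by
  have : 0 ≤ q - 1 := by linarith
  rw [one_div, ENNReal.rpow_inv_le_iff (by linarith), ennreal_rpow_eq_rpow_sub_one_mul _ hq,
    ← ENNReal.tsum_mul_left]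
  refine ENNReal.tsum_le_tsum fun i => ?_
  rw [ennreal_rpow_eq_rpow_sub_one_mul _ hq]
  gcongr
  exact ENNReal.le_tsum i

theorem tsum_tsum_indicator_le {ι κ : Type*} (I : κ → Set ι) (a : ι → ℝ≥0∞) {K : ℕ}
    (hK : ∀ i, {j | i ∈ I j}.encard ≤ K) :
    ∑' j, ∑' i, (I j).indicator a i ≤ K * ∑' i, a i := by
  rw [ENNReal.tsum_comm, ← ENNReal.tsum_mul_left]
  refine ENNReal.tsum_le_tsum fun i => ?_
  have hswap : ∀ j, (I j).indicator a i = {j | i ∈ I j}.indicator (fun _ => a i) j :=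
    fun _ => rfl
  simp only [hswap]
  rw [← tsum_subtype, ENNReal.tsum_set_const]
  gcongr
  exact_mod_cast ENat.toENNReal_le.2 (hK i)

end PowerSums

section FourierIntegrals

variable {E F : Type*} [NormedAddCommGroup E] [InnerProductSpace ℝ E] [FiniteDimensional ℝ E]
  [MeasurableSpace E] [BorelSpace E] [NormedAddCommGroup F] [NormedSpace ℂ F]

theorem continuous_fourier_of_integrable {u : E → F} (hu : Integrable u) : Continuous (𝓕 u) :=
  VectorFourier.fourierIntegral_continuous Real.continuous_fourierChar continuous_inner hu

theorem continuous_fourierInv_of_integrable {u : E → F} (hu : Integrable u) :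
    Continuous (𝓕⁻ u) := by
  rw [Real.fourierInv_eq_fourier_comp_neg]
  exact continuous_fourier_of_integrable hu.comp_neg

theorem norm_fourier_le_integral_norm (u : E → F) (ξ : E) : ‖𝓕 u ξ‖ ≤ ∫ x, ‖u x‖ :=
  VectorFourier.norm_fourierIntegral_le_integral_norm _ _ _ _ _

theorem norm_fourierInv_le_integral_norm (u : E → F) (x : E) : ‖𝓕⁻ u x‖ ≤ ∫ ξ, ‖u ξ‖ := by
  rw [Real.fourierInv_eq_fourier_neg]
  exact norm_fourier_le_integral_norm u _

theorem integral_mul_fourier_eq {u v : E → ℂ} (hu : Integrable u) (hv : Integrable v) :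
    ∫ x, u x * 𝓕 v x = ∫ x, 𝓕 u x * v x := by
  have h := VectorFourier.integral_fourierIntegral_smul_eq_flip (L := innerₗ E)
    Real.continuous_fourierChar continuous_inner hu hv
  simp only [smul_eq_mul, flip_innerₗ] at h
  exact h.symm

theorem fourier_zero_function : 𝓕 (0 : E → F) = 0 := by
  ext ξ
  simp [Real.fourier_eq]

theorem eq_zero_of_fourier_eq_zero [CompleteSpace F] {u : E → F} (hu : Integrable u)
    (hc : Continuous u) (h : 𝓕 u = 0) : u = 0 := by
  rw [← hc.fourierInv_fourier_eq hu (h ▸ integrable_zero _ _ _), h,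
    Real.fourierInv_eq_fourier_comp_neg]
  exact fourier_zero_function

theorem eq_zero_of_fourierInv_eq_zero [CompleteSpace F] {u : E → F} (hu : Integrable u)
    (hc : Continuous u) (h : 𝓕⁻ u = 0) : u = 0 := by
  refine eq_zero_of_fourier_eq_zero hu hc (funext fun ξ => ?_)
  rw [← neg_neg ξ, ← Real.fourierInv_eq_fourier_neg, h, Pi.zero_apply, Pi.zero_apply]

theorem fourier_fourierInv_eq_of_integrable [CompleteSpace F] {u : E → F} (hc : Continuous u)
    (hu : Integrable u) (hi : Integrable (𝓕⁻ u)) : 𝓕 (𝓕⁻ u) = u := by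
  refine hc.fourier_fourierInv_eq hu ?_
  convert! hi.comp_neg using 2 with ξ
  rw [Real.fourierInv_eq_fourier_neg, neg_neg]

theorem hasSum_fourier_tsum {ι : Type*} [Countable ι] {v : ι → E → F}
    (hv : ∀ i, Integrable (v i)) (hsum : Summable fun i => ∫ x, ‖v i x‖)
    (hpt : ∀ x, Summable fun i => v i x) (ξ : E) :
    HasSum (fun i => 𝓕 (v i) ξ) (𝓕 (fun x => ∑' i, v i x) ξ) := by
  have h := hasSum_integral_of_summable_integral_norm (μ := volume)
    (F := fun i x => Real.fourierChar (-inner ℝ x ξ) • v i x)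
    (fun i => (Real.fourierIntegral_convergent_iff ξ).2 (hv i))
    (by simpa only [Circle.norm_smul] using hsum)
  simp only [Real.fourier_eq]
  convert! h using 2
  ext x
  simp only [Circle.smul_def]
  exact (hpt x).tsum_const_smul _ |>.symm

/-- A family of continuous functions bounded, both uniformly and in `L¹`, by a summable family of
numbers. Its sum and the Fourier transform of its sum can be computed term by term. -/
structure IsSummablyBounded {α ι F : Type*} [TopologicalSpace α] [MeasureSpace α]
    [NormedAddCommGroup F] (v : ι → α → F) (a : ι → ℝ) : Prop where
  summable : Summable a
  continuous : ∀ i, Continuous (v i)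
  integrable : ∀ i, Integrable (v i)
  norm_le : ∀ i x, ‖v i x‖ ≤ a i
  integral_norm_le : ∀ i, ∫ x, ‖v i x‖ ≤ a i

namespace IsSummablyBounded

variable {α ι F : Type*} [TopologicalSpace α] [MeasureSpace α] [NormedAddCommGroup F]
  {v : ι → α → F} {a : ι → ℝ} (hv : IsSummablyBounded v a)

include hv

theorem nonneg (i : ι) : 0 ≤ a i :=
  (integral_nonneg fun _ => norm_nonneg _).trans (hv.integral_norm_le i)

theorem summable_integral_norm : Summable fun i => ∫ x, ‖v i x‖ :=
  hv.summable.of_nonneg_of_le (fun _ => integral_nonneg fun _ => norm_nonneg _) hv.integral_norm_le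

theorem summable_norm_apply (x : α) : Summable fun i => ‖v i x‖ :=
  hv.summable.of_nonneg_of_le (fun _ => norm_nonneg _) fun i => hv.norm_le i x

theorem norm_tsum_le (x : α) : ‖∑' i, v i x‖ ≤ ∑' i, a i :=
  (norm_tsum_le_tsum_norm (hv.summable_norm_apply x)).trans
    ((hv.summable_norm_apply x).tsum_le_tsum (fun i => hv.norm_le i x) hv.summable)

theorem indicator (I : Set ι) : IsSummablyBounded (I.indicator v) (I.indicator a) where
  summable := hv.summable.indicator I
  continuous i := by
    by_cases hi : i ∈ I
    · simpa only [indicator_of_mem hi] using hv.continuous i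
    · simpa only [indicator_of_notMem hi] using continuous_zero
  integrable i := by
    by_cases hi : i ∈ I
    · simpa only [indicator_of_mem hi] using hv.integrable i
    · simpa only [indicator_of_notMem hi] using integrable_zero α F volume
  norm_le i x := by
    by_cases hi : i ∈ I
    · simpa only [indicator_of_mem hi] using hv.norm_le i x
    · simp [hi]
  integral_norm_le i := by
    by_cases hi : i ∈ I
    · simpa only [indicator_of_mem hi] using hv.integral_norm_le i
    · simp [hi]

variable [CompleteSpace F]

theorem summable_apply (x : α) : Summable fun i => v i x :=
  (hv.summable_norm_apply x).of_norm

theorem continuous_tsum : Continuous fun x => ∑' i, v i x :=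
  _root_.continuous_tsum hv.continuous hv.summable hv.norm_le

theorem integrable_tsum [Countable ι] : Integrable fun x => ∑' i, v i x :=
  integrable_tsum_of_summable_integral_norm hv.integrable hv.summable_integral_norm

theorem integral_norm_tsum_le [Countable ι] : ∫ x, ‖∑' i, v i x‖ ≤ ∑' i, a i :=
  (_root_.integral_norm_tsum_le hv.integrable hv.summable_integral_norm).trans
    (hv.summable_integral_norm.tsum_le_tsum hv.integral_norm_le hv.summable)

end IsSummablyBounded

theorem IsSummablyBounded.hasSum_fourier [CompleteSpace F] {ι : Type*} [Countable ι]
    {v : ι → E → F} {a : ι → ℝ} (hv : IsSummablyBounded v a) (ξ : E) :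
    HasSum (fun i => 𝓕 (v i) ξ) (𝓕 (fun x => ∑' i, v i x) ξ) :=
  hasSum_fourier_tsum hv.integrable hv.summable_integral_norm hv.summable_apply ξ

theorem IsSummablyBounded.comp_mul {α β ι : Type*} [TopologicalSpace α] [MeasureSpace α]
    [TopologicalSpace β] [MeasureSpace β] [OpensMeasurableSpace β] {v : ι → α → ℂ} {a : ι → ℝ}
    (hv : IsSummablyBounded v a) {g : β → α} (hg : Continuous g) {w : ι → β → ℂ} {B : ℝ}
    (hwc : ∀ i, Continuous (w i)) (hwi : ∀ i, Integrable (w i)) (hwB : ∀ i x, ‖w i x‖ ≤ B)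
    (hwB' : ∀ i, ∫ x, ‖w i x‖ ≤ B) :
    IsSummablyBounded (fun i x => v i (g x) * w i x) (fun i => a i * B) where
  summable := hv.summable.mul_right B
  continuous i := ((hv.continuous i).comp hg).mul (hwc i)
  integrable i := (hwi i).bdd_mul ((hv.continuous i).comp hg).aestronglyMeasurable
    (.of_forall fun x => hv.norm_le i (g x))
  norm_le i x := by
    rw [norm_mul]
    exact mul_le_mul (hv.norm_le i _) (hwB i x) (norm_nonneg _) (hv.nonneg i)
  integral_norm_le i := by
    calc ∫ x, ‖v i (g x) * w i x‖ ≤ ∫ x, a i * ‖w i x‖ := by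
          refine integral_mono_of_nonneg (.of_forall fun _ => norm_nonneg _)
            ((hwi i).norm.const_mul _) (.of_forall fun x => (norm_mul _ _).trans_le ?_)
          exact mul_le_mul_of_nonneg_right (hv.norm_le i _) (norm_nonneg _)
      _ ≤ a i * B := by
          rw [integral_const_mul]
          exact mul_le_mul_of_nonneg_left (hwB' i) (hv.nonneg i)

end FourierIntegrals

/-! ### Distributions with a Fourier density -/

section Reservoir

variable {E : Type*} [NormedAddCommGroup E] [InnerProductSpace ℝ E]

theorem modulate_apply (ψ : 𝓓((⊤ : TopologicalSpace.Opens E), ℝ)) (x η : E) :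
    modulate ψ x η = (ψ η : ℂ) * Complex.exp ((2 * Real.pi * inner ℝ η x : ℝ) * Complex.I) := rfl

theorem continuous_testFunction_mul (ψ : 𝓓((⊤ : TopologicalSpace.Opens E), ℝ)) {h : E → ℂ}
    (hh : Continuous h) : Continuous fun ξ => (ψ ξ : ℂ) * h ξ :=
  (Complex.continuous_ofReal.comp ψ.continuous).mul hh

variable [FiniteDimensional ℝ E] [MeasurableSpace E] [BorelSpace E]

theorem integrable_testFunction_mul (ψ : 𝓓((⊤ : TopologicalSpace.Opens E), ℝ)) {h : E → ℂ}
    (hh : Continuous h) : Integrable fun ξ => (ψ ξ : ℂ) * h ξ :=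
  (continuous_testFunction_mul ψ hh).integrable_of_hasCompactSupport
    (ψ.hasCompactSupport.comp_left (g := ((↑) : ℝ → ℂ)) Complex.ofReal_zero).mul_right

theorem integrable_testFunction (ψ : 𝓓((⊤ : TopologicalSpace.Opens E), ℝ)) :
    Integrable fun ξ => (ψ ξ : ℂ) := by
  simpa only [mul_one] using integrable_testFunction_mul ψ (continuous_const (y := (1 : ℂ)))

theorem eq_of_integral_testFunction_eq {u v : E → ℂ} (hu : Continuous u) (hv : Continuous v)
    (h : ∀ χ : 𝓓((⊤ : TopologicalSpace.Opens E), ℂ), ∫ x, u x * χ x = ∫ x, v x * χ x) :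
    u = v := by
  refine (Continuous.ae_eq_iff_eq volume hu hv).1 ?_
  refine ae_eq_of_integral_contDiff_smul_eq hu.locallyIntegrable hv.locallyIntegrable ?_
  intro g hg hgc
  have hχ : ∫ x, u x * (g x : ℂ) = ∫ x, v x * (g x : ℂ) :=
    h ⟨fun x => (g x : ℂ), Complex.ofRealCLM.contDiff.comp hg,
      hgc.comp_left Complex.ofReal_zero, fun _ _ => trivial⟩
  simpa [mul_comm] using hχ

/-- The distribution `𝓕 f` is integration against the function `h`. -/
def HasFourierDensity (f : FourierReservoir E) (h : E → ℂ) : Prop :=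
  ∀ χ, reservoirFourier f χ = ∫ ξ, h ξ * χ ξ

namespace HasFourierDensity

variable {f : FourierReservoir E} {h : E → ℂ}

theorem eq_zero (hf : HasFourierDensity f 0) : f = 0 := by
  ext z
  obtain ⟨χ, rfl⟩ := (fourierTest E).surjective_rangeRestrict z
  change reservoirFourier f χ = 0
  simp [hf χ]

theorem frequencyPiece_eq_fourierInv (hf : HasFourierDensity f h)
    (ψ : 𝓓((⊤ : TopologicalSpace.Opens E), ℝ)) :
    frequencyPiece ψ f = 𝓕⁻ (fun ξ => (ψ ξ : ℂ) * h ξ) := by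
  ext x
  rw [frequencyPiece, hf, Real.fourierInv_eq']
  congr 1 with ξ
  rw [modulate_apply, smul_eq_mul]
  ring

theorem frequencyPiece_congr {f' : FourierReservoir E} {h' : E → ℂ} (hf : HasFourierDensity f h)
    (hf' : HasFourierDensity f' h') {ψ : 𝓓((⊤ : TopologicalSpace.Opens E), ℝ)}
    (hh : ∀ ξ, ψ ξ ≠ 0 → h ξ = h' ξ) : frequencyPiece ψ f = frequencyPiece ψ f' := by
  rw [hf.frequencyPiece_eq_fourierInv, hf'.frequencyPiece_eq_fourierInv]
  congr 1 with ξ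
  obtain hψ | hψ := eq_or_ne (ψ ξ) 0
  · simp [hψ]
  · rw [hh ξ hψ]

theorem continuous_frequencyPiece (hf : HasFourierDensity f h) (hh : Continuous h)
    (ψ : 𝓓((⊤ : TopologicalSpace.Opens E), ℝ)) : Continuous (frequencyPiece ψ f) := by
  rw [hf.frequencyPiece_eq_fourierInv]
  exact continuous_fourierInv_of_integrable (integrable_testFunction_mul ψ hh)

theorem fourier_frequencyPiece (hf : HasFourierDensity f h) (hh : Continuous h)
    {ψ : 𝓓((⊤ : TopologicalSpace.Opens E), ℝ)} (hi : Integrable (frequencyPiece ψ f)) :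
    𝓕 (frequencyPiece ψ f) = fun ξ => (ψ ξ : ℂ) * h ξ := by
  rw [hf.frequencyPiece_eq_fourierInv] at hi ⊢
  exact fourier_fourierInv_eq_of_integrable (continuous_testFunction_mul ψ hh)
    (integrable_testFunction_mul ψ hh) hi

end HasFourierDensity

/-- The inclusion `Z(E) → 𝓢(E)`. -/
noncomputable def FourierTestSpace.toSchwartz : FourierTestSpace E →ₗ[ℂ] 𝓢(E, ℂ) :=
  (LinearMap.range (fourierTest E)).subtype

theorem integrable_mul_schwartz {u : E → ℂ} (hu : Integrable u) (w : 𝓢(E, ℂ)) :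
    Integrable fun x => u x * w x :=
  hu.mul_bdd w.continuous.aestronglyMeasurable
    (.of_forall w.toBoundedContinuousFunction.norm_coe_le_norm)

theorem integral_mul_fourier_testFunction {u : E → ℂ} (hu : Integrable u)
    (χ : 𝓓((⊤ : TopologicalSpace.Opens E), ℂ)) :
    ∫ x, u x * 𝓕 (χ : E → ℂ) x = ∫ ξ, 𝓕 u ξ * χ ξ :=
  integral_mul_fourier_eq hu (χ.continuous.integrable_of_hasCompactSupport χ.hasCompactSupport)

/-- The element of `Z'(E)` represented by an integrable function. -/
noncomputable def reservoirOfIntegrable (u : E → ℂ) (hu : Integrable u) : FourierReservoir E where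
  toFun z := ∫ x, u x * FourierTestSpace.toSchwartz z x
  map_add' z w := by
    simp only [map_add, add_apply, mul_add]
    exact integral_add (integrable_mul_schwartz hu _) (integrable_mul_schwartz hu _)
  map_smul' c z := by
    simp only [map_smul, smul_apply, smul_eq_mul, RingHom.id_apply, mul_left_comm _ c]
    exact integral_const_mul c _
  cont := by
    refine continuous_coinduced_dom.2 ?_
    have hloc : LocallyIntegrable (𝓕 u) := (continuous_fourier_of_integrable hu).locallyIntegrable
    convert! (TestFunction.integralAgainstBilinCLM (Ω := (⊤ : TopologicalSpace.Opens E)) (n := ⊤)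
      (ContinuousLinearMap.mul ℂ ℂ) (volume : Measure E) (𝓕 u)).continuous using 1
    ext χ
    rw [TestFunction.integralAgainstBilinCLM_apply, if_pos (hloc.locallyIntegrableOn _)]
    refine (integral_mul_fourier_testFunction hu χ).trans ?_
    simp only [mul_comm (𝓕 u _), ContinuousLinearMap.mul_apply']

theorem hasFourierDensity_reservoirOfIntegrable {u : E → ℂ} (hu : Integrable u) :
    HasFourierDensity (reservoirOfIntegrable u hu) (𝓕 u) :=
  integral_mul_fourier_testFunction hu

theorem reservoirOfIntegrable_add {u v : E → ℂ} (hu : Integrable u) (hv : Integrable v) :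
    reservoirOfIntegrable (u + v) (hu.add hv) =
      reservoirOfIntegrable u hu + reservoirOfIntegrable v hv := by
  ext z
  refine Eq.trans ?_
    (integral_add (integrable_mul_schwartz hu _) (integrable_mul_schwartz hv _))
  simp only [← add_mul]
  rfl

theorem reservoirOfIntegrable_smul {u : E → ℂ} (c : ℂ) (hu : Integrable u) :
    reservoirOfIntegrable (c • u) (hu.smul c) = c • reservoirOfIntegrable u hu := by
  ext z
  refine Eq.trans ?_ (integral_const_mul c _)
  simp only [← mul_assoc]
  rfl

section YoungInequality

variable {u : E → ℂ} (hu : Integrable u) (ψ : 𝓓((⊤ : TopologicalSpace.Opens E), ℝ))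

theorem frequencyPiece_reservoirOfIntegrable (x : E) :
    frequencyPiece ψ (reservoirOfIntegrable u hu) x =
      ∫ y, u y * 𝓕⁻ (fun ξ => (ψ ξ : ℂ)) (x - y) := by
  change ∫ y, u y * 𝓕 (modulate ψ x : E → ℂ) y = _
  congr 1 with y
  congr 1
  rw [Real.fourier_eq', Real.fourierInv_eq']
  congr 1 with ξ
  rw [modulate_apply, smul_eq_mul, smul_eq_mul, mul_left_comm, ← Complex.exp_add, mul_comm]
  congr 2
  rw [inner_sub_right]
  push_cast
  ring

theorem enorm_frequencyPiece_le_lintegral (x : E) :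
    ‖frequencyPiece ψ (reservoirOfIntegrable u hu) x‖ₑ ≤
      ∫⁻ y, ‖u y‖ₑ * ‖𝓕⁻ (fun ξ => (ψ ξ : ℂ)) (x - y)‖ₑ := by
  rw [frequencyPiece_reservoirOfIntegrable]
  simpa only [enorm_mul] using enorm_integral_le_lintegral_enorm
    fun y => u y * 𝓕⁻ (fun ξ => (ψ ξ : ℂ)) (x - y)

theorem measurable_enorm_fourierInv_testFunction :
    Measurable fun y => ‖𝓕⁻ (fun ξ => (ψ ξ : ℂ)) y‖ₑ :=
  (continuous_fourierInv_of_integrable (integrable_testFunction ψ)).measurable.enorm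

theorem enorm_frequencyPiece_le {B : ℝ≥0∞} (hB : ∀ y, ‖u y‖ₑ ≤ B) (x : E) :
    ‖frequencyPiece ψ (reservoirOfIntegrable u hu) x‖ₑ ≤
      B * eLpNorm (𝓕⁻ (fun ξ => (ψ ξ : ℂ))) 1 volume := by
  calc _ ≤ ∫⁻ y, ‖u y‖ₑ * ‖𝓕⁻ (fun ξ => (ψ ξ : ℂ)) (x - y)‖ₑ :=
        enorm_frequencyPiece_le_lintegral hu ψ x
    _ ≤ ∫⁻ y, B * ‖𝓕⁻ (fun ξ => (ψ ξ : ℂ)) (x - y)‖ₑ :=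
        lintegral_mono fun y => mul_le_mul_left (hB y) _
    _ = _ := by
        rw [lintegral_const_mul B (f := fun y => ‖𝓕⁻ (fun ξ => (ψ ξ : ℂ)) (x - y)‖ₑ)
            ((measurable_enorm_fourierInv_testFunction ψ).comp (measurable_id.const_sub x)),
          lintegral_sub_left_eq_self (fun y => ‖𝓕⁻ (fun ξ => (ψ ξ : ℂ)) y‖ₑ) x,
          eLpNorm_one_eq_lintegral_enorm]

theorem lintegral_enorm_frequencyPiece_le :
    ∫⁻ x, ‖frequencyPiece ψ (reservoirOfIntegrable u hu) x‖ₑ ≤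
      (∫⁻ y, ‖u y‖ₑ) * eLpNorm (𝓕⁻ (fun ξ => (ψ ξ : ℂ))) 1 volume := by
  have hm := measurable_enorm_fourierInv_testFunction ψ
  calc _ ≤ ∫⁻ x, ∫⁻ y, ‖u y‖ₑ * ‖𝓕⁻ (fun ξ => (ψ ξ : ℂ)) (x - y)‖ₑ :=
        lintegral_mono fun x => enorm_frequencyPiece_le_lintegral hu ψ x
    _ = ∫⁻ y, ∫⁻ x, ‖u y‖ₑ * ‖𝓕⁻ (fun ξ => (ψ ξ : ℂ)) (x - y)‖ₑ := by
        refine lintegral_lintegral_swap ?_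
        have h1 : AEMeasurable (fun z : E × E => ‖u z.2‖ₑ) (volume.prod volume) :=
          hu.1.comp_snd.enorm
        exact h1.mul (hm.comp (measurable_fst.sub measurable_snd)).aemeasurable
    _ = ∫⁻ y, ‖u y‖ₑ * eLpNorm (𝓕⁻ (fun ξ => (ψ ξ : ℂ))) 1 volume := by
        refine lintegral_congr fun y => ?_
        rw [lintegral_const_mul' _ _ enorm_ne_top,
          lintegral_sub_right_eq_self (fun x => ‖𝓕⁻ (fun ξ => (ψ ξ : ℂ)) x‖ₑ) y,
          eLpNorm_one_eq_lintegral_enorm]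
    _ = _ := lintegral_mul_const'' _ hu.1.enorm

theorem eLpNorm_frequencyPiece_le {p : ℝ} (hp : 1 ≤ p) {A B : ℝ≥0∞} (hA : A ≠ ⊤) (hB : B ≠ ⊤)
    (h1 : ∫⁻ y, ‖u y‖ₑ ≤ A) (hsup : ∀ y, ‖u y‖ₑ ≤ A)
    (hψ : eLpNorm (𝓕⁻ (fun ξ => (ψ ξ : ℂ))) 1 volume ≤ B) :
    eLpNorm (frequencyPiece ψ (reservoirOfIntegrable u hu)) (ENNReal.ofReal p) volume ≤ A * B :=
  eLpNorm_le_of_lintegral_le_of_forall_le hp (ENNReal.mul_ne_top hA hB)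
    ((lintegral_enorm_frequencyPiece_le hu ψ).trans (mul_le_mul' h1 hψ))
    fun x => (enorm_frequencyPiece_le hu ψ hsup x).trans (mul_le_mul_right hψ A)

end YoungInequality

end Reservoir

/-! ### The Feichtinger algebra -/

section AdmissiblePartition

variable {E ι : Type*} [TopologicalSpace E] {P : ι → Set E}

theorem IsAdmissibleCovering.locallyFinite (hP : IsAdmissibleCovering P)
    (hopen : ∀ i, IsOpen (P i)) : LocallyFinite P := by
  obtain ⟨M, hM⟩ := hP.bounded
  intro x
  obtain ⟨i, hi⟩ := mem_iUnion.1 (hP.covers.ge (mem_univ x))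
  refine ⟨P i, (hopen i).mem_nhds hi, (finite_of_encard_le_coe (hM i)).subset ?_⟩
  simp only [inter_comm (P i), subset_rfl]

theorem IsAdmissibleCovering.countable [SigmaCompactSpace E] (hP : IsAdmissibleCovering P)
    (hopen : ∀ i, IsOpen (P i)) : Countable ι :=
  countable_univ_iff.1 ((hP.locallyFinite hopen).countable_univ hP.nonempty)

end AdmissiblePartition

theorem hasSum_integral_mul_of_norm_le {α ι : Type*} [MeasurableSpace α] {μ : Measure α}
    [Countable ι] {v : ι → α → ℂ} {a : ι → ℝ} (ha : Summable a)
    (hv : ∀ i, AEStronglyMeasurable (v i) μ) (hva : ∀ i x, ‖v i x‖ ≤ a i) {w : α → ℂ}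
    (hw : Integrable w μ) :
    HasSum (fun i => ∫ x, v i x * w x ∂μ) (∫ x, (∑' i, v i x) * w x ∂μ) := by
  have hinteg : ∀ i, Integrable (fun x => v i x * w x) μ := fun i =>
    hw.bdd_mul (hv i) (.of_forall (hva i))
  simp only [← tsum_mul_right]
  refine hasSum_integral_of_summable_integral_norm hinteg ?_
  refine Summable.of_nonneg_of_le (fun _ => integral_nonneg fun _ => norm_nonneg _) (fun i => ?_)
    (ha.mul_right (∫ x, ‖w x‖ ∂μ))
  rw [← integral_const_mul]
  refine integral_mono (hinteg i).norm (hw.norm.const_mul _) fun x => ?_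
  exact (norm_mul _ _).trans_le (mul_le_mul_of_nonneg_right (hva i x) (norm_nonneg _))

section FeichtingerAlgebra

variable {E ι : Type*} [NormedAddCommGroup E] [InnerProductSpace ℝ E] [FiniteDimensional ℝ E]
  [MeasurableSpace E] [BorelSpace E] {P : ι → Set E}
  {φ : ι → 𝓓((⊤ : TopologicalSpace.Opens E), ℝ)} {f : FourierReservoir E}

theorem IsBAPU.hasSum_apply_realMul (hP : IsAdmissibleCovering P) (hopen : ∀ i, IsOpen (P i))
    (hφ : IsBAPU P φ) {F : Type*} [AddCommMonoid F] [Module ℂ F] [TopologicalSpace F]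
    (T : 𝓓((⊤ : TopologicalSpace.Opens E), ℂ) →ₗ[ℂ] F)
    (χ : 𝓓((⊤ : TopologicalSpace.Opens E), ℂ)) :
    HasSum (fun i => T (realMul (φ i) χ)) (T χ) := by
  have hfin : {i | (P i ∩ tsupport χ).Nonempty}.Finite :=
    (hP.locallyFinite hopen).finite_nonempty_inter_compact χ.hasCompactSupport
  have hzero : ∀ i ∉ hfin.toFinset, realMul (φ i) χ = 0 := fun i hi => by
    ext ξ
    by_contra hne
    obtain ⟨h1, h2⟩ := mul_ne_zero_iff.1 hne
    exact hi (hfin.mem_toFinset.2 ⟨ξ, hφ.tsupport_subset i (subset_tsupport _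
      (Complex.ofReal_ne_zero.1 h1)), subset_tsupport _ h2⟩)
  have hsum : ∑ i ∈ hfin.toFinset, realMul (φ i) χ = χ := by
    ext ξ
    have h1 : HasSum (fun i => (φ i ξ : ℂ) * χ ξ) (1 * χ ξ) := by
      simpa using (Complex.ofRealCLM.hasSum (hφ.hasSum_one ξ)).mul_right (χ ξ)
    have h2 : HasSum (fun i => (φ i ξ : ℂ) * χ ξ)
        (∑ i ∈ hfin.toFinset, (φ i ξ : ℂ) * χ ξ) :=
      hasSum_sum_of_ne_finset_zero fun i hi => DFunLike.congr_fun (hzero i hi) ξ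
    rw [FunLike.coe_sum, Finset.sum_apply]
    exact (h2.unique h1).trans (one_mul _)
  have hT : HasSum (fun i => T (realMul (φ i) χ))
      (∑ i ∈ hfin.toFinset, T (realMul (φ i) χ)) :=
    hasSum_sum_of_ne_finset_zero fun i hi => by rw [hzero i hi, map_zero]
  rwa [← map_sum, hsum] at hT

theorem integral_fourier_frequencyPiece_mul {ψ : 𝓓((⊤ : TopologicalSpace.Opens E), ℝ)}
    (hi : Integrable (frequencyPiece ψ f)) (χ : 𝓓((⊤ : TopologicalSpace.Opens E), ℂ)) :
    ∫ ξ, 𝓕 (frequencyPiece ψ f) ξ * χ ξ = reservoirFourier f (realMul ψ χ) := by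
  rw [← integral_mul_fourier_testFunction hi]
  exact integral_modulate_mul_fourier _ _ _

theorem exists_continuous_hasFourierDensity (hP : IsAdmissibleCovering P)
    (hopen : ∀ i, IsOpen (P i)) (hφ : IsBAPU P φ)
    (hi : ∀ i, Integrable (frequencyPiece (φ i) f))
    (hs : Summable fun i => ∫ x, ‖frequencyPiece (φ i) f x‖) :
    ∃ h : E → ℂ, Continuous h ∧ HasFourierDensity f h := by
  have := hP.countable hopen
  have hcont : ∀ i, Continuous (𝓕 (frequencyPiece (φ i) f)) := fun i =>
    continuous_fourier_of_integrable (hi i)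
  have hbound := fun i => norm_fourier_le_integral_norm (frequencyPiece (φ i) f)
  refine ⟨fun ξ => ∑' i, 𝓕 (frequencyPiece (φ i) f) ξ, continuous_tsum hcont hs hbound,
    fun χ => ?_⟩
  refine (hφ.hasSum_apply_realMul hP hopen (reservoirFourier f).toLinearMap χ).unique ?_
  have hχ : Integrable χ := χ.continuous.integrable_of_hasCompactSupport χ.hasCompactSupport
  have hsum := hasSum_integral_mul_of_norm_le hs (fun i => (hcont i).aestronglyMeasurable)
    hbound hχ
  simp only [integral_fourier_frequencyPiece_mul (hi _)] at hsum
  exact hsum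

theorem integrable_frequencyPiece_of_mem (hf : f ∈ modulationSpace φ 1 1 le_rfl) (i : ι) :
    Integrable (frequencyPiece (φ i) f) :=
  memLp_one_iff_integrable.1 (by simpa only [ENNReal.ofReal_one] using hf.1 i)

theorem modulationNorm_one_one (φ : ι → 𝓓((⊤ : TopologicalSpace.Opens E), ℝ))
    (f : FourierReservoir E) :
    modulationNorm φ 1 1 f = ∑' i, ∫⁻ x, ‖frequencyPiece (φ i) f x‖ₑ := by
  simp only [modulationNorm, ENNReal.rpow_one, one_div, inv_one, ENNReal.ofReal_one,
    eLpNorm_one_eq_lintegral_enorm]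

theorem modulationNorm_one_one_eq_tsum_ofReal (hf : f ∈ modulationSpace φ 1 1 le_rfl) :
    modulationNorm φ 1 1 f = ∑' i, ENNReal.ofReal (∫ x, ‖frequencyPiece (φ i) f x‖) := by
  rw [modulationNorm_one_one]
  exact tsum_congr fun i =>
    (ofReal_integral_norm_eq_lintegral_enorm (integrable_frequencyPiece_of_mem hf i)).symm

theorem summable_integral_norm_frequencyPiece_of_mem (hf : f ∈ modulationSpace φ 1 1 le_rfl) :
    Summable fun i => ∫ x, ‖frequencyPiece (φ i) f x‖ := by
  have h := modulationNorm_one_one_eq_tsum_ofReal hf ▸ hf.2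
  simpa only [ENNReal.toReal_ofReal (integral_nonneg fun _ => norm_nonneg _)]
    using ENNReal.summable_toReal h.ne

theorem HasFourierDensity.norm_frequencyPiece_le {h : E → ℂ} (hf : HasFourierDensity f h)
    (hh : Continuous h) {ψ : 𝓓((⊤ : TopologicalSpace.Opens E), ℝ)}
    (hi : Integrable (frequencyPiece ψ f)) (x : E) :
    ‖frequencyPiece ψ f x‖ ≤ volume.real (tsupport ψ) * ∫ y, ‖frequencyPiece ψ f y‖ := by
  have hF := hf.fourier_frequencyPiece hh hi
  calc ‖frequencyPiece ψ f x‖ ≤ ∫ ξ, ‖(ψ ξ : ℂ) * h ξ‖ := by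
        rw [hf.frequencyPiece_eq_fourierInv]
        exact norm_fourierInv_le_integral_norm _ _
    _ = ∫ ξ in tsupport ψ, ‖(ψ ξ : ℂ) * h ξ‖ := by
        refine (setIntegral_eq_integral_of_forall_compl_eq_zero fun ξ hξ => ?_).symm
        simp [image_eq_zero_of_notMem_tsupport hξ]
    _ ≤ (∫ y, ‖frequencyPiece ψ f y‖) * volume.real (tsupport ψ) := by
        refine (le_abs_self _).trans (norm_setIntegral_le_of_norm_le_const (μ := volume)
          (f := fun ξ => ‖(ψ ξ : ℂ) * h ξ‖) ψ.hasCompactSupport.measure_lt_top fun ξ _ => ?_)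
        rw [norm_norm, ← congrFun hF ξ]
        exact norm_fourier_le_integral_norm _ _
    _ = _ := mul_comm _ _

/-- A bounded admissible partition of unity `φ` subordinate to an admissible covering by open sets
`P i`, each contained in the ball of radius `b` around a chosen frequency `t i`. -/
structure IsLocalizedBAPU (P : ι → Set E) (φ : ι → 𝓓((⊤ : TopologicalSpace.Opens E), ℝ))
    (t : ι → E) (b : ℝ) : Prop where
  admissible : IsAdmissibleCovering P
  isOpen : ∀ i, IsOpen (P i)
  isBAPU : IsBAPU P φ
  subset_closedBall : ∀ i, P i ⊆ Metric.closedBall (t i) b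

namespace IsLocalizedBAPU

variable {t : ι → E} {b : ℝ} (hφ : IsLocalizedBAPU P φ t b)

include hφ

theorem countable : Countable ι := hφ.admissible.countable hφ.isOpen

theorem mem_closedBall_of_ne_zero {i : ι} {ξ : E} (h : φ i ξ ≠ 0) :
    ξ ∈ Metric.closedBall (t i) b :=
  hφ.subset_closedBall i (hφ.isBAPU.tsupport_subset i (subset_tsupport _ h))

theorem exists_continuous_hasFourierDensity (hf : f ∈ modulationSpace φ 1 1 le_rfl) :
    ∃ h : E → ℂ, Continuous h ∧ HasFourierDensity f h :=
  _root_.exists_continuous_hasFourierDensity hφ.admissible hφ.isOpen hφ.isBAPU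
    (integrable_frequencyPiece_of_mem hf) (summable_integral_norm_frequencyPiece_of_mem hf)

theorem volume_real_tsupport_le (i : ι) :
    volume.real (tsupport (φ i)) ≤ volume.real (Metric.closedBall (0 : E) b) := by
  refine (measureReal_mono ((hφ.isBAPU.tsupport_subset i).trans (hφ.subset_closedBall i))
    measure_closedBall_lt_top.ne).trans_eq ?_
  rw [measureReal_def, measureReal_def, Measure.addHaar_closedBall_center]

theorem isSummablyBounded_frequencyPiece (hf : f ∈ modulationSpace φ 1 1 le_rfl) :
    IsSummablyBounded (fun i => frequencyPiece (φ i) f) fun i =>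
      max 1 (volume.real (Metric.closedBall (0 : E) b)) * ∫ x, ‖frequencyPiece (φ i) f x‖ := by
  obtain ⟨h, hh, hfh⟩ := hφ.exists_continuous_hasFourierDensity hf
  have hnonneg : ∀ i, 0 ≤ ∫ x, ‖frequencyPiece (φ i) f x‖ := fun i =>
    integral_nonneg fun _ => norm_nonneg _
  refine ⟨(summable_integral_norm_frequencyPiece_of_mem hf).mul_left _,
    fun i => hfh.continuous_frequencyPiece hh _, integrable_frequencyPiece_of_mem hf,
    fun i x => ?_, fun i => le_mul_of_one_le_left (hnonneg i) (le_max_left _ _)⟩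
  refine (hfh.norm_frequencyPiece_le hh (integrable_frequencyPiece_of_mem hf i) x).trans ?_
  exact mul_le_mul_of_nonneg_right
    ((hφ.volume_real_tsupport_le i).trans (le_max_right _ _)) (hnonneg i)

end IsLocalizedBAPU

end FeichtingerAlgebra

section SumsOfLocalizedTerms

variable {E ι : Type*} [NormedAddCommGroup E] [InnerProductSpace ℝ E] [FiniteDimensional ℝ E]
  [MeasurableSpace E] [BorelSpace E] [Countable ι] {v : ι → E → ℂ} {a : ι → ℝ}

/-- Only those terms contribute to a frequency piece of the sum whose Fourier transforms meet the
support of the window. -/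
theorem IsSummablyBounded.eLpNorm_frequencyPiece_tsum_le (hv : IsSummablyBounded v a)
    {ψ : 𝓓((⊤ : TopologicalSpace.Opens E), ℝ)} {I : Set ι}
    (hI : ∀ i ∉ I, ∀ ξ, ψ ξ ≠ 0 → 𝓕 (v i) ξ = 0) {C : ℝ≥0}
    (hC : eLpNorm (𝓕⁻ (fun ξ => (ψ ξ : ℂ))) 1 volume ≤ C) {p : ℝ} (hp : 1 ≤ p) :
    eLpNorm (frequencyPiece ψ (reservoirOfIntegrable _ hv.integrable_tsum)) (ENNReal.ofReal p)
      volume ≤ (∑' i, I.indicator (fun i => ENNReal.ofReal (a i)) i) * C := by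
  have hvI := hv.indicator I
  have hpiece : frequencyPiece ψ (reservoirOfIntegrable _ hv.integrable_tsum) =
      frequencyPiece ψ (reservoirOfIntegrable _ hvI.integrable_tsum) := by
    refine (hasFourierDensity_reservoirOfIntegrable _).frequencyPiece_congr
      (hasFourierDensity_reservoirOfIntegrable _) fun ξ hξ => (hv.hasSum_fourier ξ).unique ?_
    convert! hvI.hasSum_fourier ξ using 2 with i
    by_cases hi : i ∈ I
    · rw [indicator_of_mem hi]
    · rw [indicator_of_notMem hi, hI i hi ξ hξ, fourier_zero_function, Pi.zero_apply]
  have hsum : ∑' i, I.indicator (fun i => ENNReal.ofReal (a i)) i =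
      ENNReal.ofReal (∑' i, I.indicator a i) := by
    rw [ENNReal.ofReal_tsum_of_nonneg hvI.nonneg hvI.summable]
    exact tsum_congr fun i =>
      congrFun (indicator_comp_of_zero (g := ENNReal.ofReal) ENNReal.ofReal_zero) i
  rw [hpiece, hsum]
  refine eLpNorm_frequencyPiece_le _ ψ hp ENNReal.ofReal_ne_top ENNReal.coe_ne_top ?_
    (fun y => ?_) hC
  · rw [← ofReal_integral_norm_eq_lintegral_enorm hvI.integrable_tsum]
    exact ENNReal.ofReal_le_ofReal hvI.integral_norm_tsum_le
  · rw [← ofReal_norm]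
    exact ENNReal.ofReal_le_ofReal (hvI.norm_tsum_le y)

end SumsOfLocalizedTerms

/-! ### Sheared windows -/

section FourierSubstitutions

variable {E : Type*} [NormedAddCommGroup E] [InnerProductSpace ℝ E] [FiniteDimensional ℝ E]
  [MeasurableSpace E] [BorelSpace E]

theorem fourier_inner_mul {κ : ℝ → ℂ} (hκ : Integrable κ) {g : E → ℂ} (hg : Integrable g)
    (X ξ : E) :
    𝓕 (fun x => 𝓕⁻ κ (inner ℝ X x) * g x) ξ = ∫ t, κ t * 𝓕 g (ξ - t • X) := by
  have hinteg : Integrable (fun z : E × ℝ => Complex.exp (((2 * Real.pi * (z.2 * inner ℝ X z.1) -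
      2 * Real.pi * inner ℝ z.1 ξ : ℝ)) * Complex.I) * (g z.1 * κ z.2)) := by
    refine (hg.mul_prod hκ).bdd_mul (c := 1) (Continuous.aestronglyMeasurable (by fun_prop))
      (.of_forall fun z => ?_)
    rw [Complex.norm_exp_ofReal_mul_I]
  calc 𝓕 (fun x => 𝓕⁻ κ (inner ℝ X x) * g x) ξ
      = ∫ x, ∫ t, Complex.exp (((2 * Real.pi * (t * inner ℝ X x) -
          2 * Real.pi * inner ℝ x ξ : ℝ)) * Complex.I) * (g x * κ t) := by
        rw [Real.fourier_eq']
        refine integral_congr_ae (.of_forall fun x => ?_)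
        simp only [Real.fourierInv_eq', smul_eq_mul, ← integral_mul_const, ← integral_const_mul]
        refine integral_congr_ae (.of_forall fun t => ?_)
        simp only [RCLike.inner_apply, conj_trivial, Complex.ofReal_sub, sub_mul, Complex.exp_sub]
        rw [mul_comm (inner ℝ X x)]
        simp only [neg_mul, Complex.ofReal_neg, Complex.exp_neg]
        ring
    _ = ∫ t, ∫ x, Complex.exp (((2 * Real.pi * (t * inner ℝ X x) -
          2 * Real.pi * inner ℝ x ξ : ℝ)) * Complex.I) * (g x * κ t) :=
        integral_integral_swap hinteg
    _ = ∫ t, κ t * 𝓕 g (ξ - t • X) := by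
        refine integral_congr_ae (.of_forall fun t => ?_)
        simp only [Real.fourier_eq', ← integral_const_mul]
        refine integral_congr_ae (.of_forall fun x => ?_)
        simp only [inner_sub_right, inner_smul_right, real_inner_comm X x, smul_eq_mul]
        rw [mul_comm (g x), mul_left_comm]
        congr 3
        push_cast
        ring

theorem fourier_comp_measurePreserving {E' : Type*} [NormedAddCommGroup E']
    [InnerProductSpace ℝ E'] [FiniteDimensional ℝ E'] [MeasurableSpace E'] [BorelSpace E']
    {A B : E → E'} (hA : MeasurePreserving A) (hAB : ∀ x ξ, inner ℝ (A x) (B ξ) = inner ℝ x ξ)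
    {g : E' → ℂ} (hg : AEStronglyMeasurable g) (ξ : E) :
    𝓕 (fun x => g (A x)) ξ = 𝓕 g (B ξ) := by
  have hexp : Continuous fun y : E' =>
      Complex.exp ((-2 * Real.pi * inner ℝ y (B ξ) : ℝ) * Complex.I) := by fun_prop
  have h := integral_map hA.aemeasurable
    (hA.map_eq.symm ▸ hexp.aestronglyMeasurable.smul hg)
  simp only [Pi.smul_apply'] at h
  simpa only [Real.fourier_eq', hA.map_eq, hAB] using h.symm

end FourierSubstitutions

theorem complexMGF_eq_zero_of_eventually_eq_zero {Ω : Type*} [MeasurableSpace Ω] {μ : Measure Ω}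
    {X : Ω → ℝ} (hX : ProbabilityTheory.integrableExpSet X μ = univ) {s₀ : ℝ}
    (h : ∀ᶠ s : ℝ in nhds s₀, ProbabilityTheory.complexMGF X μ (Complex.I * s) = 0) :
    ProbabilityTheory.complexMGF X μ = 0 := by
  have han : AnalyticOnNhd ℂ (ProbabilityTheory.complexMGF X μ) univ := by
    simpa only [hX, interior_univ, mem_univ, ofPred_true] using
      ProbabilityTheory.analyticOnNhd_complexMGF (X := X) (μ := μ)
  have hline : Filter.Tendsto (fun s : ℝ => Complex.I * (s : ℂ)) (nhdsWithin s₀ {s₀}ᶜ)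
      (nhdsWithin (Complex.I * s₀) {Complex.I * (s₀ : ℂ)}ᶜ) := by
    refine (Continuous.continuousWithinAt (by fun_prop)).tendsto_nhdsWithin fun s hs heq => hs ?_
    exact Complex.ofReal_injective (mul_left_cancel₀ Complex.I_ne_zero heq)
  have hfreq : ∃ᶠ z in nhdsWithin (Complex.I * s₀) {Complex.I * (s₀ : ℂ)}ᶜ,
      ProbabilityTheory.complexMGF X μ z = (0 : ℂ → ℂ) z :=
    hline.frequently (h.filter_mono nhdsWithin_le_nhds).frequently
  funext z
  exact han.eqOn_zero_of_preconnected_of_frequently_eq_zero isPreconnected_univ (mem_univ _) hfreq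
    (mem_univ z)

section TestFunctions

variable {E : Type*} [NormedAddCommGroup E] [InnerProductSpace ℝ E] [FiniteDimensional ℝ E]
  [MeasurableSpace E] [BorelSpace E]

/-- The inverse Fourier transform of a compactly supported function is analytic along lines. -/
theorem integral_eq_zero_of_fourierInv_eventually_eq_zero {u : E → ℝ} (hc : Continuous u)
    (hs : HasCompactSupport u) (h0 : ∀ ξ, 0 ≤ u ξ) {x₀ : E} {s₀ : ℝ}
    (h : ∀ᶠ s in nhds s₀, 𝓕⁻ (fun ξ => (u ξ : ℂ)) (s • x₀) = 0) : ∫ ξ, u ξ = 0 := by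
  set μ : Measure E := volume.withDensity fun ξ => ENNReal.ofReal (u ξ)
  set X : E → ℝ := fun ξ => 2 * Real.pi * inner ℝ ξ x₀ with hX
  have hm : Measurable fun ξ => ENNReal.ofReal (u ξ) := hc.measurable.ennreal_ofReal
  have hfin : ∀ᵐ ξ : E, ENNReal.ofReal (u ξ) < ⊤ := .of_forall fun _ => ENNReal.ofReal_lt_top
  have hexp : ProbabilityTheory.integrableExpSet X μ = univ := by
    refine eq_univ_of_forall fun t => ?_
    change Integrable (fun ξ => Real.exp (t * X ξ)) μ
    rw [integrable_withDensity_iff_integrable_smul' hm hfin]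
    simp only [ENNReal.toReal_ofReal (h0 _)]
    exact (hc.smul (by fun_prop)).integrable_of_hasCompactSupport hs.smul_right
  have hval : ∀ s : ℝ, ProbabilityTheory.complexMGF X μ (Complex.I * s) =
      𝓕⁻ (fun ξ => (u ξ : ℂ)) (s • x₀) := fun s => by
    rw [ProbabilityTheory.complexMGF, integral_withDensity_eq_integral_toReal_smul hm hfin,
      Real.fourierInv_eq']
    refine integral_congr_ae (.of_forall fun ξ => ?_)
    simp only [ENNReal.toReal_ofReal (h0 ξ), Complex.real_smul, smul_eq_mul, hX,
      inner_smul_right]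
    rw [mul_comm]
    congr 2
    push_cast
    ring
  have hzero := complexMGF_eq_zero_of_eventually_eq_zero hexp (h.mono fun s hs => (hval s).trans hs)
  have hinteg : 𝓕⁻ (fun ξ => (u ξ : ℂ)) 0 = ((∫ ξ, u ξ : ℝ) : ℂ) := by
    simp [Real.fourierInv_eq', integral_complex_ofReal]
  rw [← Complex.ofReal_eq_zero, ← hinteg, ← zero_smul ℝ x₀, ← hval, hzero, Pi.zero_apply]

theorem integrable_fourierInv_testFunction (θ : 𝓓((⊤ : TopologicalSpace.Opens E), ℝ)) :
    Integrable (𝓕⁻ (fun ξ => (θ ξ : ℂ))) := by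
  let S : 𝓢(E, ℂ) := (θ.hasCompactSupport.comp_left (g := ((↑) : ℝ → ℂ))
    Complex.ofReal_zero).toSchwartzMap (Complex.ofRealCLM.contDiff.comp θ.contDiff)
  have h := (𝓕⁻ S).integrable (μ := volume)
  rwa [SchwartzMap.fourierInv_coe] at h

theorem fourier_fourierInv_testFunction (θ : 𝓓((⊤ : TopologicalSpace.Opens E), ℝ)) :
    𝓕 (𝓕⁻ (fun ξ => (θ ξ : ℂ))) = fun ξ => (θ ξ : ℂ) :=
  fourier_fourierInv_eq_of_integrable (Complex.continuous_ofReal.comp θ.continuous)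
    (integrable_testFunction θ) (integrable_fourierInv_testFunction θ)

theorem exists_testFunction_nonneg_integral_pos (E : Type*) [NormedAddCommGroup E]
    [InnerProductSpace ℝ E] [FiniteDimensional ℝ E] [MeasurableSpace E] [BorelSpace E] :
    ∃ θ : 𝓓((⊤ : TopologicalSpace.Opens E), ℝ), (∀ ξ, 0 ≤ θ ξ) ∧ 0 < ∫ ξ, θ ξ := by
  let β : ContDiffBump (0 : E) := ⟨1, 2, zero_lt_one, one_lt_two⟩
  exact ⟨⟨β, β.contDiff, β.hasCompactSupport, fun _ _ => trivial⟩, fun ξ => β.nonneg,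
    β.integral_pos⟩

end TestFunctions

namespace StratifiedGroup

variable {E : Type*} [NormedAddCommGroup E] [InnerProductSpace ℝ E] [FiniteDimensional ℝ E]
  (G : StratifiedGroup E) (X : E)

/-- The difference between the linear part of the left translation by `t • X` and the identity. -/
noncomputable def shear (t : ℝ) : E →L[ℝ] E :=
  (t / 2) • LinearMap.toContinuousLinearMap (G.bracket X)

theorem shear_apply (t : ℝ) (x : E) : G.shear X t x = (t / 2) • G.bracket X x := rfl

theorem shear_shear (t : ℝ) (x : E) : G.shear X t (G.shear X t x) = 0 := by
  simp only [shear_apply, map_smul, G.bracket_bracket, smul_zero]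

theorem adjoint_shear_eq_zero (t : ℝ) {x : E} (hx : ∀ y ∈ G.V₂, inner ℝ x y = 0) :
    ContinuousLinearMap.adjoint (G.shear X t) x = 0 := by
  refine ext_inner_right ℝ fun y => ?_
  rw [ContinuousLinearMap.adjoint_inner_left, shear_apply, inner_smul_right,
    hx _ (G.bracket_mem X y), mul_zero, inner_zero_left]

theorem inner_add_adjoint_shear_sub_shear (t : ℝ) (x ξ : E) :
    inner ℝ (x + ContinuousLinearMap.adjoint (G.shear X t) x) (ξ - G.shear X t ξ) =
      inner ℝ x ξ := by
  rw [inner_add_left, ContinuousLinearMap.adjoint_inner_left, map_sub, shear_shear, sub_zero,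
    inner_sub_right, sub_add_cancel]

variable [MeasurableSpace E] [BorelSpace E]

theorem measurePreserving_add_adjoint_shear (t : ℝ) :
    MeasurePreserving (fun x => x + ContinuousLinearMap.adjoint (G.shear X t) x)
      (volume : Measure E) volume := by
  refine measurePreserving_add_apply_of_isNilpotent volume
    (T := (ContinuousLinearMap.adjoint (G.shear X t) : E →ₗ[ℝ] E)) ⟨2, ?_⟩
  ext x
  refine ext_inner_right ℝ fun y => ?_
  simp [pow_two, ContinuousLinearMap.adjoint_inner_left, shear_shear]

variable (θ : 𝓓((⊤ : TopologicalSpace.Opens E), ℝ))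

/-- The window at `t • X`, whose Fourier transform is the bump `θ` sheared like the left translation
by `t • X`. -/
noncomputable def window (t : ℝ) (x : E) : ℂ :=
  𝓕⁻ (fun ξ => (θ ξ : ℂ)) (x + ContinuousLinearMap.adjoint (G.shear X t) x)

theorem continuous_window (t : ℝ) : Continuous (G.window X θ t) :=
  (continuous_fourierInv_of_integrable (integrable_testFunction θ)).comp (by fun_prop)

theorem integrable_window (t : ℝ) : Integrable (G.window X θ t) :=
  (G.measurePreserving_add_adjoint_shear X t).integrable_comp_of_integrable
    (integrable_fourierInv_testFunction θ)

theorem norm_window_le (t : ℝ) (x : E) : ‖G.window X θ t x‖ ≤ ∫ ξ, ‖(θ ξ : ℂ)‖ :=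
  norm_fourierInv_le_integral_norm _ _

theorem integral_norm_window (t : ℝ) :
    ∫ x, ‖G.window X θ t x‖ = ∫ x, ‖𝓕⁻ (fun ξ => (θ ξ : ℂ)) x‖ := by
  have hmp := G.measurePreserving_add_adjoint_shear X t
  have hc := continuous_fourierInv_of_integrable (integrable_testFunction θ)
  have h := integral_map hmp.aemeasurable (μ := volume)
    (f := fun x => ‖𝓕⁻ (fun ξ => (θ ξ : ℂ)) x‖) hc.norm.aestronglyMeasurable
  rw [hmp.map_eq] at h
  exact h.symm

theorem fourier_window (t : ℝ) (ξ : E) :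
    𝓕 (G.window X θ t) ξ = (θ (ξ - G.shear X t ξ) : ℂ) := by
  have hc := continuous_fourierInv_of_integrable (integrable_testFunction θ)
  exact (fourier_comp_measurePreserving (G.measurePreserving_add_adjoint_shear X t)
    (G.inner_add_adjoint_shear_sub_shear X t) hc.aestronglyMeasurable ξ).trans
    (congrFun (fourier_fourierInv_testFunction θ) _)

theorem window_of_orthogonal (t : ℝ) {x : E} (hx : ∀ y ∈ G.V₂, inner ℝ x y = 0) :
    G.window X θ t x = 𝓕⁻ (fun ξ => (θ ξ : ℂ)) x := by
  rw [window, G.adjoint_shear_eq_zero X t hx, add_zero]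

theorem exists_ball_of_fourier_window_ne_zero {ν : E → ℝ} (hν : G.IsQuasiNorm ν) (b : ℝ) :
    ∃ R > 0, ∀ s t : ℝ, |t - s| ≤ b → ∀ ξ, 𝓕 (G.window X θ t) (ξ - s • X) ≠ 0 →
      ξ ∈ G.ball ν (s • X) R := by
  have hcont : Continuous fun p : ℝ × E => p.2 + p.1 • G.bracket X p.2 := by
    have : Continuous (G.bracket X) := LinearMap.continuous_of_finiteDimensional _
    fun_prop
  obtain ⟨R, hR0, hR⟩ := hν.exists_lt_of_isBounded
    ((isCompact_Icc.prod θ.hasCompactSupport).image hcont).isBounded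
  refine ⟨R, hR0, fun s t hst ξ hξ => ?_⟩
  rw [fourier_window, Complex.ofReal_ne_zero] at hξ
  have hmem : (t - s) / 2 ∈ Icc (-b) b := by
    rw [mem_Icc, ← abs_le, abs_div, abs_two]
    linarith [(abs_nonneg _).trans hst]
  rw [mem_ball]
  convert hR _ ⟨((t - s) / 2, _), ⟨hmem, subset_tsupport _ hξ⟩, rfl⟩ using 2
  simp only [mul, shear_apply, map_neg, map_smul, map_sub, LinearMap.neg_apply,
    LinearMap.smul_apply, G.bracket_self, G.bracket_bracket, smul_zero, sub_zero]
  module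

end StratifiedGroup

/-! ### Modulation norms on the group -/

section ModulationSpaces

variable {E ι : Type*} [NormedAddCommGroup E] [InnerProductSpace ℝ E] [FiniteDimensional ℝ E]
  [MeasurableSpace E] [BorelSpace E] {f : FourierReservoir E} {h : E → ℂ} {p q : ℝ}

theorem modulationNorm_le_tsum_eLpNorm (φ : ι → 𝓓((⊤ : TopologicalSpace.Opens E), ℝ))
    (hq : 1 ≤ q) (f : FourierReservoir E) :
    modulationNorm φ p q f ≤
      ∑' i, eLpNorm (frequencyPiece (φ i) f) (ENNReal.ofReal p) volume :=
  rpow_tsum_rpow_le_tsum _ hq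

theorem HasFourierDensity.mem_modulationSpace (hf : HasFourierDensity f h) (hh : Continuous h)
    {φ : ι → 𝓓((⊤ : TopologicalSpace.Opens E), ℝ)} (hq : 1 ≤ q)
    (hfin : ∑' i, eLpNorm (frequencyPiece (φ i) f) (ENNReal.ofReal p) volume < ⊤) :
    f ∈ modulationSpace φ p q hq :=
  ⟨fun i => ⟨(hf.continuous_frequencyPiece hh _).aestronglyMeasurable,
    (ENNReal.le_tsum i).trans_lt hfin⟩, (modulationNorm_le_tsum_eLpNorm φ hq f).trans_lt hfin⟩

variable {Q : ι → Set E} {ψ : ι → 𝓓((⊤ : TopologicalSpace.Opens E), ℝ)}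

theorem IsBAPU.exists_ne_zero (hψ : IsBAPU Q ψ) (x : E) : ∃ i, ψ i x ≠ 0 := by
  by_contra! hzero
  have hsum := hψ.hasSum_one x
  simp only [hzero] at hsum
  exact one_ne_zero (hsum.unique hasSum_zero)

theorem HasFourierDensity.mem_essentialSupport (hf : HasFourierDensity f h) (hh : Continuous h)
    (hψ : IsBAPU Q ψ) (hp : 0 < p) {x : E} (hx : h x ≠ 0) : x ∈ essentialSupport Q ψ p f := by
  obtain ⟨i, hi⟩ := hψ.exists_ne_zero x
  refine mem_iUnion₂.2 ⟨i, fun h0 => ?_, hψ.tsupport_subset i (subset_tsupport _ hi)⟩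
  have hc := hf.continuous_frequencyPiece hh (ψ i)
  rw [eLpNorm_eq_zero_iff hc.aestronglyMeasurable (by simpa using hp),
    hc.ae_eq_iff_eq volume continuous_zero, hf.frequencyPiece_eq_fourierInv] at h0
  have hzero := congrFun (eq_zero_of_fourierInv_eq_zero (integrable_testFunction_mul (ψ i) hh)
    (continuous_testFunction_mul (ψ i) hh) h0) x
  exact mul_ne_zero (Complex.ofReal_ne_zero.2 hi) hx hzero

theorem HasFourierDensity.exists_ne_zero_of_mem_essentialSupport (hf : HasFourierDensity f h)
    (hψ : IsBAPU Q ψ) {z : E} (hz : z ∈ essentialSupport Q ψ p f) :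
    ∃ i, ∃ ξ ∈ Q i, z ∈ Q i ∧ h ξ ≠ 0 := by
  obtain ⟨i, hi, hzi⟩ := mem_iUnion₂.1 hz
  by_contra! hzero
  have hzero_density : HasFourierDensity (0 : FourierReservoir E) 0 := fun χ => by
    simp only [Pi.zero_apply, zero_mul, integral_zero]
    rfl
  refine hi ?_
  rw [hf.frequencyPiece_congr hzero_density fun ξ hξ =>
    hzero i ξ (hψ.tsupport_subset i (subset_tsupport _ hξ)) hzi]
  exact eLpNorm_zero

end ModulationSpaces

namespace StratifiedGroup

variable {E ι κ : Type*} [NormedAddCommGroup E] [InnerProductSpace ℝ E] [FiniteDimensional ℝ E]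
  {G : StratifiedGroup E} {ν : E → ℝ}

theorem IsQuasiNorm.exists_smul_mem_ball_smul (hν : G.IsQuasiNorm ν) (X : E) (b : ℝ) :
    ∃ R > 0, ∀ s t : ℝ, |t - s| ≤ b → s • X ∈ G.ball ν (t • X) R := by
  have hcont : Continuous fun τ : ℝ => τ • X := by fun_prop
  obtain ⟨R, hR, hlt⟩ := hν.exists_lt_of_isBounded
    (isCompact_Icc (a := -b) (b := b) |>.image hcont).isBounded
  refine ⟨R, hR, fun s t hst => ?_⟩
  rw [mem_ball, neg_smul_mul_smul]
  exact hlt _ ⟨s - t, mem_Icc.2 (abs_le.1 (abs_sub_comm t s ▸ hst)), rfl⟩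

/-- Each term contributes only to the boundedly many frequency pieces whose covering sets meet the
ball that carries its Fourier transform. -/
theorem IsUniformCovering.exists_tsum_eLpNorm_frequencyPiece_le [MeasurableSpace E] [BorelSpace E]
    [Countable ι] {Q : κ → Set E} (hQ : IsUniformCovering G ν Q) (hν : G.IsQuasiNorm ν)
    {ψ : κ → 𝓓((⊤ : TopologicalSpace.Opens E), ℝ)} (hψ : IsBAPU Q ψ) (R : ℝ) :
    ∃ C : ℝ≥0, ∀ {v : ι → E → ℂ} {a : ι → ℝ} (hv : IsSummablyBounded v a) {c : ι → E},
      (∀ i ξ, 𝓕 (v i) ξ ≠ 0 → ξ ∈ G.ball ν (c i) R) → ∀ {p : ℝ}, 1 ≤ p →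
      ∑' j, eLpNorm (frequencyPiece (ψ j) (reservoirOfIntegrable _ hv.integrable_tsum))
        (ENNReal.ofReal p) volume ≤ C * ∑' i, ENNReal.ofReal (a i) := by
  obtain ⟨B, hB⟩ := hψ.bounded
  obtain ⟨K, hK⟩ := hQ.exists_encard_meeting_le hν R
  refine ⟨K * B, fun {v a} hv {c} hball {p} hp => ?_⟩
  let I : κ → Set ι := fun j => {i | j ∈ meeting Q (G.ball ν (c i) R)}
  have hI : ∀ j, ∀ i ∉ I j, ∀ ξ, ψ j ξ ≠ 0 → 𝓕 (v i) ξ = 0 := fun j i hi ξ hξ => by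
    by_contra hne
    exact hi ⟨ξ, hψ.tsupport_subset j (subset_tsupport _ hξ), hball i ξ hne⟩
  calc _ ≤ ∑' j, (∑' i, (I j).indicator (fun i => ENNReal.ofReal (a i)) i) * B :=
        ENNReal.tsum_le_tsum fun j => hv.eLpNorm_frequencyPiece_tsum_le (hI j) (hB j) hp
    _ ≤ (K * ∑' i, ENNReal.ofReal (a i)) * B := by
        rw [ENNReal.tsum_mul_right]
        exact mul_le_mul_left (tsum_tsum_indicator_le I _ fun i => hK (c i)) _
    _ = _ := by
        push_cast
        ring

end StratifiedGroup

/-! ### Transplantation to a one-parameter subgroup -/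

theorem eq_zero_of_reservoirOfIntegrable_eq_zero {E : Type*} [NormedAddCommGroup E]
    [InnerProductSpace ℝ E] [FiniteDimensional ℝ E] [MeasurableSpace E] [BorelSpace E] {u : E → ℂ}
    (hu : Integrable u) (hc : Continuous u) (h : reservoirOfIntegrable u hu = 0) : u = 0 := by
  refine eq_zero_of_fourier_eq_zero hu hc ?_
  refine eq_of_integral_testFunction_eq (continuous_fourier_of_integrable hu) continuous_zero
    fun χ => ?_
  simp only [← hasFourierDensity_reservoirOfIntegrable hu χ, h, Pi.zero_apply, zero_mul,
    integral_zero]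
  rfl

theorem exists_orthogonal_inner_eq_one {E : Type*} [NormedAddCommGroup E]
    [InnerProductSpace ℝ E] {V : Submodule ℝ E} [V.HasOrthogonalProjection] {X : E} (hX : X ∉ V) :
    ∃ x₀, (∀ y ∈ V, inner ℝ x₀ y = 0) ∧ inner ℝ X x₀ = 1 := by
  rw [← V.orthogonal_orthogonal, Submodule.mem_orthogonal] at hX
  push Not at hX
  obtain ⟨u, hu, hne⟩ := hX
  refine ⟨(inner ℝ u X)⁻¹ • u, fun y hy => ?_, ?_⟩
  · rw [inner_smul_left, Submodule.inner_left_of_mem_orthogonal hy hu, mul_zero]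
  · rw [inner_smul_right, real_inner_comm u X, inv_mul_cancel₀ hne]

section Transplant

variable {ι E : Type*} [NormedAddCommGroup E] [InnerProductSpace ℝ E] [FiniteDimensional ℝ E]
  [MeasurableSpace E] [BorelSpace E] (G : StratifiedGroup E) (X : E)
  (θ : 𝓓((⊤ : TopologicalSpace.Opens E), ℝ)) {P : ι → Set ℝ}
  {φ : ι → 𝓓((⊤ : TopologicalSpace.Opens ℝ), ℝ)} {t : ι → ℝ} {b : ℝ} {f : FourierReservoir ℝ}

/-- The `i`-th frequency piece of `f`, read along `X` and localized by the window at `t i • X`: its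
frequencies are those of the piece, moved from the line to a neighbourhood of the one-parameter
subgroup of `X`. -/
noncomputable def transplantPiece (φ : ι → 𝓓((⊤ : TopologicalSpace.Opens ℝ), ℝ)) (t : ι → ℝ)
    (f : FourierReservoir ℝ) (i : ι) (x : E) : ℂ :=
  frequencyPiece (φ i) f (inner ℝ X x) * G.window X θ (t i) x

theorem exists_isSummablyBounded_transplantPiece (hφ : IsLocalizedBAPU P φ t b) :
    ∃ B : ℝ≥0, ∀ f ∈ modulationSpace φ 1 1 le_rfl,
      IsSummablyBounded (transplantPiece G X θ φ t f) fun i =>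
        B * ∫ s, ‖frequencyPiece (φ i) f s‖ := by
  set A : ℝ := max 1 (volume.real (Metric.closedBall (0 : ℝ) b))
  set A' : ℝ := max (∫ ξ, ‖(θ ξ : ℂ)‖) (∫ x, ‖𝓕⁻ (fun ξ => (θ ξ : ℂ)) x‖)
  have hA0 : 0 ≤ A := zero_le_one.trans (le_max_left _ _)
  have hA'0 : 0 ≤ A' := (integral_nonneg fun _ => norm_nonneg _).trans (le_max_left _ _)
  refine ⟨⟨A * A', mul_nonneg hA0 hA'0⟩, fun f hf => ?_⟩
  convert! (hφ.isSummablyBounded_frequencyPiece hf).comp_mul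
    (g := fun x : E => inner ℝ X x) (B := A') (by fun_prop) (fun i => G.continuous_window X θ (t i))
    (fun i => G.integrable_window X θ (t i))
    (fun i x => (G.norm_window_le X θ (t i) x).trans (le_max_left _ _))
    (fun i => (G.integral_norm_window X θ (t i)).trans_le (le_max_right _ _)) using 2 with i
  exact mul_right_comm _ _ _

theorem continuous_tsum_transplantPiece (hφ : IsLocalizedBAPU P φ t b)
    (hf : f ∈ modulationSpace φ 1 1 le_rfl) :
    Continuous fun x => ∑' i, transplantPiece G X θ φ t f i x := by
  obtain ⟨B, hB⟩ := exists_isSummablyBounded_transplantPiece G X θ hφ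
  exact (hB f hf).continuous_tsum

theorem integrable_tsum_transplantPiece (hφ : IsLocalizedBAPU P φ t b)
    (hf : f ∈ modulationSpace φ 1 1 le_rfl) :
    Integrable fun x => ∑' i, transplantPiece G X θ φ t f i x := by
  have := hφ.countable
  obtain ⟨B, hB⟩ := exists_isSummablyBounded_transplantPiece G X θ hφ
  exact (hB f hf).integrable_tsum

theorem hasSum_fourier_transplantPiece (hφ : IsLocalizedBAPU P φ t b)
    (hf : f ∈ modulationSpace φ 1 1 le_rfl) (ξ : E) :
    HasSum (fun i => 𝓕 (transplantPiece G X θ φ t f i) ξ)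
      (𝓕 (fun x => ∑' i, transplantPiece G X θ φ t f i x) ξ) := by
  have := hφ.countable
  obtain ⟨B, hB⟩ := exists_isSummablyBounded_transplantPiece G X θ hφ
  exact (hB f hf).hasSum_fourier ξ

theorem tsum_transplantPiece_add (hφ : IsLocalizedBAPU P φ t b) {f g : FourierReservoir ℝ}
    (hf : f ∈ modulationSpace φ 1 1 le_rfl) (hg : g ∈ modulationSpace φ 1 1 le_rfl) :
    (fun x => ∑' i, transplantPiece G X θ φ t (f + g) i x) =
      (fun x => ∑' i, transplantPiece G X θ φ t f i x) +
        fun x => ∑' i, transplantPiece G X θ φ t g i x := by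
  obtain ⟨B, hB⟩ := exists_isSummablyBounded_transplantPiece G X θ hφ
  ext x
  rw [Pi.add_apply, ← ((hB f hf).summable_apply x).tsum_add ((hB g hg).summable_apply x)]
  exact tsum_congr fun i => add_mul _ _ _

theorem tsum_transplantPiece_smul (c : ℂ) (f : FourierReservoir ℝ) :
    (fun x => ∑' i, transplantPiece G X θ φ t (c • f) i x) =
      c • fun x => ∑' i, transplantPiece G X θ φ t f i x := by
  ext x
  rw [Pi.smul_apply, smul_eq_mul, ← tsum_mul_left]
  exact tsum_congr fun i => mul_assoc _ _ _

/-- The embedding of the Feichtinger algebra along the one-parameter subgroup of `X`: every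
frequency piece is transplanted and the results are summed. -/
noncomputable def transplant (hφ : IsLocalizedBAPU P φ t b) :
    modulationSpace φ 1 1 le_rfl →ₗ[ℂ] FourierReservoir E where
  toFun f := reservoirOfIntegrable _ (integrable_tsum_transplantPiece G X θ hφ f.2)
  map_add' f g := by
    rw [← reservoirOfIntegrable_add]
    congr 1
    exact tsum_transplantPiece_add G X θ hφ f.2 g.2
  map_smul' c f := by
    rw [RingHom.id_apply, ← reservoirOfIntegrable_smul]
    congr 1
    exact tsum_transplantPiece_smul G X θ c f

theorem hasFourierDensity_transplant (hφ : IsLocalizedBAPU P φ t b)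
    (f : modulationSpace φ 1 1 le_rfl) :
    HasFourierDensity (transplant G X θ hφ f)
      (𝓕 fun x => ∑' i, transplantPiece G X θ φ t (f : FourierReservoir ℝ) i x) :=
  hasFourierDensity_reservoirOfIntegrable (integrable_tsum_transplantPiece G X θ hφ f.2)

theorem tsum_transplantPiece_smul_of_orthogonal {x₀ : E} (hx₀ : ∀ y ∈ G.V₂, inner ℝ x₀ y = 0)
    (hX : inner ℝ X x₀ = 1) (s : ℝ) :
    ∑' i, transplantPiece G X θ φ t f i (s • x₀) =
      (∑' i, frequencyPiece (φ i) f s) * 𝓕⁻ (fun ξ => (θ ξ : ℂ)) (s • x₀) := by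
  rw [← tsum_mul_right]
  refine tsum_congr fun i => ?_
  rw [transplantPiece, inner_smul_right, hX, mul_one, G.window_of_orthogonal X θ (t i)]
  intro y hy
  rw [inner_smul_left, hx₀ y hy, mul_zero]

theorem IsLocalizedBAPU.eq_zero_of_tsum_frequencyPiece_eq_zero {E : Type*} [NormedAddCommGroup E]
    [InnerProductSpace ℝ E] [FiniteDimensional ℝ E] [MeasurableSpace E] [BorelSpace E]
    {P : ι → Set E} {φ : ι → 𝓓((⊤ : TopologicalSpace.Opens E), ℝ)} {t : ι → E}
    (hφ : IsLocalizedBAPU P φ t b) {f : FourierReservoir E}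
    (hf : f ∈ modulationSpace φ 1 1 le_rfl) (h0 : ∀ s, ∑' i, frequencyPiece (φ i) f s = 0) :
    f = 0 := by
  have := hφ.countable
  obtain ⟨h, hh, hfh⟩ := hφ.exists_continuous_hasFourierDensity hf
  have hh0 : h = 0 := funext fun ξ => by
    have hsum := (hφ.isSummablyBounded_frequencyPiece hf).hasSum_fourier ξ
    simp only [hfh.fourier_frequencyPiece hh (integrable_frequencyPiece_of_mem hf _), h0] at hsum
    have hone : HasSum (fun i => (φ i ξ : ℂ) * h ξ) (1 * h ξ) := by
      simpa using (Complex.ofRealCLM.hasSum (hφ.isBAPU.hasSum_one ξ)).mul_right (h ξ)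
    rw [← one_mul (h ξ), hone.unique hsum]
    exact congrFun fourier_zero_function ξ
  exact (hh0 ▸ hfh).eq_zero

/-- Along a line orthogonal to `V₂` the transplanted function is the original one times the inverse
Fourier transform of `θ`, whose zeros on the line are isolated. -/
theorem transplant_injective (hφ : IsLocalizedBAPU P φ t b) (hX : X ∉ G.V₂) (hθ : ∀ ξ, 0 ≤ θ ξ)
    (hθ' : 0 < ∫ ξ, θ ξ) : Function.Injective (transplant G X θ hφ) := by
  rw [injective_iff_map_eq_zero]
  intro f hf
  obtain ⟨x₀, hx₀, hX₀⟩ := exists_orthogonal_inner_eq_one hX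
  have hzero := congrFun (eq_zero_of_reservoirOfIntegrable_eq_zero
    (integrable_tsum_transplantPiece G X θ hφ f.2)
    (continuous_tsum_transplantPiece G X θ hφ f.2) hf)
  refine Subtype.ext (hφ.eq_zero_of_tsum_frequencyPiece_eq_zero f.2 fun s => ?_)
  by_contra hne
  have hcont := (hφ.isSummablyBounded_frequencyPiece f.2).continuous_tsum
  refine hθ'.ne' (integral_eq_zero_of_fourierInv_eventually_eq_zero θ.continuous
    θ.hasCompactSupport hθ (x₀ := x₀)
    ((hcont.continuousAt.eventually_ne hne).mono fun s' hs' => ?_))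
  have hprod := tsum_transplantPiece_smul_of_orthogonal G X θ (φ := φ) (t := t)
    (f := (f : FourierReservoir ℝ)) hx₀ hX₀ s'
  exact (mul_eq_zero.1 (hprod.symm.trans (hzero _))).resolve_left hs'

/-- On the Fourier side, transplanting integrates translates of the sheared windows along the
one-parameter subgroup against the density of `f`. -/
theorem exists_ball_of_fourier_transplantPiece_ne_zero (hφ : IsLocalizedBAPU P φ t b) {ν : E → ℝ}
    (hν : G.IsQuasiNorm ν) :
    ∃ R > 0, ∀ {f : FourierReservoir ℝ} {h : ℝ → ℂ}, Continuous h → HasFourierDensity f h →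
      ∀ i ξ, 𝓕 (transplantPiece G X θ φ t f i) ξ ≠ 0 →
        ∃ s, h s ≠ 0 ∧ |t i - s| ≤ b ∧ ξ ∈ G.ball ν (s • X) R := by
  obtain ⟨R, hR, hwindow⟩ := G.exists_ball_of_fourier_window_ne_zero X θ hν b
  refine ⟨R, hR, fun {f h} hh hfh i ξ hne => ?_⟩
  have hfourier : 𝓕 (transplantPiece G X θ φ t f i) ξ =
      ∫ s, ((φ i s : ℂ) * h s) * 𝓕 (G.window X θ (t i)) (ξ - s • X) := by
    rw [← fourier_inner_mul (integrable_testFunction_mul (φ i) hh) (G.integrable_window X θ (t i)),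
      ← hfh.frequencyPiece_eq_fourierInv]
    rfl
  by_contra! hnot
  refine hne (hfourier.trans (integral_eq_zero_of_ae (.of_forall fun s => ?_)))
  by_contra hs
  obtain ⟨hφh, hw⟩ := mul_ne_zero_iff.1 hs
  obtain ⟨hφs, hhs⟩ := mul_ne_zero_iff.1 hφh
  have hts : |t i - s| ≤ b := by
    rw [← Real.dist_eq, dist_comm]
    exact hφ.mem_closedBall_of_ne_zero (Complex.ofReal_ne_zero.1 hφs)
  exact hnot s hhs hts (hwindow s (t i) hts ξ hw)

theorem exists_tsum_eLpNorm_frequencyPiece_transplant_le (hφ : IsLocalizedBAPU P φ t b) {κ : Type*}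
    {ν : E → ℝ} (hν : G.IsQuasiNorm ν) {Q : κ → Set E} (hQ : G.IsUniformCovering ν Q)
    {ψ : κ → 𝓓((⊤ : TopologicalSpace.Opens E), ℝ)} (hψ : IsBAPU Q ψ) :
    ∃ C : ℝ≥0, ∀ f : modulationSpace φ 1 1 le_rfl, ∀ {p : ℝ}, 1 ≤ p →
      ∑' j, eLpNorm (frequencyPiece (ψ j) (transplant G X θ hφ f)) (ENNReal.ofReal p) volume ≤
        C * modulationNorm φ 1 1 (f : FourierReservoir ℝ) := by
  have := hφ.countable
  obtain ⟨B, hB⟩ := exists_isSummablyBounded_transplantPiece G X θ hφ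
  obtain ⟨R₁, -, hR₁⟩ := exists_ball_of_fourier_transplantPiece_ne_zero G X θ hφ hν
  obtain ⟨R₂, -, hR₂⟩ := hν.exists_smul_mem_ball_smul X b
  obtain ⟨R, -, hR⟩ := hν.exists_ball_trans R₂ R₁
  obtain ⟨C, hC⟩ := hQ.exists_tsum_eLpNorm_frequencyPiece_le (ι := ι) hν hψ R
  refine ⟨C * B, fun f {p} hp => ?_⟩
  obtain ⟨h, hh, hfh⟩ := hφ.exists_continuous_hasFourierDensity f.2
  refine (hC (hB f f.2) (c := fun i => t i • X) (fun i ξ hne => ?_) hp).trans_eq ?_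
  · obtain ⟨s, -, hs, hξ⟩ := hR₁ hh hfh i ξ hne
    exact hR _ _ _ (hR₂ s (t i) hs) hξ
  · rw [modulationNorm_one_one_eq_tsum_ofReal f.2, ENNReal.coe_mul, mul_assoc,
      ← ENNReal.tsum_mul_left (a := (B : ℝ≥0∞))]
    simp only [ENNReal.ofReal_mul B.coe_nonneg, ENNReal.ofReal_coe_nnreal]

theorem transplant_mem_modulationSpace (hφ : IsLocalizedBAPU P φ t b) {κ : Type*} {ν : E → ℝ}
    (hν : G.IsQuasiNorm ν) {Q : κ → Set E} (hQ : G.IsUniformCovering ν Q)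
    {ψ : κ → 𝓓((⊤ : TopologicalSpace.Opens E), ℝ)} (hψ : IsBAPU Q ψ) {p q : ℝ} (hp : 1 ≤ p)
    (hq : 1 ≤ q) (f : modulationSpace φ 1 1 le_rfl) :
    transplant G X θ hφ f ∈ modulationSpace ψ p q hq := by
  obtain ⟨C, hC⟩ := exists_tsum_eLpNorm_frequencyPiece_transplant_le G X θ hφ hν hQ hψ
  exact (hasFourierDensity_transplant G X θ hφ f).mem_modulationSpace
    (continuous_fourier_of_integrable (integrable_tsum_transplantPiece G X θ hφ f.2)) hq
    ((hC f hp).trans_lt (ENNReal.mul_lt_top ENNReal.coe_lt_top f.2.2))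

theorem exists_mem_ball_of_mem_essentialSupport_transplant (hφ : IsLocalizedBAPU P φ t b)
    {ι₀ κ : Type*} {Q₀ : ι₀ → Set ℝ} {ψ₀ : ι₀ → 𝓓((⊤ : TopologicalSpace.Opens ℝ), ℝ)}
    (hψ₀ : IsBAPU Q₀ ψ₀) {ν : E → ℝ} (hν : G.IsQuasiNorm ν) {Q : κ → Set E}
    (hQ : G.IsUniformCovering ν Q) {ψ : κ → 𝓓((⊤ : TopologicalSpace.Opens E), ℝ)}
    (hψ : IsBAPU Q ψ) {p₀ : ℝ} (hp₀ : 0 < p₀) (p : ℝ) :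
    ∃ ρ > 0, ∀ f : modulationSpace φ 1 1 le_rfl,
      ∀ z ∈ essentialSupport Q ψ p (transplant G X θ hφ f),
        ∃ s ∈ essentialSupport Q₀ ψ₀ p₀ (f : FourierReservoir ℝ), z ∈ G.ball ν (s • X) ρ := by
  obtain ⟨R, -, hR⟩ := exists_ball_of_fourier_transplantPiece_ne_zero G X θ hφ hν
  obtain ⟨r, -, hr⟩ := hQ.exists_mem_ball hν
  obtain ⟨ρ, hρ, htrans⟩ := hν.exists_ball_trans R r
  refine ⟨ρ, hρ, fun f z hz => ?_⟩
  obtain ⟨m, ξ, hξm, hzm, hne⟩ :=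
    (hasFourierDensity_transplant G X θ hφ f).exists_ne_zero_of_mem_essentialSupport hψ hz
  obtain ⟨h, hh, hfh⟩ := hφ.exists_continuous_hasFourierDensity f.2
  obtain ⟨i, hi⟩ : ∃ i, 𝓕 (transplantPiece G X θ φ t (f : FourierReservoir ℝ) i) ξ ≠ 0 := by
    by_contra! hzero
    have hsum := hasSum_fourier_transplantPiece G X θ hφ f.2 ξ
    simp only [hzero] at hsum
    exact hne (hsum.unique hasSum_zero)
  obtain ⟨s, hs, -, hξ⟩ := hR hh hfh i ξ hi
  exact ⟨s, hfh.mem_essentialSupport hh hψ₀ hp₀ hs, htrans _ ξ z hξ (hr m ξ hξm z hzm)⟩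

end Transplant

/-! ### The geometric embedding -/

theorem exists_comparison_trans {L₁ L₂ C₁ C₂ T : ℝ} (hL₁ : 0 < L₁) (hL₂ : 0 < L₂) (hC₁ : 0 < C₁)
    (hC₂ : 0 < C₂) (hT : 0 < T) :
    ∃ C > 0, ∀ {a b d d' : ℝ}, |a - b| ≤ T → 1 / L₁ * a - C₁ ≤ d ∧ d ≤ L₁ * a + C₁ →
      1 / L₂ * b - C₂ ≤ d' ∧ d' ≤ L₂ * b + C₂ →
        1 / (L₁ * L₂) * d - C ≤ d' ∧ d' ≤ L₁ * L₂ * d + C := by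
  refine ⟨(L₁ * T + C₁) / (L₁ * L₂) + C₂ + (L₂ * (L₁ * C₁ + T)), by positivity,
    fun {a b d d'} hab ⟨h₁, h₁'⟩ ⟨h₂, h₂'⟩ => ?_⟩
  obtain ⟨hab, hab'⟩ := abs_le.1 hab
  have ha : a ≤ L₁ * (d + C₁) := by
    rw [← div_le_iff₀' hL₁]
    linarith only [one_div_mul_eq_div L₁ a, h₁]
  have hb : b ≤ L₂ * (d' + C₂) := by
    rw [← div_le_iff₀' hL₂]
    linarith only [one_div_mul_eq_div L₂ b, h₂]
  constructor
  · have hd : d ≤ L₁ * (L₂ * (d' + C₂) + T) + C₁ := h₁'.trans (by gcongr; linarith)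
    calc 1 / (L₁ * L₂) * d - ((L₁ * T + C₁) / (L₁ * L₂) + C₂ + (L₂ * (L₁ * C₁ + T)))
        ≤ 1 / (L₁ * L₂) * (L₁ * (L₂ * (d' + C₂) + T) + C₁) -
            ((L₁ * T + C₁) / (L₁ * L₂) + C₂) :=
          sub_le_sub (by gcongr) (le_add_of_nonneg_right (by positivity))
      _ = d' := by
          field_simp
          ring
  · calc d' ≤ L₂ * (L₁ * (d + C₁) + T) + C₂ := h₂'.trans (by gcongr; linarith)
      _ = L₁ * L₂ * d + (C₂ + L₂ * (L₁ * C₁ + T)) := by ring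
      _ ≤ _ := by
          rw [add_assoc ((L₁ * T + C₁) / (L₁ * L₂))]
          exact add_le_add_right (le_add_of_nonneg_left (by positivity)) _

namespace ModulationData

section General

variable {E : Type*} [NormedAddCommGroup E] [InnerProductSpace ℝ E] [FiniteDimensional ℝ E]
  [MeasurableSpace E] [BorelSpace E] {G : StratifiedGroup E}

/-- On a trivial group the index set `N \ {0}` is empty, so nothing covers the origin. -/
theorem nontrivial (D : ModulationData G) : Nontrivial E := by
  by_contra h
  rw [not_nontrivial_iff_subsingleton] at h
  obtain ⟨m, -⟩ := mem_iUnion.1 (D.isAdmissible.covers ▸ mem_univ (0 : E))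
  exact m.2.2 (StratifiedGroup.Carrier.ext (Subsingleton.elim _ _))

theorem isUniformCovering_covering (D : ModulationData G) :
    StratifiedGroup.IsUniformCovering G D.ν D.covering :=
  StratifiedGroup.isUniformCovering_latticeCovering D.isQuasiNorm D.R_pos D.isAdmissible

theorem isUniformCovering_P (D : ModulationData G) :
    StratifiedGroup.IsUniformCovering G D.ν D.P :=
  have := D.nontrivial
  D.isAlphaCovering.isUniformCovering D.isQuasiNorm

end General

section Line

variable (D : ModulationData (StratifiedGroup.abelian ℝ))

theorem exists_abs_sub_le_of_mem_ball (R : ℝ) :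
    ∃ T > 0, ∀ x y : ℝ, y ∈ (StratifiedGroup.abelian ℝ).ball D.ν x R → |x - y| ≤ T := by
  obtain ⟨T, hT, hle⟩ := D.isQuasiNorm.exists_abs_le continuous_id R
  refine ⟨T, hT, fun x y hy => ?_⟩
  have hmul : (StratifiedGroup.abelian ℝ).mul (-x) y = y - x := by
    simp [StratifiedGroup.mul, StratifiedGroup.abelian, neg_add_eq_sub]
  rw [abs_sub_comm, ← hmul]
  exact hle _ hy

theorem exists_isLocalizedBAPU : ∃ t b, IsLocalizedBAPU D.P D.φ t b := by
  obtain ⟨R, hR⟩ := D.isUniformCovering_P.subset_ball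
  obtain ⟨b, -, hb⟩ := D.exists_abs_sub_le_of_mem_ball R
  choose t ht using hR
  refine ⟨t, b, D.isAlphaCovering.admissible, D.isAlphaCovering.isOpen, D.isBAPU_φ,
    fun i x hx => ?_⟩
  rw [Metric.mem_closedBall', Real.dist_eq]
  exact hb _ _ (ht i hx)

theorem exists_coveringDist_real_comparison :
    ∃ L > 0, ∃ C > 0, ∀ x y : ℝ, 1 / L * |x - y| - C ≤ coveringDist D.covering x y ∧
      coveringDist D.covering x y ≤ L * |x - y| + C := by
  have hone : (1 : ℝ) ∉ (StratifiedGroup.abelian ℝ).V₂ := fun h =>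
    one_ne_zero ((Submodule.mem_bot ℝ).1 h)
  obtain ⟨L, hL, hcomp⟩ :=
    D.isUniformCovering_covering.exists_coveringDist_comparison D.isQuasiNorm hone
  obtain ⟨C, hC, hcomp⟩ := hcomp 1
  have hself : ∀ x : ℝ, x ∈ (StratifiedGroup.abelian ℝ).ball D.ν (x • (1 : ℝ)) 1 := fun x => by
    rw [smul_eq_mul, mul_one]
    exact D.isQuasiNorm.mem_ball_self x one_pos
  exact ⟨L, hL, C, hC, fun x y => hcomp x y x (hself x) y (hself y)⟩

theorem exists_abs_sub_le_of_mem_starSet (k : ℕ) :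
    ∃ T > 0, ∀ i, ∀ x ∈ starSet D.covering i k, ∀ y ∈ starSet D.covering i k, |x - y| ≤ T := by
  obtain ⟨R, -, hR⟩ := D.isUniformCovering_covering.exists_ball_of_mem_starSet D.isQuasiNorm k
  obtain ⟨T, hT, hle⟩ := D.exists_abs_sub_le_of_mem_ball R
  exact ⟨T, hT, fun i x hx y hy => hle x y (hR i x hx y hy)⟩

end Line

end ModulationData

section Embedding

variable {E : Type*} [NormedAddCommGroup E] [InnerProductSpace ℝ E] [FiniteDimensional ℝ E]
  [MeasurableSpace E] [BorelSpace E] {G : StratifiedGroup E} {p q : ℝ}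
  {D : ModulationData (StratifiedGroup.abelian ℝ)} {D' : ModulationData G}

theorem exists_coveringDist_bounds_of_mem_ball_smul {F : D.space 1 1 le_rfl → FourierReservoir E}
    {X : E} (hX : X ∉ G.V₂) {ρ : ℝ}
    (hF : ∀ f, ∀ z ∈ D'.essSupp p (F f), ∃ s ∈ D.essSupp 1 (f : FourierReservoir ℝ),
      z ∈ G.ball D'.ν (s • X) ρ) :
    ∃ L : ℝ, 0 < L ∧ ∀ k : ℕ, ∃ C : ℝ, 0 < C ∧
      ∀ (i j) (f g : D.space 1 1 le_rfl),
        D.essSupp 1 (f : FourierReservoir ℝ) ⊆ starSet D.covering i k →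
        D.essSupp 1 (g : FourierReservoir ℝ) ⊆ starSet D.covering j k →
        ∀ x ∈ starSet D.covering i k, ∀ y ∈ starSet D.covering j k,
        ∀ z ∈ D'.essSupp p (F f), ∀ w ∈ D'.essSupp p (F g),
          1 / L * (coveringDist D.covering x y : ℝ) - C ≤ coveringDist D'.covering z w ∧
          (coveringDist D'.covering z w : ℝ) ≤ L * coveringDist D.covering x y + C := by
  obtain ⟨L₁, hL₁, C₁, hC₁, hline⟩ := D.exists_coveringDist_real_comparison
  obtain ⟨L₂, hL₂, hgroup⟩ :=
    D'.isUniformCovering_covering.exists_coveringDist_comparison D'.isQuasiNorm hX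
  obtain ⟨C₂, hC₂, hgroup⟩ := hgroup ρ
  refine ⟨L₁ * L₂, mul_pos hL₁ hL₂, fun k => ?_⟩
  obtain ⟨T, hT, hstar⟩ := D.exists_abs_sub_le_of_mem_starSet k
  obtain ⟨C, hC, htrans⟩ := exists_comparison_trans hL₁ hL₂ hC₁ hC₂ (add_pos hT hT)
  refine ⟨C, hC, fun i j f g hf hg x hx y hy z hz w hw => ?_⟩
  obtain ⟨s, hs, hzs⟩ := hF f z hz
  obtain ⟨s', hs', hws⟩ := hF g w hw
  refine htrans ?_ (hline x y) (hgroup s s' z hzs w hws)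
  calc |(|x - y| - |s - s'|)| ≤ |(x - y) - (s - s')| := abs_abs_sub_abs_le _ _
    _ = |(x - s) - (y - s')| := by rw [sub_sub_sub_comm]
    _ ≤ |x - s| + |y - s'| := abs_sub _ _
    _ ≤ T + T := add_le_add (hstar i x hx s (hf hs)) (hstar j y hy s' (hg hs'))

end Embedding

theorem corollary6p6_general {E : Type*} [NormedAddCommGroup E] [InnerProductSpace ℝ E]
    [FiniteDimensional ℝ E] [MeasurableSpace E] [BorelSpace E] {G : StratifiedGroup E} {p q : ℝ}
    (hp : 1 ≤ p) (hq : 1 ≤ q) (D : ModulationData (StratifiedGroup.abelian ℝ))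
    (D' : ModulationData G) :
    ∃ F : D.space 1 1 le_rfl →ₗ[ℂ] D'.space p q hq,
      IsGeometricEmbedding D D' 1 1 p q le_rfl hq F := by
  have := D'.nontrivial
  obtain ⟨X, -, hX⟩ := SetLike.exists_of_lt G.V₂_ne_top.lt_top
  obtain ⟨θ, hθ, hθpos⟩ := exists_testFunction_nonneg_integral_pos E
  obtain ⟨t, b, hφ⟩ := D.exists_isLocalizedBAPU
  obtain ⟨C, hC⟩ := exists_tsum_eLpNorm_frequencyPiece_transplant_le G X θ hφ D'.isQuasiNorm
    D'.isUniformCovering_P D'.isBAPU_φ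
  obtain ⟨ρ, -, hρ⟩ := exists_mem_ball_of_mem_essentialSupport_transplant G X θ hφ D.isBAPU_ψ
    D'.isQuasiNorm D'.isUniformCovering_covering D'.isBAPU_ψ one_pos p
  exact ⟨(transplant G X θ hφ).codRestrict (D'.space p q hq)
      (transplant_mem_modulationSpace G X θ hφ D'.isQuasiNorm D'.isUniformCovering_P D'.isBAPU_φ
        hp hq),
    fun f g h => transplant_injective G X θ hφ hX hθ hθpos (congrArg Subtype.val h),
    ⟨C, fun f => (modulationNorm_le_tsum_eLpNorm _ hq _).trans (hC f hp)⟩,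
    exists_coveringDist_bounds_of_mem_ball_smul hX hρ⟩

theorem corollary6p6 (n : ℕ) (hn : 0 < n) (G : StratifiedGroup (EuclideanSpace ℝ (Fin n)))
    (hG : G.IsRational) (p q : ℝ) (hp : 1 ≤ p) (hq : 1 ≤ q)
    (D : ModulationData (StratifiedGroup.abelian ℝ)) (D' : ModulationData G) :
    ∃ F : D.space 1 1 le_rfl →ₗ[ℂ] D'.space p q hq,
      IsGeometricEmbedding D D' 1 1 p q le_rfl hq F :=
  corollary6p6_general hp hq D D'
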